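/- Let $\mathbf{k}$ be a field of characteristic $0$ and let $Q$ be a quiver with vertex set $I$. Let $\overline{Q}$ be its double, with a reverse edge $e^*$ for each $e\in Q$, and put $(e^*)^*=e$. For $a\in\overline{Q}$ let $t(a),h(a)$ be its tail and head, and set $\epsilon(a)=1$ if $a\in Q$, $\epsilon(a)=-1$ if $a^*\in Q$. Let $L=P/[P,P]$, where $P$ is the path algebra of $\overline Q$; $L$ has as basis the necklaces, i.e. the closed paths $a_1\cdots a_l$ ($l\ge1$, $h(a_r)=t(a_{r+1})$, indices mod $l$) up to cyclic rotation and the vertex idempotents $v\in I$. All tensor products are over $\mathbf{k}[h]$. A collection of necklaces $P=a_{11}\cdots a_{1l_1}\,\&\cdots\&\,a_{k1}\cdots a_{kl_k}\,\&\,v_1\&\cdots\&v_q$ is a monomial of $\mathrm{Sym}\,L$ ($\&$ is the symmetric product). Its set of abstract edges is $X=\{(i,j)\}$, with $\mathrm{pr}(i,j)=a_{ij}$ and $(i,j)+1=(i,j+1)$, where $j+1$ is taken mod $l_i$. *Cutting and gluing.* A pairing of $P$ is a subset $J\subset X$ with an involution $\phi$ of $J$ such that $\mathrm{pr}(\phi(x))=\mathrm{pr}(x)^*$.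 Let $f:X\to X$ be $f(x)=\phi(x)+1$ for $x\in J$ and $f(x)=x+1$ for $x\notin J$. Each orbit $(x_1,\dots,x_p)$ of $f$ gives a necklace, the product of the $\mathrm{pr}(x_i)$ with $x_i\notin J$ (a vertex idempotent if all $x_i\in J$). These necklaces together with $v_1,\dots,v_q$ are the components $R_1,\dots,R_m$ of the result of cutting and gluing. The component of the start of $x$ is that of the orbit of $x$, and the component of the target of $x$ is that of the orbit of $x+1$. *Moyal operations on $(\mathrm{Sym}\,L)[h]$.* The product $P*_hR=e^{h\pi/2}(P\otimes R)$ is given by $\pi=\sum_{e\in Q}\partial_e\otimes\partial_{e^*}-\partial_{e^*}\otimes\partial_e$, where $\pi^N$ sums over all ordered choices of $N$ disjoint pairs $(x_i,y_i)$ with $x_i$ in $P$, $y_i$ in $R$ and $\mathrm{pr}(y_i)=\mathrm{pr}(x_i)^*$, cut and glued, with sign $\prod_i\epsilon(\mathrm{pr}(x_i))$. The coproduct $\Delta_h=e^{h\pi/2}$ is given by $\pi=\sum_{e\in Q}\partial_e\partial_{e^*}$, where $\pi^N P$ sums over all ordered choices of $N$ disjoint pairs $(x_i,y_i)$ of abstract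 edges of $P$ with $\mathrm{pr}(x_i)\in Q$, $\mathrm{pr}(y_i)=\mathrm{pr}(x_i)^*$, and over all $c\in\{1,2\}^m$, of $s_1\cdots s_N\,R_1^{c_1}\&\cdots\& R_m^{c_m}$. Here $R^{1}=R\otimes1$, $R^{2}=1\otimes R$, and $s_i=1,0,-1$ according as the number assigned by $c$ to the start of $x_i$ is less than, equal to, or greater than the one assigned to its target. Both are extended $\mathbf{k}[h]$-linearly. The unit is $1$ and the counit takes the constant term. *The bialgebra $A_h(Q)$.* A height assignment of $P$, $N=\#X$, is a bijection $H:X\to\{1,\dots,N\}$, and $P_H$ denotes $P$ with these heights. As a $\mathbf{k}[h]$-module $A_h(Q)$ is spanned by all $P_H$, modulo the following relations: if $x,y\in X$ have consecutive heights $H(y)=H(x)+1$ and $H'$ is $H$ with these two heights interchanged, then $P_H-P_{H'}=h\,\epsilon(\mathrm{pr}(x))\,P''$ if $\mathrm{pr}(y)=\mathrm{pr}(x)^*$, where $P''$ is the result of cutting and gluing along $\{x,y\}$ with the induced order of heights, and $P_H-P_{H'}=0$ otherwise. The product $P_H\cdot R_{H'}$ is the symmetric product with $R$ placed above $P$. The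 coproduct of $P_H$ is the sum, over all pairings $(J,\phi)$ and all $c\in\{1,2\}^m$ such that, whenever $x\in J$ and $H(x)<H(\phi(x))$, the start of $x$ is assigned $1$ and its target $2$, of $h^{\#J/2}\prod_{x\in J,\,H(x)<H(\phi(x))}\epsilon(\mathrm{pr}(x))$ times $R_1^{c_1}\&\cdots\& R_m^{c_m}$ with the induced heights in each tensor factor. The counit is $1$ on the empty collection and $0$ on all other $P_H$. Let $\Phi_W:(\mathrm{Sym}\,L)[h]\to A_h(Q)$ be the $\mathbf{k}[h]$-linear map $\Phi_W(P)=\frac1{N!}\sum_H P_H$. **Theorem.** 1. $*_h$, $\Delta_h$ and $\Phi_W$ do not depend on the way in which collections of necklaces are written. For all collections $P,R$ with sets of abstract edges $X,Y$: $$P*_hR=\sum_{(J_X,J_Y,\phi)}\Bigl(\frac h2\Bigr)^{\#J_X}(-1)^{\#(J_Y\cap \mathrm{pr}^{-1}(Q))}\,PR_{J_X,J_Y,\phi},$$ where $\phi:J_X\to J_Y$ runs over the bijections between subsets $J_X\subset X$ and $J_Y\subset Y$ with $\mathrm{pr}(\phi(x))=\mathrm{pr}(x)^*$, and $PR_{J_X,J_Y,\phi}$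 is the result of cutting and gluing $P\,\&\,R$ along $\phi$; and $$\Delta_h(P)=\sum_{(J,\phi)}\Bigl(\frac h2\Bigr)^{\#J/2}\sum_{c\in\{1,2\}^m}\Bigl(\prod_{x\in J,\ \mathrm{pr}(x)\in Q}s_x\Bigr)R_1^{c_1}\&\cdots\& R_m^{c_m},$$ over all pairings $(J,\phi)$ of $P$, with $s_x=1,0,-1$ defined for $x$ as $s_i$ is for $x_i$. 2. The coproduct and the counit of $A_h(Q)$ are well defined, and with them $A_h(Q)$ is a bialgebra over $\mathbf{k}[h]$. 3. $\Phi_W$ is an isomorphism of bialgebras from $((\mathrm{Sym}\,L)[h],*_h,\Delta_h)$ to $A_h(Q)$: it is bijective, $\Phi_W(1)=1$, $\Phi_W(f*_hg)=\Phi_W(f)\Phi_W(g)$, $\Delta(\Phi_W(f))=(\Phi_W\otimes\Phi_W)(\Delta_h(f))$, and it is compatible with the counits. 4. In particular $((\mathrm{Sym}\,L)[h],*_h,\Delta_h)$ is a bialgebra over $\mathbf{k}[h]$. -/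

import Mathlib

open scoped TensorProduct Polynomial

universe u v w x y

namespace NecklaceMoyal

/-! ### The double quiver, necklaces, and `(Sym L)[h]` -/

section Quiver

variable (V : Type u) [Quiver.{v} V]

/-- The edges of the double of the quiver `V`: `Sum.inl e` is the edge `e` of the quiver and
`Sum.inr e` is the reverse edge `e^*`. -/
abbrev DEdge : Type (max u v) := Quiver.Total V ⊕ Quiver.Total V

variable {V}

/-- The tail (starting vertex) of an edge of the double quiver. -/
def src : DEdge V → V := Sum.elim Quiver.Total.left Quiver.Total.right

/-- The head (end vertex) of an edge of the double quiver. -/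
def tgt : DEdge V → V := Sum.elim Quiver.Total.right Quiver.Total.left

/-- Edge reversal `a ↦ a^*`, with `(e^*)^* = e`. -/
def edgeRev (a : DEdge V) : DEdge V := a.swap

/-- The sign of an edge: `1` for an edge `e` of the quiver, `-1` for a reverse edge `e^*`.
This is the bracket `[a, a^*]`. -/
def edgeSign : DEdge V → ℤ := Sum.elim (fun _ => 1) (fun _ => -1)

theorem src_edgeRev (a : DEdge V) : src (edgeRev a) = tgt a := by cases a <;> rfl

theorem tgt_edgeRev (a : DEdge V) : tgt (edgeRev a) = src a := by cases a <;> rfl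

theorem edgeRev_edgeRev (a : DEdge V) : edgeRev (edgeRev a) = a := by cases a <;> rfl

variable (V)

/-- Closed paths of positive length in the double quiver, up to cyclic rotation.  Paths are
written so that each edge starts where the preceding one ends. -/
def CycWord : Type (max u v) :=
  {c : Cycle (DEdge V) // c ≠ Cycle.nil ∧ c.Chain fun a b => src b = tgt a}

/-- The basis of `L = P / [P, P]`: cyclic words and vertex idempotents. -/
abbrev Necklace : Type (max u v) := CycWord V ⊕ V

/-- `(Sym L)[h]`, as the polynomial algebra over `k[h]` on the basis of `L`. -/
abbrev SymL (k : Type w) [Field k] : Type (max u v w) := MvPolynomial (Necklace V) k[X]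

end Quiver

/-! ### First return maps -/

section FirstReturn

variable {X : Type x} [Finite X] (f : Equiv.Perm X) (S : X → Prop)

theorem exists_return (a : {a : X // S a}) : ∃ n, 0 < n ∧ S (f^[n] a.1) := by
  refine ⟨orderOf f, orderOf_pos f, ?_⟩
  rw [← Equiv.Perm.coe_pow, pow_orderOf_eq_one]
  exact a.2

open Classical in
/-- The least `n > 0` with `f^n a ∈ S`. -/
noncomputable def returnTime (a : {a : X // S a}) : ℕ := Nat.find (exists_return f S a)

theorem returnTime_pos (a : {a : X // S a}) : 0 < returnTime f S a := by
  classical exact (Nat.find_spec (exists_return f S a)).1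

theorem returnTime_spec (a : {a : X // S a}) : S (f^[returnTime f S a] a.1) := by
  classical exact (Nat.find_spec (exists_return f S a)).2

theorem not_of_lt_returnTime (a : {a : X // S a}) {n : ℕ} (h0 : 0 < n)
    (h : n < returnTime f S a) : ¬ S (f^[n] a.1) := by
  classical exact fun hs => Nat.find_min (exists_return f S a) h ⟨h0, hs⟩

theorem return_injective :
    Function.Injective fun a : {a : X // S a} =>
      (⟨f^[returnTime f S a] a.1, returnTime_spec f S a⟩ : {a : X // S a}) := by
  have key : ∀ a b : {a : X // S a}, returnTime f S a ≤ returnTime f S b →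
      f^[returnTime f S a] a.1 = f^[returnTime f S b] b.1 → a = b := by
    intro a b hle h
    obtain ⟨d, hd⟩ := Nat.exists_eq_add_of_le hle
    rw [hd, Function.iterate_add_apply] at h
    have h2 : a.1 = f^[d] b.1 := f.injective.iterate _ h
    rcases Nat.eq_zero_or_pos d with h0 | h0
    · subst h0
      exact Subtype.ext h2
    · refine absurd ?_ (not_of_lt_returnTime f S b h0 ?_)
      · rw [← h2]
        exact a.2
      · have := returnTime_pos f S a
        omega
  intro a b h
  have h' := congrArg Subtype.val h
  rcases le_total (returnTime f S a) (returnTime f S b) with hle | hle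
  · exact key a b hle h'
  · exact (key b a hle h'.symm).symm

/-- The first return map of the permutation `f` to the subset `S`, as a permutation of `S`. -/
noncomputable def firstReturn : Equiv.Perm {a : X // S a} :=
  Equiv.ofBijective _ (Finite.injective_iff_bijective.1 (return_injective f S))

theorem firstReturn_val (a : {a : X // S a}) :
    (firstReturn f S a).1 = f^[returnTime f S a] a.1 := rfl

end FirstReturn

/-! ### Collections of necklaces and their abstract edges -/

section Collection

variable (V : Type u) [Quiver.{v} V]

/-- A collection of necklaces
`a₁₁ ⋯ a₁ₗ & ⋯ & aₖ₁ ⋯ aₖₗ & v₁ & ⋯ & v_q`,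
presented by its finite set `X` of abstract edges, the permutation `next` of `X` sending an
abstract edge to the following one on the same necklace (so that the cyclic words are the cycles
of `next`), the projection `edge` to the edges of the double quiver, and the family `idem` of
vertex idempotents, indexed by a finite set `W`. -/
structure Collection (X : Type x) (W : Type y) where
  next : Equiv.Perm X
  edge : X → DEdge V
  src_next : ∀ a, src (edge (next a)) = tgt (edge a)
  idem : W → V

namespace Collection

variable {V} {X : Type x} {W : Type y} (P : Collection V X W)

section Value

variable [Finite X]

/-- The cyclic word read off along the cycle of `next` through the abstract edge `a`. -/
noncomputable def word (a : X) : CycWord V :=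
  ⟨(Function.periodicOrbit P.next a).map P.edge, by
    constructor
    · intro h
      have h1 := congrArg Cycle.length h
      have h2 : 0 < Function.minimalPeriod P.next a :=
        Function.minimalPeriod_pos_of_mem_periodicPts
          (P.next.injective.mem_periodicPts a)
      rw [Cycle.length_nil] at h1
      have h3 : ((Function.periodicOrbit P.next a).map P.edge).length
          = Function.minimalPeriod P.next a := by
        simp [Function.periodicOrbit]
      omega
    · rw [Cycle.chain_map, Function.periodicOrbit_chain]
      intro n _
      rw [Function.iterate_succ_apply']
      exact P.src_next _⟩

/-- The cyclic word of a cycle of `next`. -/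
noncomputable def cycleWord : Quotient (Equiv.Perm.SameCycle.setoid P.next) → CycWord V :=
  Quotient.lift P.word (by
    intro a b h
    obtain ⟨n, hn⟩ := Equiv.Perm.SameCycle.exists_nat_pow_eq h
    apply Subtype.ext
    show (Function.periodicOrbit P.next a).map P.edge
      = (Function.periodicOrbit P.next b).map P.edge
    rw [← hn, Equiv.Perm.coe_pow, Function.periodicOrbit_apply_iterate_eq
      (P.next.injective.mem_periodicPts a)])

noncomputable instance {f : Equiv.Perm X} :
    Fintype (Quotient (Equiv.Perm.SameCycle.setoid f)) := Fintype.ofFinite _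

/-- The element of `Sym L` given by a collection: the symmetric product of its necklaces and
vertex idempotents. -/
noncomputable def toSym [Fintype W] (k : Type w) [Field k] : SymL V k :=
  (∏ o, MvPolynomial.X (Sum.inl (P.cycleWord o))) * ∏ i, MvPolynomial.X (Sum.inr (P.idem i))

end Value

/-- The symmetric product of two collections; its abstract edges are the disjoint union. -/
def union {X' : Type*} {W' : Type*} (R : Collection V X' W') :
    Collection V (X ⊕ X') (W ⊕ W') where
  next := Equiv.Perm.sumCongr P.next R.next
  edge := Sum.elim P.edge R.edge
  src_next := by
    rintro (a | a)
    · exact P.src_next a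
    · exact R.src_next a
  idem := Sum.elim P.idem R.idem

/-! #### Cutting and gluing -/

/-- Pairings `(I, φ)`: an involution `φ` of a subset `I` of the abstract edges, matching each
edge with an occurrence of the reverse edge.  The involution is extended by the identity outside
`I`; as no edge is its own reverse, `I` is the set of points that are moved. -/
def Pairing : Type x :=
  {ψ : Equiv.Perm X // (∀ a, ψ (ψ a) = a) ∧ ∀ a, ψ a ≠ a → P.edge (ψ a) = edgeRev (P.edge a)}

variable {P}

/-- The permutation `f` of the abstract edges: it sends `a ∉ I` to the edge following `a` and
`a ∈ I` to the edge following `φ a`. -/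
def flow (ψ : P.Pairing) : Equiv.Perm X := P.next * ψ.1

/-- The orbits of `f`; each of them becomes a necklace or a vertex idempotent. -/
abbrev Orb (ψ : P.Pairing) : Type x := Quotient (Equiv.Perm.SameCycle.setoid (flow ψ))

/-- The orbit of an abstract edge, which is the component of the start of this edge. The
component of the target of `a` is `orb ψ (P.next a)`. -/
def orb (ψ : P.Pairing) (a : X) : Orb ψ := Quotient.mk _ a

theorem orb_iterate (ψ : P.Pairing) (a : X) (n : ℕ) : orb ψ ((flow ψ)^[n] a) = orb ψ a := by
  apply Quotient.sound
  show Equiv.Perm.SameCycle (flow ψ) _ _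
  rw [← Equiv.Perm.coe_pow]
  exact Equiv.Perm.sameCycle_pow_left.2 (Equiv.Perm.SameCycle.refl _ _)

/-- The components obtained by cutting and gluing along a pairing: the orbits of `f` and the
original vertex idempotents. -/
abbrev Comp (ψ : P.Pairing) : Type (max x y) := Orb ψ ⊕ W

/-- The abstract edges that remain, and whose component satisfies `q`, after cutting and gluing
along `ψ`: those outside `I` whose orbit satisfies `q`. -/
def Keep (ψ : P.Pairing) (q : Comp ψ → Prop) (a : X) : Prop :=
  ψ.1 a = a ∧ q (Sum.inl (orb ψ a))

/-- The components satisfying `q` that are vertex idempotents after cutting and gluing along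
`ψ`: original vertex idempotents, and orbits contained in `I`. -/
def KeepIdem (ψ : P.Pairing) (q : Comp ψ → Prop) (i : Comp ψ) : Prop :=
  q i ∧ ∀ a, i = Sum.inl (orb ψ a) → ψ.1 a ≠ a

/-- The collection formed by those components that satisfy `q` in the result of cutting and
gluing along `ψ`.  Each remaining abstract edge is followed by the next remaining one on its
orbit under `f`.  An orbit contained in `I` passes through a single vertex. -/
noncomputable def part [Finite X] (ψ : P.Pairing) (q : Comp ψ → Prop) :
    Collection V {a : X // Keep ψ q a} {i : Comp ψ // KeepIdem ψ q i} where
  next := firstReturn (flow ψ) (Keep ψ q)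
  edge a := P.edge a.1
  src_next := by
    intro a
    have key : ∀ n, n < returnTime (flow ψ) (Keep ψ q) a →
        src (P.edge ((flow ψ)^[n + 1] a.1)) = tgt (P.edge a.1) := by
      intro n
      induction n with
      | zero =>
        intro _
        show src (P.edge (P.next (ψ.1 a.1))) = _
        rw [a.2.1]
        exact P.src_next _
      | succ n ih =>
        intro hn
        rw [Function.iterate_succ_apply']
        have h1 := not_of_lt_returnTime (flow ψ) (Keep ψ q) a (Nat.succ_pos n) hn
        have h2 : ψ.1 ((flow ψ)^[n + 1] a.1) ≠ (flow ψ)^[n + 1] a.1 := by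
          intro h3
          refine h1 ⟨h3, ?_⟩
          rw [orb_iterate]
          exact a.2.2
        show src (P.edge (P.next (ψ.1 _))) = _
        rw [P.src_next, ψ.2.2 _ h2, tgt_edgeRev]
        exact ih (by omega)
    have hp := returnTime_pos (flow ψ) (Keep ψ q) a
    have := key (returnTime (flow ψ) (Keep ψ q) a - 1) (by omega)
    rw [Nat.sub_add_cancel hp] at this
    exact this
  idem i := Sum.elim (fun o => src (P.edge o.out)) P.idem i.1

/-- The result of cutting and gluing along a pairing. -/
noncomputable abbrev glue [Finite X] (ψ : P.Pairing) := part ψ fun _ => True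

variable (P)

/-- Ordered choices of `N` pairs `(x₁, y₁), …, (x_N, y_N)` of abstract edges, all `2N` of them
distinct, such that `yᵢ` is an occurrence of the reverse of `xᵢ`.  Here `xᵢ` is the value at
`Sum.inl i` and `yᵢ` the value at `Sum.inr i`. -/
def OrdPairing (N : ℕ) : Type x :=
  {ι : Fin N ⊕ Fin N ↪ X // ∀ i, P.edge (ι (Sum.inr i)) = edgeRev (P.edge (ι (Sum.inl i)))}

variable {P}

/-- The pairing that exchanges `xᵢ` and `yᵢ` for all `i`. -/
noncomputable def OrdPairing.toPairing {N : ℕ} (ι : P.OrdPairing N) : P.Pairing :=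
  ⟨Equiv.Perm.viaEmbedding (Equiv.sumComm (Fin N) (Fin N)) ι.1, by
    constructor
    · intro a
      by_cases ha : a ∈ Set.range ι.1
      · obtain ⟨s, rfl⟩ := ha
        rw [Equiv.Perm.viaEmbedding_apply, Equiv.Perm.viaEmbedding_apply]
        simp
      · rw [Equiv.Perm.viaEmbedding_apply_of_notMem _ _ _ ha,
          Equiv.Perm.viaEmbedding_apply_of_notMem _ _ _ ha]
    · intro a h
      by_cases ha : a ∈ Set.range ι.1
      · obtain ⟨s, rfl⟩ := ha
        rw [Equiv.Perm.viaEmbedding_apply]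
        rcases s with i | i
        · exact ι.2 i
        · show P.edge (ι.1 (Sum.inl i)) = _
          rw [ι.2 i, edgeRev_edgeRev]
      · exact absurd (Equiv.Perm.viaEmbedding_apply_of_notMem _ _ _ ha) h⟩

noncomputable instance [Finite X] : Fintype P.Pairing :=
  have : Finite P.Pairing := Subtype.finite
  Fintype.ofFinite _

noncomputable instance [Finite X] (N : ℕ) : Fintype (P.OrdPairing N) :=
  have : Finite (P.OrdPairing N) := Subtype.finite
  Fintype.ofFinite _

noncomputable instance [Finite X] [Finite W] (ψ : P.Pairing) : Fintype (Comp ψ → Fin 2) :=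
  Fintype.ofFinite _

noncomputable instance [Finite X] [Finite W] (ψ : P.Pairing) (q : Comp ψ → Prop) :
    Fintype {i : Comp ψ // KeepIdem ψ q i} :=
  Fintype.ofFinite _

noncomputable instance [Finite X] (ψ : P.Pairing) (q : Comp ψ → Prop) :
    Fintype {a : X // Keep ψ q a} :=
  Fintype.ofFinite _

end Collection

end Collection

/-! ### The Moyal product and coproduct on collections -/

section Moyal

variable {V : Type u} [Quiver.{v} V] (k : Type w) [Field k]

/-- `h / 2` in `k[h]`. -/
noncomputable def halfH : k[X] := Polynomial.C (2⁻¹ : k) * Polynomial.X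

namespace Collection

variable {X : Type x} {W : Type y} {X' : Type*} {W' : Type*}

open Classical in
/-- `π^N (P ⊗ R)` for `π = ∑ₑ ∂/∂e ⊗ ∂/∂e^* - ∂/∂e^* ⊗ ∂/∂e`: the sum over all ordered choices
of `x₁, …, x_N` in `P` and `y₁, …, y_N` in `R` with `yᵢ` the reverse of `xᵢ`, of the
product of the signs of the `xᵢ` times the result of cutting and gluing along them. -/
noncomputable def mulPow [Fintype X] [Fintype W] [Fintype X'] [Fintype W']
    (P : Collection V X W) (R : Collection V X' W') (N : ℕ) : SymL V k :=
  ∑ ι : (P.union R).OrdPairing N with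
      ∀ i, (ι.1 (Sum.inl i)).isLeft = true ∧ (ι.1 (Sum.inr i)).isRight = true,
    (∏ i, edgeSign ((P.union R).edge (ι.1 (Sum.inl i)))) • (glue ι.toPairing).toSym k

/-- `e^{hπ/2} (P ⊗ R) = ∑_N (h/2)^N / N! π^N (P ⊗ R)`; the terms with `N > #X` vanish. -/
noncomputable def mulExp [Fintype X] [Fintype W] [Fintype X'] [Fintype W']
    (P : Collection V X W) (R : Collection V X' W') : SymL V k :=
  ∑ N ∈ Finset.range (Fintype.card X + 1),
    (Polynomial.C ((N.factorial : k)⁻¹) * halfH k ^ N) • mulPow k P R N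

open Classical in
/-- The explicit expression of the Moyal product of two collections: the sum over all triples
`(I_X, I_Y, φ)` of `(h/2)^{#I_X} (-1)^{#(I_Y ∩ Q)}` times the result of cutting and gluing. -/
noncomputable def mulSum [Fintype X] [Fintype W] [Fintype X'] [Fintype W']
    (P : Collection V X W) (R : Collection V X' W') : SymL V k :=
  ∑ ψ : (P.union R).Pairing with ∀ z, ψ.1 z ≠ z → (ψ.1 z).isLeft ≠ z.isLeft,
    (halfH k ^ (Finset.univ.filter fun a : X => ψ.1 (Sum.inl a) ≠ Sum.inl a).card *
      (-1) ^ (Finset.univ.filter fun b : X' =>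
        ψ.1 (Sum.inr b) ≠ Sum.inr b ∧ (R.edge b).isLeft = true).card) • (glue ψ).toSym k

/-- The number `s_a`, for a component assignment `c`: `1` if the start of the arrow `a` is
assigned the first component and its target the second, `-1` in the opposite case, and `0` if
both are assigned the same component. -/
def arrowSign {P : Collection V X W} {ψ : P.Pairing} (c : Comp ψ → Fin 2) (a : X) : ℤ :=
  if c (Sum.inl (orb ψ a)) < c (Sum.inl (orb ψ (P.next a))) then 1
  else if c (Sum.inl (orb ψ a)) = c (Sum.inl (orb ψ (P.next a))) then 0
  else -1

/-- The tensor `R₁^{c₁} & ⋯ & R_m^{c_m}` in `(Sym L)[h] ⊗ (Sym L)[h]`. -/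
noncomputable def split [Fintype X] [Fintype W] {P : Collection V X W} (ψ : P.Pairing)
    (c : Comp ψ → Fin 2) : SymL V k ⊗[k[X]] SymL V k :=
  (part ψ fun i => c i = 0).toSym k ⊗ₜ (part ψ fun i => c i = 1).toSym k

open Classical in
/-- `π^N P` for the operator `π = ∑ₑ ∂/∂e ∂/∂e^*` from `Sym L` to `Sym L ⊗ Sym L`: the sum over
all ordered choices of `N` disjoint pairs `(xᵢ, yᵢ)`, with `xᵢ` in `Q` and `yᵢ` its reverse, and
over all component assignments `c`, of `s₁ ⋯ s_N R₁^{c₁} & ⋯ & R_m^{c_m}`. -/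
noncomputable def comulPow [Fintype X] [Fintype W] (P : Collection V X W) (N : ℕ) :
    SymL V k ⊗[k[X]] SymL V k :=
  ∑ ι : P.OrdPairing N with ∀ i, (P.edge (ι.1 (Sum.inl i))).isLeft = true,
    ∑ c : Comp ι.toPairing → Fin 2,
      (∏ i, arrowSign c (ι.1 (Sum.inl i))) • split k ι.toPairing c

/-- `e^{hπ/2} P = ∑_N (h/2)^N / N! π^N P`; the terms with `N > #X` vanish. -/
noncomputable def comulExp [Fintype X] [Fintype W] (P : Collection V X W) :
    SymL V k ⊗[k[X]] SymL V k :=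
  ∑ N ∈ Finset.range (Fintype.card X + 1),
    (Polynomial.C ((N.factorial : k)⁻¹) * halfH k ^ N) • comulPow k P N

open Classical in
/-- The explicit expression of the Moyal coproduct of a collection: the sum over all pairings
`(I, φ)` and all component assignments `c` of
`(h/2)^{#I/2} s(c, I, φ) R₁^{c₁} & ⋯ & R_m^{c_m}`. The cardinality of `I` is even. -/
noncomputable def comulSum [Fintype X] [Fintype W] (P : Collection V X W) :
    SymL V k ⊗[k[X]] SymL V k :=
  ∑ ψ : P.Pairing,
    halfH k ^ ((Finset.univ.filter fun a : X => ψ.1 a ≠ a).card / 2) •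
      ∑ c : Comp ψ → Fin 2,
        (∏ a : X with ψ.1 a ≠ a ∧ (P.edge a).isLeft = true, arrowSign c a) • split k ψ c

end Collection

end Moyal

/-! ### Collections with heights and the algebra `A_h(Q)` -/

section Heights

variable (V : Type u) [Quiver.{v} V]

/-- Collections of necklaces with heights, up to order preserving changes of the heights.  As
the heights of the `n` abstract edges are distinct, they can be taken to be the elements of
`Fin n`, and the abstract edges can be identified with their heights. -/
@[ext]
structure HColl where
  n : ℕ
  next : Equiv.Perm (Fin n)
  edge : Fin n → DEdge V
  src_next : ∀ a, src (edge (next a)) = tgt (edge a)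
  idem : Multiset V

variable {V}

/-- Equip a collection with the heights given by a bijection `H`. -/
def Collection.withHeights {X : Type x} {W : Type y} [Fintype W] (P : Collection V X W) {n : ℕ}
    (H : X ≃ Fin n) : HColl V where
  n := n
  next := H.permCongr P.next
  edge := P.edge ∘ H.symm
  src_next a := by simpa using P.src_next (H.symm a)
  idem := Finset.univ.val.map P.idem

namespace HColl

/-- Forget the heights: the abstract edges of a collection with heights. -/
noncomputable def toCollection (a : HColl V) :
    Collection V (Fin a.n) (Fin a.idem.toList.length) where
  next := a.next
  edge := a.edge
  src_next := a.src_next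
  idem := a.idem.toList.get

/-- Two collections with heights are equal when their data agree. -/
theorem ext_val {a b : HColl V} (hn : a.n = b.n)
    (h1 : ∀ i : Fin a.n, (a.next i : ℕ) = b.next (Fin.cast hn i))
    (h2 : ∀ i : Fin a.n, a.edge i = b.edge (Fin.cast hn i))
    (h3 : a.idem = b.idem) : a = b := by
  obtain ⟨n, f, e, _, v⟩ := a
  obtain ⟨m, f', e', _, v'⟩ := b
  obtain rfl : n = m := hn
  obtain rfl : f = f' := Equiv.ext fun i => Fin.ext (h1 i)
  obtain rfl : e = e' := funext h2
  obtain rfl : v = v' := h3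
  rfl

/-- The product of collections with heights: the symmetric product, with `b` placed above `a`. -/
def mul (a b : HColl V) : HColl V where
  n := a.n + b.n
  next := finSumFinEquiv.permCongr (Equiv.Perm.sumCongr a.next b.next)
  edge := Sum.elim a.edge b.edge ∘ finSumFinEquiv.symm
  src_next i := by
    obtain ⟨s, rfl⟩ := finSumFinEquiv.surjective i
    rcases s with s | s
    · simpa using a.src_next s
    · simpa using b.src_next s
  idem := a.idem + b.idem

/-- The empty collection. -/
def one : HColl V := ⟨0, 1, Fin.elim0, fun i => i.elim0, 0⟩

section MulLemmas

variable (a b c : HColl V)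

theorem mul_next_left (i : Fin a.n) (h : (i : ℕ) < (a.mul b).n) :
    ((a.mul b).next ⟨i, h⟩ : ℕ) = a.next i := by
  have : (⟨i, h⟩ : Fin (a.n + b.n)) = finSumFinEquiv (Sum.inl i) := by ext; simp
  show ((finSumFinEquiv.permCongr (Equiv.Perm.sumCongr a.next b.next))
    (⟨i, h⟩ : Fin (a.n + b.n)) : ℕ) = _
  rw [this]
  simp

theorem mul_next_right (i : Fin b.n) (h : a.n + (i : ℕ) < (a.mul b).n) :
    ((a.mul b).next ⟨a.n + i, h⟩ : ℕ) = a.n + b.next i := by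
  have : (⟨a.n + i, h⟩ : Fin (a.n + b.n)) = finSumFinEquiv (Sum.inr i) := by ext; simp
  show ((finSumFinEquiv.permCongr (Equiv.Perm.sumCongr a.next b.next))
    (⟨a.n + i, h⟩ : Fin (a.n + b.n)) : ℕ) = _
  rw [this]
  simp

theorem mul_edge_left (i : Fin a.n) (h : (i : ℕ) < (a.mul b).n) :
    (a.mul b).edge ⟨i, h⟩ = a.edge i := by
  have : (⟨i, h⟩ : Fin (a.n + b.n)) = finSumFinEquiv (Sum.inl i) := by ext; simp
  show (Sum.elim a.edge b.edge ∘ finSumFinEquiv.symm) (⟨i, h⟩ : Fin (a.n + b.n)) = _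
  rw [this]
  simp

theorem mul_edge_right (i : Fin b.n) (h : a.n + (i : ℕ) < (a.mul b).n) :
    (a.mul b).edge ⟨a.n + i, h⟩ = b.edge i := by
  have : (⟨a.n + i, h⟩ : Fin (a.n + b.n)) = finSumFinEquiv (Sum.inr i) := by ext; simp
  show (Sum.elim a.edge b.edge ∘ finSumFinEquiv.symm) (⟨a.n + i, h⟩ : Fin (a.n + b.n)) = _
  rw [this]
  simp

end MulLemmas

theorem mul_assoc_aux (a b c : HColl V) : (a.mul b).mul c = a.mul (b.mul c) := by
  have key : ∀ i : Fin ((a.mul b).mul c).n, ∀ h : (i : ℕ) < (a.mul (b.mul c)).n,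
      (((a.mul b).mul c).next i : ℕ) = (a.mul (b.mul c)).next ⟨i, h⟩ ∧
        ((a.mul b).mul c).edge i = (a.mul (b.mul c)).edge ⟨i, h⟩ := by
    rintro ⟨i, hi⟩ h
    have hi' : i < a.n + b.n + c.n := hi
    by_cases h1 : i < a.n
    · have h2 : i < (a.mul b).n := Nat.lt_add_right _ h1
      rw [mul_next_left (a.mul b) c ⟨i, h2⟩, mul_edge_left (a.mul b) c ⟨i, h2⟩,
        mul_next_left a b ⟨i, h1⟩, mul_edge_left a b ⟨i, h1⟩,
        mul_next_left a (b.mul c) ⟨i, h1⟩, mul_edge_left a (b.mul c) ⟨i, h1⟩]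
      exact ⟨rfl, rfl⟩
    · obtain ⟨d, rfl⟩ := Nat.exists_eq_add_of_le (not_lt.1 h1)
      by_cases h3 : d < b.n
      · have h2 : a.n + d < (a.mul b).n := Nat.add_lt_add_left h3 _
        have h4 : d < (b.mul c).n := Nat.lt_add_right _ h3
        rw [mul_next_left (a.mul b) c ⟨a.n + d, h2⟩, mul_edge_left (a.mul b) c ⟨a.n + d, h2⟩,
          mul_next_right a b ⟨d, h3⟩, mul_edge_right a b ⟨d, h3⟩,
          mul_next_right a (b.mul c) ⟨d, h4⟩, mul_edge_right a (b.mul c) ⟨d, h4⟩,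
          mul_next_left b c ⟨d, h3⟩, mul_edge_left b c ⟨d, h3⟩]
        exact ⟨rfl, rfl⟩
      · obtain ⟨p, rfl⟩ := Nat.exists_eq_add_of_le (not_lt.1 h3)
        have h5 : p < c.n := by omega
        have h4 : b.n + p < (b.mul c).n := Nat.add_lt_add_left h5 _
        have e1 := mul_next_right (a.mul b) c ⟨p, h5⟩ (Nat.add_lt_add_left h5 _)
        have e2 := mul_edge_right (a.mul b) c ⟨p, h5⟩ (Nat.add_lt_add_left h5 _)
        have hn : (a.mul b).n + p = a.n + (b.n + p) := Nat.add_assoc _ _ _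
        simp only [hn] at e1 e2
        rw [mul_next_right a (b.mul c) ⟨b.n + p, h4⟩, mul_edge_right a (b.mul c) ⟨b.n + p, h4⟩,
          mul_next_right b c ⟨p, h5⟩, mul_edge_right b c ⟨p, h5⟩, e1, e2]
        exact ⟨Nat.add_assoc _ _ _, rfl⟩
  exact ext_val (Nat.add_assoc _ _ _) (fun i => (key i _).1) (fun i => (key i _).2)
    (_root_.add_assoc _ _ _)

theorem one_mul_aux (a : HColl V) : one.mul a = a := by
  have hn : (one.mul a).n = a.n := Nat.zero_add _
  have key : ∀ i : Fin (one.mul a).n, ((one.mul a).next i : ℕ) = a.next (Fin.cast hn i) ∧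
      (one.mul a).edge i = a.edge (Fin.cast hn i) := by
    rintro ⟨i, hi⟩
    have h0 : (one : HColl V).n + i = i := Nat.zero_add _
    have h1 : i < a.n := hn ▸ hi
    have e1 := mul_next_right one a ⟨i, h1⟩ (by rw [h0]; exact hi)
    have e2 := mul_edge_right one a ⟨i, h1⟩ (by rw [h0]; exact hi)
    simp only [h0] at e1 e2
    rw [e1, e2]
    exact ⟨Nat.zero_add _, rfl⟩
  exact ext_val hn (fun i => (key i).1) (fun i => (key i).2) (zero_add _)

theorem mul_one_aux (a : HColl V) : a.mul one = a := by
  have hn : (a.mul one).n = a.n := Nat.add_zero _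
  have key : ∀ i : Fin (a.mul one).n, ((a.mul one).next i : ℕ) = a.next (Fin.cast hn i) ∧
      (a.mul one).edge i = a.edge (Fin.cast hn i) := by
    rintro ⟨i, hi⟩
    have h1 : i < a.n := hn ▸ hi
    rw [mul_next_left a one ⟨i, h1⟩, mul_edge_left a one ⟨i, h1⟩]
    exact ⟨rfl, rfl⟩
  exact ext_val hn (fun i => (key i).1) (fun i => (key i).2) (add_zero _)

instance : Monoid (HColl V) where
  mul := mul
  one := one
  mul_assoc := mul_assoc_aux
  one_mul := one_mul_aux
  mul_one := mul_one_aux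

/-- Interchange the heights `i` and `j`. -/
def interchange (a : HColl V) (i j : Fin a.n) : HColl V where
  n := a.n
  next := (Equiv.swap i j).permCongr a.next
  edge := a.edge ∘ Equiv.swap i j
  src_next x := by simpa using a.src_next (Equiv.swap i j x)
  idem := a.idem

/-- The pairing consisting of the edges of heights `i` and `j`. -/
noncomputable def swapPairing (a : HColl V) (i j : Fin a.n) (h : a.edge j = edgeRev (a.edge i)) :
    a.toCollection.Pairing :=
  ⟨Equiv.swap i j, by
    refine ⟨fun x => by simp, fun x hx => ?_⟩
    have hs : a.edge i = edgeRev (a.edge j) := by rw [h, edgeRev_edgeRev]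
    show a.edge (Equiv.swap i j x) = edgeRev (a.edge x)
    by_cases h1 : x = i
    · subst h1
      rw [Equiv.swap_apply_left]
      exact h
    · by_cases h2 : x = j
      · subst h2
        rw [Equiv.swap_apply_right]
        exact hs
      · exact absurd (Equiv.swap_apply_of_ne_of_ne h1 h2) hx⟩

end HColl

/-- The collection with heights given by a linear order on the abstract edges. -/
noncomputable def Collection.ordHeights {X : Type x} {W : Type y} [Fintype X] [LinearOrder X]
    [Fintype W] (P : Collection V X W) : HColl V :=
  P.withHeights (Fintype.orderIsoFinOfCardEq X rfl).symm.toEquiv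

variable (V) (k : Type w) [Field k]

/-- The defining relations of `A_h(Q)`, for a collection `a` with heights and two of its edges
of consecutive heights `i` and `j = i + 1`.  The difference of `a` and of `a` with these two
heights interchanged is `h [edge i, edge j]` times the collection obtained by deleting the two
edges and gluing their endpoints, with the induced order of heights. -/
inductive Rel : MonoidAlgebra k[X] (HColl V) → MonoidAlgebra k[X] (HColl V) → Prop
  | commute (a : HColl V) (i j : Fin a.n) (hij : (j : ℕ) = i + 1)
      (h : a.edge j ≠ edgeRev (a.edge i)) :
      Rel (MonoidAlgebra.of k[X] (HColl V) a)
        (MonoidAlgebra.of k[X] (HColl V) (a.interchange i j))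
  | contract (a : HColl V) (i j : Fin a.n) (hij : (j : ℕ) = i + 1)
      (h : a.edge j = edgeRev (a.edge i)) :
      Rel (MonoidAlgebra.of k[X] (HColl V) a)
        (MonoidAlgebra.of k[X] (HColl V) (a.interchange i j) +
          (edgeSign (a.edge i) • (Polynomial.X : k[X])) •
            MonoidAlgebra.of k[X] (HColl V)
              (Collection.glue (a.swapPairing i j h)).ordHeights)

/-- The `k[h]`-algebra `A_h(Q)`: spanned by collections of necklaces with heights, with the
product that places the second factor above the first one, modulo the defining relations. -/
abbrev AlgH : Type (max u v w) := RingQuot (Rel V k)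

variable {V}

/-- The class `P_H` in `A_h(Q)` of a collection with heights. -/
noncomputable def HColl.toAlg (a : HColl V) : AlgH V k :=
  RingQuot.mkAlgHom k[X] (Rel V k) (MonoidAlgebra.of k[X] (HColl V) a)

open Classical in
/-- The value of the coproduct of `A_h(Q)` on `P_H`.  It is the sum over all pairings `(I, φ)` and
all component assignments `c`, such that whenever `φ x = y` and `H x < H y` the start of `x` is
assigned the first component and its target the second, of `h^{#I/2}` times the product of the
signs of these `x`, times the result of cutting and gluing, with the induced heights and with its
components distributed to the two tensor factors according to `c`. -/
noncomputable def HColl.comul (a : HColl V) : AlgH V k ⊗[k[X]] AlgH V k :=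
  ∑ ψ : a.toCollection.Pairing,
    (Polynomial.X : k[X]) ^ ((Finset.univ.filter fun i => ψ.1 i ≠ i).card / 2) •
      ∑ c : Collection.Comp ψ → Fin 2 with ∀ i, i < ψ.1 i →
          c (Sum.inl (Collection.orb ψ i)) = 0 ∧ c (Sum.inl (Collection.orb ψ (a.next i))) = 1,
        (∏ i : Fin a.n with i < ψ.1 i, edgeSign (a.edge i)) •
          ((Collection.part ψ fun i => c i = 0).ordHeights.toAlg k ⊗ₜ[k[X]]
            (Collection.part ψ fun i => c i = 1).ordHeights.toAlg k)

open Classical in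
/-- The value of the counit of `A_h(Q)` on `P_H`: `1` on the empty collection, `0` otherwise. -/
noncomputable def HColl.counit (a : HColl V) : k[X] :=
  if a.n = 0 ∧ a.idem = 0 then 1 else 0

/-- The coproduct `D` and the counit `e` of `A_h(Q)` are the `k[h]`-linear maps with the values
above on the classes `P_H`, which span `A_h(Q)`. -/
def IsAlgHCoproduct (D : AlgH V k →ₗ[k[X]] AlgH V k ⊗[k[X]] AlgH V k)
    (e : AlgH V k →ₗ[k[X]] k[X]) : Prop :=
  ∀ a : HColl V, D (a.toAlg k) = a.comul k ∧ e (a.toAlg k) = a.counit k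

end Heights

/-! ### The operations on `(Sym L)[h]` and the symmetrization map -/

section Operations

variable {V : Type u} [Quiver.{v} V] (k : Type w) [Field k]

/-- A closed path representing a cyclic word. -/
noncomputable def CycWord.rep (c : CycWord V) : List (DEdge V) := Quotient.out c.1

theorem chain_finRotate {α : Type*} {r : α → α → Prop} {l : List α}
    (h : Cycle.Chain r (l : Cycle α)) (j : Fin l.length) :
    r (l.get j) (l.get (finRotate _ j)) := by
  cases l with
  | nil => exact j.elim0
  | cons a m =>
    rw [Cycle.chain_coe_cons, ← List.cons_append, List.isChain_iff_getElem] at h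
    have hj := h j.1 (by have := j.2; simp at this ⊢; omega)
    have hj2 : (j : ℕ) < m.length + 1 := j.2
    have hv : (finRotate (m.length + 1) j : ℕ) = if j = Fin.last m.length then (0 : ℕ) else j + 1 :=
      coe_finRotate j
    have e1 : (a :: m ++ [a])[j.1]'(by simp) = (a :: m).get j :=
      List.getElem_append_left j.2
    by_cases hl : j = Fin.last m.length
    · rw [if_pos hl] at hv
      have h0 : finRotate (m.length + 1) j = 0 := Fin.ext hv
      have e2 : (a :: m).get (finRotate _ j) = a := by
        show (a :: m).get (finRotate (m.length + 1) j) = a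
        rw [h0]
        rfl
      have e3 : (a :: m ++ [a])[j.1 + 1]'(by simp; omega) = a := by
        have : j.1 = m.length := by rw [hl]; rfl
        simp [this]
      rw [e1, e3] at hj
      rw [e2]
      exact hj
    · rw [if_neg hl] at hv
      have hlt : j.1 + 1 < (a :: m).length := by
        have := (finRotate (m.length + 1) j).2
        rw [hv] at this
        exact this
      have e3 : (a :: m ++ [a])[j.1 + 1]'(by simp; omega) = (a :: m).get (finRotate _ j) := by
        rw [List.getElem_append_left hlt]
        have : finRotate (a :: m).length j = ⟨j.1 + 1, hlt⟩ := Fin.ext hv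
        rw [this]
        rfl
      rw [e1, e3] at hj
      exact hj

/-- The collection `a₁₁ ⋯ a₁ₗ & ⋯ & aₖ₁ ⋯ aₖₗ & v₁ & ⋯ & v_q` given by lists of cyclic words and
of vertices.  Its abstract edges are the indices `(i, j)`, and `(i, j)` is followed by `(i, j + 1)`,
with `j + 1` taken modulo the length of the `i`-th word. -/
noncomputable def ofLists (c : List (CycWord V)) (d : List V) :
    Collection V (Σ i : Fin c.length, Fin (c.get i).rep.length) (Fin d.length) where
  next := Equiv.sigmaCongrRight fun i => finRotate _
  edge a := (c.get a.1).rep.get a.2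
  src_next a := by
    have h := (c.get a.1).2.2
    rw [show (c.get a.1).1 = ((c.get a.1).rep : Cycle _) from (Quotient.out_eq _).symm] at h
    exact chain_finRotate h a.2
  idem := d.get

/-- The list of necklaces of a monomial of `Sym L`, in some order. -/
noncomputable def necklaces (m : Necklace V →₀ ℕ) : List (Necklace V) :=
  (Finsupp.toMultiset m).toList

/-- A presentation of a monomial of `Sym L` as a collection. -/
noncomputable abbrev present (m : Necklace V →₀ ℕ) :=
  ofLists ((necklaces m).filterMap Sum.getLeft?) ((necklaces m).filterMap Sum.getRight?)

variable (V)

/-- The Moyal product `P *_h R = e^{hπ/2} (P ⊗ R)` on `(Sym L)[h]`. -/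
noncomputable def moyalMul : SymL V k →ₗ[k[X]] SymL V k →ₗ[k[X]] SymL V k :=
  (MvPolynomial.basisMonomials (Necklace V) k[X]).constr k[X] fun m =>
    (MvPolynomial.basisMonomials (Necklace V) k[X]).constr k[X] fun m' =>
      (present m).mulExp k (present m')

/-- The Moyal coproduct `Δ_h = e^{hπ/2}` on `(Sym L)[h]`. -/
noncomputable def moyalComul : SymL V k →ₗ[k[X]] SymL V k ⊗[k[X]] SymL V k :=
  (MvPolynomial.basisMonomials (Necklace V) k[X]).constr k[X] fun m => (present m).comulExp k

/-- The counit of `(Sym L)[h]`: it takes the constant coefficient. -/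
noncomputable def symCounit : SymL V k →ₗ[k[X]] k[X] :=
  (MvPolynomial.aeval fun _ => (0 : k[X])).toLinearMap

variable {V}

open Classical in
/-- The average `1 / N! ∑_H P_H` over all height assignments of a collection. -/
noncomputable def Collection.average {X : Type x} {W : Type y} [Fintype X] [Fintype W]
    (P : Collection V X W) : AlgH V k :=
  Polynomial.C (((Fintype.card X).factorial : k)⁻¹) •
    ∑ H : X ≃ Fin (Fintype.card X), (P.withHeights H).toAlg k

variable (V)

/-- The symmetrization map `Φ_W : (Sym L)[h] → A_h(Q)`. -/
noncomputable def symmetrization : SymL V k →ₗ[k[X]] AlgH V k :=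
  (MvPolynomial.basisMonomials (Necklace V) k[X]).constr k[X] fun m => (present m).average k

end Operations

/-! ### Bialgebras -/

/-- The structure maps `mul`, `one`, `comul`, `counit` make the `R`-module `B` an (associative,
unital, coassociative, counital) bialgebra over `R`. -/
structure IsBialgebra {R : Type x} {B : Type y} [CommRing R] [AddCommGroup B] [Module R B]
    (mul : B →ₗ[R] B →ₗ[R] B) (one : B) (comul : B →ₗ[R] B ⊗[R] B) (counit : B →ₗ[R] R) :
    Prop where
  mul_assoc : ∀ a b c, mul (mul a b) c = mul a (mul b c)
  one_mul : ∀ a, mul one a = a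
  mul_one : ∀ a, mul a one = a
  coassoc : ∀ a, TensorProduct.assoc R B B B (comul.rTensor B (comul a)) =
    comul.lTensor B (comul a)
  rTensor_counit_comul : ∀ a, counit.rTensor B (comul a) = 1 ⊗ₜ[R] a
  lTensor_counit_comul : ∀ a, counit.lTensor B (comul a) = a ⊗ₜ[R] 1
  comul_one : comul one = one ⊗ₜ[R] one
  comul_mul : ∀ a b, comul (mul a b) = TensorProduct.map₂ mul mul (comul a) (comul b)
  counit_one : counit one = 1
  counit_mul : ∀ a b, counit (mul a b) = counit a * counit b

end NecklaceMoyal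

namespace NecklaceMoyal

open Function

/-! ### Diagrams: permutations with labels -/

section Diagram

/-! Every operation in the theorem is brought to one form: a sum over the pairings of a fixed finite
set, where each pair carries a weight and the summand depends only on the result of gluing. For this
a collection is replaced by a permutation with labelled points (`Diagram`). Gluing along `ψ`
replaces `next` by `next * ψ` and relabels the moved points by vertices, which the words ignore; no
point is deleted. Hence gluing twice along disjoint pairings is gluing along their product
(`Diagram.glue_glue`), and composing two such sums adds the weights pair by pair
(`Diagram.psum_glue`, the expansion of a product of binomials). Vertex points can be dropped without
changing anything (`Diagram.Red`), which relates this picture to collections. The `N!` orderings of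
`N` pairs cancel the `1/N!` of the exponential (`Collection.sum_exp`), so the Moyal operations take
the required form (`Diagram.moyalMul_val`, `Diagram.moyalComul_val`).

The inverse of `Φ_W` is a Wick formula. `HColl.quant` sends `P_H` to the sum over all pairings, each
pair having weight `±h/2` with the sign of its lower member. Interchanging two consecutive heights
affects only the pair they might form: its weight changes sign, and the difference `±h` is exactly
the defining relation of `A_h(Q)`. If `R` lies above `P`, the pairs of the stacked collection lie in
`P`, in `R` or across, and the pairs across are those of the Moyal product (`Diagram.quant_or`); so
stacking goes to `*_h`. Averaged over all heights, every nonempty pairing cancels, because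
exchanging the heights of one pair reverses the sign (`Collection.sum_quant_withHeights`). Hence the
quantized collections span, associativity of `*_h` is inherited from stacking, `A_h(Q)` acts on
`(Sym L)[h]`, and evaluation at `1` is a left inverse of `Φ_W`. Surjectivity holds because, modulo
classes with fewer edges, `P_H` does not depend on `H`.

For the coproducts, an assignment of components is a 2-colouring that is constant on the cycles
after gluing. For a fixed colouring, and a pair `x` below `y` with `w = ±h/2` of the sign of `x`,
the coproduct of `A_h(Q)` followed by `quant ⊗ quant` gives the pair weight `2w`, `w` or `0`
according as the colour increases, stays or decreases from `x` to `y`. The Moyal coproduct after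
`quant` gives `w + s w` with `s = 1, 0, -1`, which is the same (`Diagram.sum_quant_tmul_quant`). So
the coproduct transported by `Φ_W` has the prescribed values.

The bialgebra axioms are proved on the Moyal side and transported. Both iterated coproducts are the
same sum over 3-colourings. For multiplicativity, a pair across the two factors has weight `w + s w`
on one side, and on the other side `w` for equal colours and `0` otherwise. These differ pair by
pair, but colours are conserved: if some crossing pair has unequal colours, then some crossing pair
has `s = -1`, and both products vanish (`Diagram.Flow.exists_lt`, `Diagram.prod_low_cross`). -/

/-- Source of a label: an edge or a vertex. -/
def lsrc {V : Type u} [Quiver.{v} V] : DEdge V ⊕ V → V := Sum.elim src id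

/-- Target of a label: an edge or a vertex. -/
def ltgt {V : Type u} [Quiver.{v} V] : DEdge V ⊕ V → V := Sum.elim tgt id

/-- Sign of a label; vertices get the sign `0`. -/
def lsign {V : Type u} [Quiver.{v} V] : DEdge V ⊕ V → ℤ := Sum.elim edgeSign fun _ => 0

/-- A finite permutation whose points are labelled by edges of the double quiver or by vertices.
Its cycles spell closed paths, in which the points labelled by vertices are ignored. -/
@[ext]
structure Diagram (V : Type u) [Quiver.{v} V] (X : Type) where
  next : Equiv.Perm X
  lab : X → DEdge V ⊕ V

theorem sameCycle_iff_iterate {X : Type*} [Finite X] {f : Equiv.Perm X} {a b : X} :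
    f.SameCycle a b ↔ ∃ n : ℕ, f^[n] a = b := by
  constructor
  · intro h
    obtain ⟨n, hn⟩ := h.exists_nat_pow_eq
    exact ⟨n, by rwa [← Equiv.Perm.coe_pow]⟩
  · rintro ⟨n, rfl⟩
    rw [← Equiv.Perm.coe_pow]
    exact Equiv.Perm.sameCycle_pow_right.2 (Equiv.Perm.SameCycle.refl _ _)

theorem sameCycle_out {X : Type*} (f : Equiv.Perm X) (x : X) :
    f.SameCycle (Quotient.mk (Equiv.Perm.SameCycle.setoid f) x).out x :=
  Quotient.exact (s := Equiv.Perm.SameCycle.setoid f) (Quotient.out_eq _)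

theorem isRotated_filterMap {α β : Type*} (g : α → Option β) {l l' : List α} (h : l ~r l') :
    l.filterMap g ~r l'.filterMap g := by
  obtain ⟨n, hn, rfl⟩ := List.isRotated_iff_mod.1 h
  rw [List.rotate_eq_drop_append_take hn, List.filterMap_append]
  conv_lhs => rw [← List.take_append_drop n l, List.filterMap_append]
  exact List.isRotated_append

variable {V : Type u} [Quiver.{v} V]

open Classical in
/-- The necklace with a given cyclic word; a vertex is given for the case of the empty word. -/
noncomputable def necklaceOf (C : Cycle (DEdge V)) (v : V) : Necklace V :=
  if h0 : C = Cycle.nil then Sum.inr v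
  else if h : C.Chain (fun a b => src b = tgt a) then Sum.inl ⟨C, h0, h⟩
  -- A default for words that are not composable. By proof irrelevance it does not depend on `v`, so
  -- that for a nonempty word the given vertex never matters.
  else Sum.inr (Classical.choice ⟨v⟩)

theorem necklaceOf_nil (v : V) : necklaceOf Cycle.nil v = Sum.inr v := by
  simp [necklaceOf]

theorem necklaceOf_coe (c : CycWord V) (v : V) : necklaceOf c.1 v = Sum.inl c := by
  rw [necklaceOf, dif_neg c.2.1, dif_pos c.2.2]
  rfl

theorem necklaceOf_congr {C : Cycle (DEdge V)} (h : C ≠ Cycle.nil) (v v' : V) :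
    necklaceOf C v = necklaceOf C v' := by
  simp only [necklaceOf, dif_neg h]

theorem edgeSign_edgeRev (a : DEdge V) : edgeSign (edgeRev a) = -edgeSign a := by
  cases a <;> rfl

theorem edgeRev_ne (a : DEdge V) : edgeRev a ≠ a := by
  cases a <;> simp [edgeRev]

namespace Diagram

variable {X : Type} (G : Diagram V X)

/-- Consecutive labels are composable. -/
def IsPath : Prop := ∀ x, lsrc (G.lab (G.next x)) = ltgt (G.lab x)

/-- The predicate `p` holds or fails on all of each cycle. -/
def Inv (p : X → Prop) : Prop := ∀ x, p (G.next x) ↔ p x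

/-- Points labelled by edges. -/
def Alive (x : X) : Prop := ∃ e, G.lab x = Sum.inl e

/-- The edges read off along the cycle of a point. -/
noncomputable def spell (x : X) : List (DEdge V) :=
  ((List.range (minimalPeriod G.next x)).map fun n => G.next^[n] x).filterMap
    fun z => (G.lab z).getLeft?

/-- The necklace of the cycle of a point. -/
noncomputable def neck (x : X) : Necklace V :=
  necklaceOf (G.spell x : Cycle (DEdge V)) (lsrc (G.lab x))

open Classical in
/-- The product of the necklaces of the cycles that satisfy `p`. -/
noncomputable def val [Finite X] (k : Type w) [Field k] (p : X → Prop) : SymL V k :=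
  ∏ o : Quotient (Equiv.Perm.SameCycle.setoid G.next),
    if p o.out then MvPolynomial.X (G.neck o.out) else 1

variable {G}

theorem Inv.iterate {p : X → Prop} (hp : G.Inv p) (n : ℕ) (x : X) : p (G.next^[n] x) ↔ p x := by
  induction n generalizing x with
  | zero => rfl
  | succ n ih => rw [iterate_succ_apply, ih, hp]

theorem Inv.sameCycle [Finite X] {p : X → Prop} (hp : G.Inv p) {x y : X}
    (h : G.next.SameCycle x y) : p x ↔ p y := by
  obtain ⟨n, rfl⟩ := sameCycle_iff_iterate.1 h
  exact (hp.iterate n x).symm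

theorem inv_true : G.Inv fun _ => True := fun _ => Iff.rfl

variable (G)

theorem mem_periodicPts [Finite X] (x : X) : x ∈ periodicPts G.next :=
  G.next.injective.mem_periodicPts x

theorem minimalPeriod_pos [Finite X] (x : X) : 0 < minimalPeriod G.next x :=
  minimalPeriod_pos_of_mem_periodicPts (G.mem_periodicPts x)

theorem spell_next [Finite X] (x : X) :
    (G.spell (G.next x) : Cycle (DEdge V)) = (G.spell x : Cycle (DEdge V)) := by
  have h := periodicOrbit_apply_eq (G.mem_periodicPts x)
  rw [periodicOrbit_def, periodicOrbit_def, Cycle.coe_eq_coe] at h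
  exact Cycle.coe_eq_coe.2 (isRotated_filterMap _ h)

variable {G}

theorem spell_ne_nil [Finite X] {x : X} (h : G.Alive x) :
    (G.spell x : Cycle (DEdge V)) ≠ Cycle.nil := by
  obtain ⟨e, he⟩ := h
  rw [Ne, Cycle.coe_eq_nil]
  refine List.ne_nil_of_mem (a := e) ?_
  rw [spell, List.mem_filterMap]
  refine ⟨x, List.mem_map.2 ⟨0, List.mem_range.2 (G.minimalPeriod_pos x), rfl⟩, by simp [he]⟩

/-- Moving the base point rotates the word, so only an empty word needs care. Then `x` is labelled
by a vertex, and composability gives the next point the same source. -/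
theorem IsPath.neck_next [Finite X] (hG : G.IsPath) (x : X) : G.neck (G.next x) = G.neck x := by
  rw [neck, neck, spell_next]
  by_cases h : (G.spell x : Cycle (DEdge V)) = Cycle.nil
  · have : ∃ v, G.lab x = Sum.inr v := by
      rcases hl : G.lab x with e | v
      · exact absurd h (spell_ne_nil ⟨e, hl⟩)
      · exact ⟨v, rfl⟩
    obtain ⟨v, hv⟩ := this
    rw [hG, hv]
    rfl
  · exact necklaceOf_congr h _ _

theorem IsPath.neck_sameCycle [Finite X] (hG : G.IsPath) {x y : X} (h : G.next.SameCycle x y) :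
    G.neck x = G.neck y := by
  obtain ⟨n, rfl⟩ := sameCycle_iff_iterate.1 h
  clear h
  induction n generalizing x with
  | zero => rfl
  | succ n ih => rw [iterate_succ_apply, ← ih, hG.neck_next]

/-- The value as a product over a system of representatives of the cycles. -/
theorem val_eq_prod [Finite X] (k : Type w) [Field k] (hG : G.IsPath) {p : X → Prop}
    (hp : G.Inv p) {ι : Type*} [Fintype ι] (r : ι → X) (hr : ∀ i, p (r i))
    (hinj : ∀ i i', G.next.SameCycle (r i) (r i') → i = i')
    (hsurj : ∀ x, p x → ∃ i, G.next.SameCycle x (r i)) :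
    G.val k p = ∏ i, MvPolynomial.X (G.neck (r i)) := by
  classical
  rw [val, ← Finset.prod_filter]
  symm
  refine Finset.prod_bij (fun i _ => Quotient.mk _ (r i)) ?_ ?_ ?_ ?_
  · intro i _
    rw [Finset.mem_filter]
    exact ⟨Finset.mem_univ _, (hp.sameCycle (sameCycle_out _ _)).2 (hr i)⟩
  · intro i _ i' _ h
    exact hinj i i' (Quotient.exact h)
  · intro o ho
    obtain ⟨i, hi⟩ := hsurj _ (Finset.mem_filter.1 ho).2
    refine ⟨i, Finset.mem_univ _, ?_⟩
    rw [← Quotient.out_eq o]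
    exact Quotient.sound hi.symm
  · intro i _
    congr 1
    exact hG.neck_sameCycle ((sameCycle_out _ _).symm)

variable {Y : Type}

/-- `G'` arises from the cycles of `G` that satisfy `p` by leaving out points labelled by
vertices, at least one point being kept on each cycle. -/
structure Red (j : Y → X) (G' : Diagram V Y) (G : Diagram V X) (p : X → Prop) : Prop where
  inj : Injective j
  mem : ∀ y, p (j y)
  lab_eq : ∀ y, G'.lab y = G.lab (j y)
  step : ∀ y, ∃ n, G.next^[n + 1] (j y) = j (G'.next y) ∧
    ∀ i, 0 < i → i ≤ n → G.next^[i] (j y) ∉ Set.range j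
  dead : ∀ x, p x → x ∉ Set.range j → ∃ v, G.lab x = Sum.inr v
  meets : ∀ x, p x → ∃ n, G.next^[n] x ∈ Set.range j

namespace Red

variable {j : Y → X} {G' : Diagram V Y} {p : X → Prop} (h : Red j G' G p)
include h

/-- Return times to the points that are kept. -/
theorem exists_time : ∃ T : Y → ℕ → ℕ, (∀ y, StrictMono (T y)) ∧ (∀ y, T y 0 = 0) ∧
    (∀ y m, G.next^[T y m] (j y) = j (G'.next^[m] y)) ∧
    (∀ y m i, T y m < i → i < T y (m + 1) → G.next^[i] (j y) ∉ Set.range j) := by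
  choose τ h1 h2 using h.step
  have key : ∀ y m, G.next^[∑ i ∈ Finset.range m, (τ (G'.next^[i] y) + 1)] (j y)
      = j (G'.next^[m] y) := by
    intro y m
    induction m with
    | zero => rfl
    | succ m ih =>
      rw [Finset.sum_range_succ, add_comm, iterate_add_apply, ih, h1, iterate_succ_apply']
  refine ⟨fun y m => ∑ i ∈ Finset.range m, (τ (G'.next^[i] y) + 1), ?_, fun y => rfl, key, ?_⟩
  · intro y
    refine strictMono_nat_of_lt_succ fun m => ?_
    dsimp only
    rw [Finset.sum_range_succ]
    omega
  · intro y m i hi hi'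
    dsimp only at hi hi'
    obtain ⟨d, rfl⟩ := Nat.exists_eq_add_of_lt hi
    rw [Finset.sum_range_succ] at hi'
    rw [show ∀ a : ℕ, a + d + 1 = (d + 1) + a by intro a; omega, iterate_add_apply, key]
    exact h2 _ _ (by omega) (by omega)

omit h in
-- Any visit to a kept point happens at a return time: with `m` least such that `M < T y (m + 1)`, a
-- visit strictly after `T y m` would contradict `h3`.
theorem exists_eq_time {T : Y → ℕ → ℕ} (hT : ∀ y, StrictMono (T y)) (h0 : ∀ y, T y 0 = 0)
    (h3 : ∀ y m i, T y m < i → i < T y (m + 1) → G.next^[i] (j y) ∉ Set.range j)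
    (y : Y) (M : ℕ) (hM : G.next^[M] (j y) ∈ Set.range j) : ∃ m, M = T y m := by
  have hex : ∃ m, M < T y (m + 1) := ⟨M, lt_of_lt_of_le (Nat.lt_succ_self M) ((hT y).le_apply)⟩
  classical
  have hs := Nat.find_spec hex
  refine ⟨Nat.find hex, ?_⟩
  by_contra hne
  have hle : T y (Nat.find hex) ≤ M := by
    rcases hm : Nat.find hex with _ | m
    · rw [h0]
      exact Nat.zero_le _
    · exact not_lt.1 (Nat.find_min hex (m := m) (by omega))
  exact h3 y _ M (lt_of_le_of_ne hle (Ne.symm hne)) hs hM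

/-- The period of `j y` is the return time belonging to the period of `y`. Between consecutive
return times only points labelled by vertices occur, and these are not read. -/
theorem spell_eq [Finite X] (hp : G.Inv p) (y : Y) : G'.spell y = G.spell (j y) := by
  obtain ⟨T, hT, h0, h1, h3⟩ := h.exists_time
  have : Finite Y := Finite.of_injective j h.inj
  have hper : minimalPeriod G.next (j y) = T y (minimalPeriod G'.next y) := by
    apply le_antisymm
    · refine IsPeriodicPt.minimalPeriod_le ?_ ?_
      · rw [← h0 y]
        exact hT y (G'.minimalPeriod_pos y)
      · rw [IsPeriodicPt, IsFixedPt, h1, iterate_minimalPeriod]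
    · obtain ⟨m, hm⟩ := exists_eq_time hT h0 h3 y (minimalPeriod G.next (j y))
        ⟨y, by rw [iterate_minimalPeriod]⟩
      rw [hm]
      refine (hT y).monotone (IsPeriodicPt.minimalPeriod_le ?_ ?_)
      · rcases Nat.eq_zero_or_pos m with rfl | hpos
        · rw [h0] at hm
          exact absurd hm (G.minimalPeriod_pos _).ne'
        · exact hpos
      · apply h.inj
        rw [← h1, ← hm, iterate_minimalPeriod]
  have key : ∀ m, ((List.range (T y m)).map fun n => G.next^[n] (j y)).filterMap
      (fun z => (G.lab z).getLeft?)
      = ((List.range m).map fun n => G'.next^[n] y).filterMap fun z => (G'.lab z).getLeft? := by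
    intro m
    induction m with
    | zero => simp [h0]
    | succ m ih =>
      have hlt := hT y (Nat.lt_succ_self m)
      obtain ⟨d, hd⟩ := Nat.exists_eq_add_of_lt hlt
      rw [Nat.succ_eq_add_one] at hd
      rw [List.range_succ, List.map_append, List.filterMap_append, ← ih, hd, add_assoc,
        List.range_add, List.map_append, List.filterMap_append]
      congr 1
      rw [List.range_succ_eq_map, List.map_cons, List.map_cons, add_zero]
      have hnil : (((List.map Nat.succ (List.range d)).map fun x => T y m + x).map
          fun n => G.next^[n] (j y)).filterMap (fun z => (G.lab z).getLeft?) = [] := by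
        rw [List.filterMap_eq_nil_iff]
        intro z hz
        simp only [List.map_map, List.mem_map, List.mem_range, comp_apply] at hz
        obtain ⟨i, hi, rfl⟩ := hz
        obtain ⟨v, hv⟩ := h.dead (G.next^[T y m + i.succ] (j y))
          ((hp.iterate _ _).2 (h.mem y)) (h3 y m _ (by omega) (by omega))
        rw [hv]
        rfl
      rw [show ∀ (a : X) (l : List X), a :: l = [a] ++ l from fun _ _ => rfl,
        List.filterMap_append, hnil, List.append_nil, List.map_singleton, h1, List.filterMap_cons,
        List.filterMap_cons, ← h.lab_eq]
      rfl
  rw [spell, spell, hper, key]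

theorem neck_eq [Finite X] (hp : G.Inv p) (y : Y) : G'.neck y = G.neck (j y) := by
  rw [neck, neck, h.spell_eq hp, h.lab_eq]

theorem sameCycle_iff [Finite X] {y y' : Y} :
    G.next.SameCycle (j y) (j y') ↔ G'.next.SameCycle y y' := by
  have : Finite Y := Finite.of_injective j h.inj
  obtain ⟨T, hT, h0, h1, h3⟩ := h.exists_time
  rw [sameCycle_iff_iterate, sameCycle_iff_iterate]
  constructor
  · rintro ⟨M, hM⟩
    obtain ⟨m, rfl⟩ := exists_eq_time hT h0 h3 y M ⟨y', hM.symm⟩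
    exact ⟨m, h.inj (by rw [← h1, hM])⟩
  · rintro ⟨m, rfl⟩
    exact ⟨T y m, h1 y m⟩

theorem isPath [Finite X] (hG : G.IsPath) (hp : G.Inv p) : G'.IsPath := by
  intro y
  obtain ⟨n, hn, hd⟩ := h.step y
  rw [h.lab_eq, h.lab_eq, ← hn]
  have key : ∀ i, i ≤ n → lsrc (G.lab (G.next^[i + 1] (j y))) = ltgt (G.lab (j y)) := by
    intro i
    induction i with
    | zero => intro _; exact hG _
    | succ i ih =>
      intro hi
      rw [iterate_succ_apply', hG, ← ih (by omega)]
      obtain ⟨v, hv⟩ := h.dead _ ((hp.iterate (i + 1) _).2 (h.mem y)) (hd _ (by omega) hi)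
      rw [hv]
      rfl
  exact key n le_rfl

theorem inv_comp {q : X → Prop} (hq : G.Inv q) : G'.Inv fun y => q (j y) := by
  intro y
  obtain ⟨n, hn, -⟩ := h.step y
  show q (j (G'.next y)) ↔ q (j y)
  rw [← hn, hq.iterate]

/-- Kept points serve as representatives of the cycles on both sides: every cycle in `p` meets them,
and two of them lie on one cycle of `G` exactly if they do in `G'`. -/
theorem val_eq_and [Finite X] [Finite Y] (k : Type w) [Field k] (hG : G.IsPath) (hp : G.Inv p)
    {q : X → Prop} (hq : G.Inv q) :
    G'.val k (fun y => q (j y)) = G.val k fun x => p x ∧ q x := by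
  classical
  have hG' := h.isPath hG hp
  have hq' := h.inv_comp hq
  have hinv : G.Inv fun x => p x ∧ q x := fun x => and_congr (hp x) (hq x)
  rw [val_eq_prod k hG' hq' (fun o : {o : Quotient (Equiv.Perm.SameCycle.setoid G'.next) //
      q (j o.out)} => o.1.out) (fun o => o.2) (fun i i' hi => by
      apply Subtype.ext
      rw [← Quotient.out_eq i.1, ← Quotient.out_eq i'.1]; exact Quotient.sound hi)
    (fun x hx => ⟨⟨Quotient.mk _ x, (hq'.sameCycle (sameCycle_out _ _)).2 hx⟩,
      (sameCycle_out _ _).symm⟩),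
    val_eq_prod k hG hinv (fun o : {o : Quotient (Equiv.Perm.SameCycle.setoid G'.next) //
      q (j o.out)} => j o.1.out) (fun o => ⟨h.mem _, o.2⟩) (fun i i' hi => by
      apply Subtype.ext
      rw [← Quotient.out_eq i.1, ← Quotient.out_eq i'.1]
      exact Quotient.sound (h.sameCycle_iff.1 hi))]
  · exact Finset.prod_congr rfl fun o _ => by rw [h.neck_eq hp]
  · intro x hx
    obtain ⟨n, y, hy⟩ := h.meets x hx.1
    have hxy : G.next.SameCycle x (j y) := sameCycle_iff_iterate.2 ⟨n, hy.symm⟩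
    have hy' : q (j y) := (hq.sameCycle hxy).1 hx.2
    refine ⟨⟨Quotient.mk _ y, (hq'.sameCycle (sameCycle_out _ _)).2 hy'⟩, ?_⟩
    exact hxy.trans (h.sameCycle_iff.2 (sameCycle_out _ _).symm)

theorem val_eq [Finite X] [Finite Y] (k : Type w) [Field k] (hG : G.IsPath) (hp : G.Inv p) :
    G'.val k (fun _ => True) = G.val k p := by
  rw [h.val_eq_and k hG hp inv_true]
  simp only [and_true]

end Red

end Diagram

end Diagram

end NecklaceMoyal

namespace NecklaceMoyal

open Function

/-! ### Cutting and gluing diagrams -/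

section Gluing

variable {V : Type u} [Quiver.{v} V]

namespace Diagram

variable {X : Type} (G : Diagram V X)

open Classical in
/-- Cut and glue along `ψ`.  The points moved by `ψ` remain as points labelled by vertices. -/
noncomputable def glue (ψ : Equiv.Perm X) : Diagram V X where
  next := G.next * ψ
  lab x := if ψ x = x then G.lab x else Sum.inr (lsrc (G.lab x))

/-- Involutions that match edges with reverse edges. -/
def IsPairing (ψ : Equiv.Perm X) : Prop :=
  (∀ x, ψ (ψ x) = x) ∧
    ∀ x, ψ x ≠ x → ∃ e, G.lab x = Sum.inl e ∧ G.lab (ψ x) = Sum.inl (edgeRev e)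

/-- The finite set of pairings. -/
noncomputable def pairings [Finite X] : Finset (Equiv.Perm X) :=
  (Set.toFinite {ψ | G.IsPairing ψ}).toFinset

/-- The points that are lower than their partners. -/
noncomputable def low [Finite X] (ht : X → ℕ) (ψ : Equiv.Perm X) : Finset X :=
  (Set.toFinite {x | ht x < ht (ψ x)}).toFinset

/-- The height function distinguishes points that can be paired. -/
def Separates (ht : X → ℕ) : Prop :=
  ∀ x y e, G.lab x = Sum.inl e → G.lab y = Sum.inl (edgeRev e) → ht x ≠ ht y

variable {G}

@[simp] theorem mem_pairings [Finite X] {ψ : Equiv.Perm X} : ψ ∈ G.pairings ↔ G.IsPairing ψ := by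
  simp [pairings]

@[simp] theorem mem_low [Finite X] {ht : X → ℕ} {ψ : Equiv.Perm X} {x : X} :
    x ∈ low ht ψ ↔ ht x < ht (ψ x) := by
  simp [low]

theorem ne_of_mem_low [Finite X] {ht : X → ℕ} {ψ : Equiv.Perm X} {x : X} (h : x ∈ low ht ψ) :
    ψ x ≠ x := by
  intro h'
  rw [mem_low, h'] at h
  exact lt_irrefl _ h

theorem Separates.lt_or_lt {ht : X → ℕ} (hs : G.Separates ht) {ψ : Equiv.Perm X}
    (hψ : G.IsPairing ψ) {x : X} (hx : ψ x ≠ x) : ht x < ht (ψ x) ∨ ht (ψ x) < ht (ψ (ψ x)) := by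
  obtain ⟨e, h1, h2⟩ := hψ.2 x hx
  rw [hψ.1]
  exact lt_or_gt_of_ne (hs x (ψ x) e h1 h2)

theorem isPairing_one : G.IsPairing 1 := ⟨fun _ => rfl, fun _ h => absurd rfl h⟩

theorem IsPairing.apply_ne {ψ : Equiv.Perm X} (hψ : G.IsPairing ψ) {x : X} (hx : ψ x ≠ x) :
    ψ (ψ x) ≠ ψ x := by
  rw [hψ.1]; exact hx.symm

@[simp] theorem glue_next_apply (ψ : Equiv.Perm X) (x : X) :
    (G.glue ψ).next x = G.next (ψ x) := rfl

theorem glue_lab_of_eq {ψ : Equiv.Perm X} {x : X} (h : ψ x = x) : (G.glue ψ).lab x = G.lab x :=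
  if_pos h

theorem glue_lab_of_ne {ψ : Equiv.Perm X} {x : X} (h : ψ x ≠ x) :
    (G.glue ψ).lab x = Sum.inr (lsrc (G.lab x)) :=
  if_neg h

theorem lsrc_glue_lab (ψ : Equiv.Perm X) (x : X) :
    lsrc ((G.glue ψ).lab x) = lsrc (G.lab x) := by
  by_cases h : ψ x = x
  · rw [glue_lab_of_eq h]
  · rw [glue_lab_of_ne h]; rfl

theorem glue_one : G.glue 1 = G := by
  ext x
  · rfl
  · exact glue_lab_of_eq rfl

theorem IsPath.glue {ψ : Equiv.Perm X} (hG : G.IsPath) (hψ : G.IsPairing ψ) :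
    (G.glue ψ).IsPath := by
  intro x
  rw [glue_next_apply, lsrc_glue_lab, hG]
  by_cases h : ψ x = x
  · rw [glue_lab_of_eq h, h]
  · obtain ⟨e, h1, h2⟩ := hψ.2 x h
    rw [glue_lab_of_ne h, h1, h2]
    exact tgt_edgeRev e

theorem Inv.glue {p : X → Prop} {ψ : Equiv.Perm X} (hp : G.Inv p) (hψ : ∀ x, p (ψ x) ↔ p x) :
    (G.glue ψ).Inv p := by
  intro x
  rw [glue_next_apply, hp, hψ]

theorem glue_lab_eq_inl {ψ : Equiv.Perm X} {x : X} {e : DEdge V} :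
    (G.glue ψ).lab x = Sum.inl e ↔ ψ x = x ∧ G.lab x = Sum.inl e := by
  by_cases h : ψ x = x
  · simp [glue_lab_of_eq h, h]
  · simp [glue_lab_of_ne h, h]

/-- Points that have been glued no longer carry edges, so they cannot be paired a second time. -/
theorem isPairing_glue {ψ₁ ψ₂ : Equiv.Perm X} :
    (G.glue ψ₁).IsPairing ψ₂ ↔ G.IsPairing ψ₂ ∧ ψ₁.Disjoint ψ₂ := by
  constructor
  · rintro ⟨h1, h2⟩
    refine ⟨⟨h1, fun x hx => ?_⟩, fun x => ?_⟩
    · obtain ⟨e, he, he'⟩ := h2 x hx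
      exact ⟨e, (glue_lab_eq_inl.1 he).2, (glue_lab_eq_inl.1 he').2⟩
    · by_cases hx : ψ₂ x = x
      · exact Or.inr hx
      · obtain ⟨e, he, -⟩ := h2 x hx
        exact Or.inl (glue_lab_eq_inl.1 he).1
  · rintro ⟨⟨h1, h2⟩, h⟩
    refine ⟨h1, fun x hx => ?_⟩
    obtain ⟨e, he, he'⟩ := h2 x hx
    refine ⟨e, glue_lab_eq_inl.2 ⟨(h x).resolve_right hx, he⟩,
      glue_lab_eq_inl.2 ⟨(h (ψ₂ x)).resolve_right ?_, he'⟩⟩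
    rw [h1]
    exact Ne.symm hx

/-- Because glued points are relabelled instead of deleted, this is an equality of diagrams on one
set of points. All statements on iterated operations rest on it. -/
theorem glue_glue {ψ₁ ψ₂ : Equiv.Perm X} (h : ψ₁.Disjoint ψ₂) :
    (G.glue ψ₁).glue ψ₂ = G.glue (ψ₁ * ψ₂) := by
  ext x
  · rfl
  · by_cases h2 : ψ₂ x = x
    · rw [glue_lab_of_eq h2]
      by_cases h1 : ψ₁ x = x
      · rw [glue_lab_of_eq h1, glue_lab_of_eq (h.mul_apply_eq_iff.2 ⟨h1, h2⟩)]
      · rw [glue_lab_of_ne h1, glue_lab_of_ne fun h' => h1 (h.mul_apply_eq_iff.1 h').1]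
    · rw [glue_lab_of_ne h2, lsrc_glue_lab,
        glue_lab_of_ne fun h' => h2 (h.mul_apply_eq_iff.1 h').2]

theorem mul_apply_left {ψ₁ ψ₂ : Equiv.Perm X} (h : ψ₁.Disjoint ψ₂) {x : X} (hx : ψ₁ x ≠ x) :
    (ψ₁ * ψ₂) x = ψ₁ x := by
  rw [Equiv.Perm.mul_apply, (h x).resolve_left hx]

theorem mul_apply_right {ψ₁ ψ₂ : Equiv.Perm X} (h : ψ₁.Disjoint ψ₂) {x : X} (hx : ψ₂ x ≠ x) :
    (ψ₁ * ψ₂) x = ψ₂ x := by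
  rw [h.commute.eq, mul_apply_left h.symm hx]

theorem IsPairing.mul {ψ₁ ψ₂ : Equiv.Perm X} (h₁ : G.IsPairing ψ₁) (h₂ : G.IsPairing ψ₂)
    (h : ψ₁.Disjoint ψ₂) : G.IsPairing (ψ₁ * ψ₂) := by
  constructor
  · intro x
    by_cases h1 : ψ₁ x = x
    · by_cases h2 : ψ₂ x = x
      · simp [h1, h2]
      · rw [mul_apply_right h h2, mul_apply_right h (h₂.apply_ne h2), h₂.1]
    · rw [mul_apply_left h h1, mul_apply_left h (h₁.apply_ne h1), h₁.1]
  · intro x hx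
    by_cases h1 : ψ₁ x = x
    · by_cases h2 : ψ₂ x = x
      · simp [h1, h2] at hx
      · rw [mul_apply_right h h2]
        exact h₂.2 x h2
    · rw [mul_apply_left h h1]
      exact h₁.2 x h1

theorem Separates.glue {ht : X → ℕ} (hs : G.Separates ht) (ψ : Equiv.Perm X) :
    (G.glue ψ).Separates ht := by
  intro x y e hx hy
  exact hs x y e (glue_lab_eq_inl.1 hx).2 (glue_lab_eq_inl.1 hy).2

open Classical in
/-- The part of an involution that consists of the pairs meeting `s`. -/
noncomputable def restr (ψ : Equiv.Perm X) (s : Set X) : Equiv.Perm X :=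
  -- For an involution `ψ` the condition always holds, since it is symmetric in `x` and `ψ x`; the
  -- value `1` is only a default.
  if h : Involutive fun x => if x ∈ s ∨ ψ x ∈ s then ψ x else x then h.toPerm else 1

theorem restr_apply_pos {ψ : Equiv.Perm X} (hψ : ∀ x, ψ (ψ x) = x) {s : Set X} {x : X}
    (hx : x ∈ s ∨ ψ x ∈ s) : restr ψ s x = ψ x := by
  classical
  have h : Involutive fun x => if x ∈ s ∨ ψ x ∈ s then ψ x else x := by
    intro x
    by_cases h : x ∈ s ∨ ψ x ∈ s
    · simp only [if_pos h]
      rw [if_pos (by rw [hψ]; exact h.symm), hψ]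
    · simp only [if_neg h]
  rw [restr, dif_pos h]
  exact if_pos hx

theorem restr_apply_neg {ψ : Equiv.Perm X} {s : Set X} {x : X}
    (hx : ¬ (x ∈ s ∨ ψ x ∈ s)) : restr ψ s x = x := by
  classical
  rw [restr]
  split_ifs with h
  · exact if_neg hx
  · rfl

theorem IsPairing.restr {ψ : Equiv.Perm X} (hψ : G.IsPairing ψ) (s : Set X) :
    G.IsPairing (restr ψ s) := by
  constructor
  · intro x
    by_cases h : x ∈ s ∨ ψ x ∈ s
    · rw [restr_apply_pos hψ.1 h, restr_apply_pos hψ.1 (by rw [hψ.1]; exact h.symm), hψ.1]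
    · rw [restr_apply_neg h, restr_apply_neg h]
  · intro x hx
    by_cases h : x ∈ s ∨ ψ x ∈ s
    · rw [restr_apply_pos hψ.1 h] at hx ⊢
      exact hψ.2 x hx
    · exact absurd (restr_apply_neg h) hx

/-! ### Weighted sums over pairings -/

section Sums

variable [Finite X] {R M N : Type*} [CommRing R] [AddCommGroup M] [Module R M]
  [AddCommGroup N] [Module R N]

/-- The sum of `F ψ` over all pairings, each pair `{x, y}` with `x` below `y` being weighted
by `a x y`. -/
noncomputable def psum (G : Diagram V X) (ht : X → ℕ) (a : X → X → R) (F : Equiv.Perm X → M) : M :=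
  ∑ ψ ∈ G.pairings, (∏ x ∈ low ht ψ, a x (ψ x)) • F ψ

/-- A pairing with a vanishing factor contributes nothing, so the summands need only be compared
where all weights are nonzero. In this way the support of a weight restricts the pairings to be
considered. -/
theorem psum_congr {ht : X → ℕ} {a a' : X → X → R} {F F' : Equiv.Perm X → M}
    (ha : ∀ ψ, G.IsPairing ψ → ∏ x ∈ low ht ψ, a x (ψ x) = ∏ x ∈ low ht ψ, a' x (ψ x))
    (hF : ∀ ψ, G.IsPairing ψ → (∀ x ∈ low ht ψ, a x (ψ x) ≠ 0) → F ψ = F' ψ) :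
    psum G ht a F = psum G ht a' F' := by
  refine Finset.sum_congr rfl fun ψ hψ => ?_
  rw [mem_pairings] at hψ
  by_cases h : ∀ x ∈ low ht ψ, a x (ψ x) ≠ 0
  · rw [← ha ψ hψ, hF ψ hψ h]
  · push Not at h
    obtain ⟨x, hx, h0⟩ := h
    rw [← ha ψ hψ, Finset.prod_eq_zero hx h0, zero_smul, zero_smul]

theorem map_psum (L : M →ₗ[R] N) (ht : X → ℕ) (a : X → X → R) (F : Equiv.Perm X → M) :
    L (psum G ht a F) = psum G ht a fun ψ => L (F ψ) := by
  simp only [psum, map_sum, map_smul]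

theorem low_mul {ht : X → ℕ} {ψ₁ ψ₂ : Equiv.Perm X} (h : ψ₁.Disjoint ψ₂) [DecidableEq X] :
    low ht (ψ₁ * ψ₂) = low ht ψ₁ ∪ low ht ψ₂ := by
  ext x
  rw [Finset.mem_union, mem_low, mem_low, mem_low]
  by_cases h1 : ψ₁ x = x
  · by_cases h2 : ψ₂ x = x
    · simp [h1, h2]
    · rw [mul_apply_right h h2, h1]
      simp
  · rw [mul_apply_left h h1, (h x).resolve_left h1]
    simp

theorem disjoint_low {ht : X → ℕ} {ψ₁ ψ₂ : Equiv.Perm X} (h : ψ₁.Disjoint ψ₂) :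
    Disjoint (low ht ψ₁) (low ht ψ₂) :=
  Finset.disjoint_left.2 fun x h1 h2 =>
    (h x).elim (fun h' => ne_of_mem_low h1 h') fun h' => ne_of_mem_low h2 h'

/-- A pairing together with a pairing of the result of gluing is a pairing whose pairs are
distributed to two kinds. -/
theorem psum_glue {ht : X → ℕ} (hs : G.Separates ht) (a b : X → X → R) (F : Equiv.Perm X → M) :
    psum G ht a (fun ψ₁ => psum (G.glue ψ₁) ht b fun ψ₂ => F (ψ₁ * ψ₂))
      = psum G ht (fun x y => a x y + b x y) F := by
  classical
  -- Expanding the product of the sums `a + b` amounts to choosing the set `t` of lower points whose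
  -- pairs take the weight `a`.
  simp only [psum, Finset.prod_add, Finset.sum_smul, Finset.smul_sum, smul_smul]
  rw [Finset.sum_sigma', Finset.sum_sigma']
  have hmoved : ∀ {K : Equiv.Perm X}, G.IsPairing K → ∀ {x}, K x ≠ x →
      x ∈ low ht K ∨ K x ∈ low ht K := by
    intro K hK x hx
    simpa using hs.lt_or_lt hK hx
  -- Pairs `(ψ₁, ψ₂)` of disjoint pairings correspond to pairs `(K, t)`: `K` is the product and `t`
  -- the set of lower points of `ψ₁`. Conversely, `K` is divided into the pairs with lower member in
  -- `t` and the others.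
  refine Finset.sum_bij' (fun s _ => ⟨s.1 * s.2, low ht s.1⟩)
    (fun s _ => ⟨restr s.1 s.2, restr s.1 ↑(low ht s.1 \ s.2)⟩) ?_ ?_ ?_ ?_ ?_
  · rintro ⟨ψ₁, ψ₂⟩ h
    simp only [Finset.mem_sigma, mem_pairings, isPairing_glue, Finset.mem_powerset] at h ⊢
    exact ⟨h.1.mul h.2.1 h.2.2, by rw [low_mul h.2.2]; exact Finset.subset_union_left⟩
  · rintro ⟨K, t⟩ h
    simp only [Finset.mem_sigma, mem_pairings, isPairing_glue, Finset.mem_powerset] at h ⊢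
    refine ⟨h.1.restr _, h.1.restr _, fun x => ?_⟩
    by_cases hx : x ∈ t ∨ K x ∈ t
    · right
      refine restr_apply_neg ?_
      rw [Finset.mem_coe, Finset.mem_coe, Finset.mem_sdiff, Finset.mem_sdiff, mem_low, mem_low,
        h.1.1]
      rcases hx with hx | hx
      · have h2 := mem_low.1 (h.2 hx)
        rintro (h' | h')
        · exact h'.2 hx
        · exact absurd h2 (not_lt.2 h'.1.le)
      · have h2 := mem_low.1 (h.2 hx)
        rw [h.1.1] at h2
        rintro (h' | h')
        · exact absurd h2 (not_lt.2 h'.1.le)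
        · exact h'.2 hx
    · exact Or.inl (restr_apply_neg hx)
  · rintro ⟨ψ₁, ψ₂⟩ h
    simp only [Finset.mem_sigma, mem_pairings, isPairing_glue] at h
    obtain ⟨h1, h2, h⟩ := h
    have hK := h1.mul h2 h
    have e1 : ∀ {φ φ' : Equiv.Perm X}, G.IsPairing φ → G.IsPairing φ' → φ.Disjoint φ' →
        restr (φ * φ') ↑(low ht φ) = φ := by
      intro φ φ' hφ hφ' hd
      ext x
      by_cases hx : φ x = x
      · rw [restr_apply_neg, hx]
        rw [Finset.mem_coe, Finset.mem_coe]
        rintro (h' | h')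
        · exact ne_of_mem_low h' hx
        · by_cases hx' : φ' x = x
          · rw [hd.mul_apply_eq_iff.2 ⟨hx, hx'⟩] at h'
            exact ne_of_mem_low h' hx
          · rw [mul_apply_right hd hx'] at h'
            exact hφ'.apply_ne hx' ((hd _).resolve_left (ne_of_mem_low h'))
      · rw [restr_apply_pos (hφ.mul hφ' hd).1, mul_apply_left hd hx]
        rw [mul_apply_left hd hx, Finset.mem_coe, Finset.mem_coe]
        exact hmoved hφ hx
    have e2 : low ht (ψ₁ * ψ₂) \ low ht ψ₁ = low ht ψ₂ := by
      rw [low_mul h]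
      exact Finset.union_sdiff_cancel_left (disjoint_low h)
    simp only [e2, e1 h1 h2 h]
    rw [h.commute.eq, e1 h2 h1 h.symm]
  · rintro ⟨K, t⟩ h
    simp only [Finset.mem_sigma, mem_pairings, Finset.mem_powerset] at h
    obtain ⟨hK, ht'⟩ := h
    have e1 : restr K ↑t * restr K ↑(low ht K \ t) = K := by
      ext x
      rw [Equiv.Perm.mul_apply]
      by_cases hx : K x = x
      · rw [restr_apply_neg (x := x), restr_apply_neg, hx]
        · rw [hx]
          rintro (h' | h') <;> exact ne_of_mem_low (ht' h') hx
        · rw [hx]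
          rintro (h' | h') <;> exact ne_of_mem_low (Finset.mem_sdiff.1 h').1 hx
      · by_cases hx' : x ∈ t ∨ K x ∈ t
        · rw [restr_apply_neg (s := (↑(low ht K \ t) : Set X)), restr_apply_pos hK.1 hx']
          rw [Finset.mem_coe, Finset.mem_coe, Finset.mem_sdiff, Finset.mem_sdiff, mem_low, mem_low,
            hK.1]
          rcases hx' with hx' | hx'
          · have h2 := mem_low.1 (ht' hx')
            rintro (h' | h')
            · exact h'.2 hx'
            · exact absurd h2 (not_lt.2 h'.1.le)
          · have h2 := mem_low.1 (ht' hx')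
            rw [hK.1] at h2
            rintro (h' | h')
            · exact absurd h2 (not_lt.2 h'.1.le)
            · exact h'.2 hx'
        · rw [restr_apply_pos hK.1 (s := (↑(low ht K \ t) : Set X)), restr_apply_neg]
          · rw [hK.1]
            exact fun h' => hx' h'.symm
          · push Not at hx'
            rw [Finset.mem_coe, Finset.mem_coe, Finset.mem_sdiff, Finset.mem_sdiff]
            exact (hmoved hK hx).imp (fun h' => ⟨h', hx'.1⟩) fun h' => ⟨h', hx'.2⟩
    have e2 : low ht (restr K ↑t) = t := by
      ext x
      rw [mem_low]
      by_cases hx : x ∈ t ∨ K x ∈ t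
      · rw [restr_apply_pos hK.1 hx]
        constructor
        · intro hlt
          refine hx.resolve_right fun h' => ?_
          have h2 := mem_low.1 (ht' h')
          rw [hK.1] at h2
          exact absurd h2 (not_lt.2 hlt.le)
        · exact fun h' => mem_low.1 (ht' h')
      · rw [restr_apply_neg hx]
        exact iff_of_false (lt_irrefl _) fun h' => hx (Or.inl h')
    simp only [e1, e2]
  · rintro ⟨ψ₁, ψ₂⟩ h
    simp only [Finset.mem_sigma, mem_pairings, isPairing_glue] at h
    obtain ⟨h1, h2, h⟩ := h
    have e2 : low ht (ψ₁ * ψ₂) \ low ht ψ₁ = low ht ψ₂ := by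
      rw [low_mul h]
      exact Finset.union_sdiff_cancel_left (disjoint_low h)
    dsimp only
    rw [e2]
    congr 2
    · exact Finset.prod_congr rfl fun x hx => by rw [mul_apply_left h (ne_of_mem_low hx)]
    · exact Finset.prod_congr rfl fun x hx => by rw [mul_apply_right h (ne_of_mem_low hx)]

/-- If two weights have disjoint supports, then the pairings that contribute to a double sum are
disjoint. -/
theorem psum_psum {ht : X → ℕ} (hs : G.Separates ht) {a b : X → X → R} {p : X → Prop}
    (ha : ∀ x y, a x y ≠ 0 → p x ∧ p y) (hb : ∀ x y, b x y ≠ 0 → ¬ p x ∧ ¬ p y)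
    (F : Equiv.Perm X → Equiv.Perm X → M) :
    psum G ht a (fun ψ₁ => psum G ht b (F ψ₁))
      = psum G ht a fun ψ₁ => psum (G.glue ψ₁) ht b (F ψ₁) := by
  refine psum_congr (fun _ _ => rfl) fun ψ₁ h₁ hne => ?_
  symm
  -- If `ψ₂` is not disjoint from `ψ₁`, they move a common point. It lies in `p` by the support of
  -- `a`, and so the weight `b` of its pair in `ψ₂` vanishes.
  refine Finset.sum_subset ?_ ?_
  · intro ψ₂ h
    rw [mem_pairings, isPairing_glue] at h
    exact mem_pairings.2 h.1
  · intro ψ₂ h h'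
    rw [mem_pairings] at h h'
    have : ∃ x, ψ₁ x ≠ x ∧ ψ₂ x ≠ x := by
      by_contra hd
      push Not at hd
      exact h' (isPairing_glue.2 ⟨h, fun x => or_iff_not_imp_left.2 (hd x)⟩)
    obtain ⟨x, hx1, hx2⟩ := this
    have hpx : p x := by
      rcases hs.lt_or_lt h₁ hx1 with hx | hx
      · exact (ha _ _ (hne x (mem_low.2 hx))).1
      · have := (ha _ _ (hne _ (mem_low.2 hx))).2
        rwa [h₁.1] at this
    have h0 : ∏ x ∈ low ht ψ₂, b x (ψ₂ x) = 0 := by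
      rcases hs.lt_or_lt h hx2 with hx | hx
      · refine Finset.prod_eq_zero (mem_low.2 hx) ?_
        by_contra h0
        exact (hb _ _ h0).1 hpx
      · refine Finset.prod_eq_zero (mem_low.2 hx) ?_
        by_contra h0
        have := (hb _ _ h0).2
        rw [h.1] at this
        exact this hpx
    rw [h0, zero_smul]

/-- Points moved by a pairing that contributes to a sum with supported weight. -/
theorem supp_of_weight {ht : X → ℕ} (hs : G.Separates ht) {a : X → X → R} {p : X → Prop}
    (ha : ∀ x y, a x y ≠ 0 → p x ∧ p y) {ψ : Equiv.Perm X} (hψ : G.IsPairing ψ)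
    (hne : ∀ x ∈ low ht ψ, a x (ψ x) ≠ 0) {x : X} (hx : ψ x ≠ x) : p x := by
  rcases hs.lt_or_lt hψ hx with hx | hx
  · exact (ha _ _ (hne x (mem_low.2 hx))).1
  · have := (ha _ _ (hne _ (mem_low.2 hx))).2
    rwa [hψ.1] at this

end Sums

/-! ### Invariance under reduction -/

section Reduction

variable {Y : Type} {j : Y → X} {G' : Diagram V Y} {p : X → Prop}

/-- The extension of `ψ` fixes all omitted points, so only the first step out of a kept point
changes: the path back to the kept points is the one that leaves `j (ψ y)` in `G`. -/
theorem Red.glue (h : Red j G' G p) (ψ : Equiv.Perm Y) :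
    Red j (G'.glue ψ) (G.glue (ψ.viaEmbedding ⟨j, h.inj⟩)) p := by
  have hj : ∀ y, ψ.viaEmbedding ⟨j, h.inj⟩ (j y) = j (ψ y) :=
    fun y => ψ.viaEmbedding_apply ⟨j, h.inj⟩ y
  have hn : ∀ x, x ∉ Set.range j → ψ.viaEmbedding ⟨j, h.inj⟩ x = x :=
    fun x hx => ψ.viaEmbedding_apply_of_notMem ⟨j, h.inj⟩ x hx
  refine ⟨h.inj, h.mem, ?_, ?_, ?_, ?_⟩
  · intro y
    by_cases hy : ψ y = y
    · rw [glue_lab_of_eq hy, glue_lab_of_eq (by rw [hj, hy]), h.lab_eq]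
    · rw [glue_lab_of_ne hy, glue_lab_of_ne (by rw [hj]; exact fun h' => hy (h.inj h')), h.lab_eq]
  · intro y
    obtain ⟨n, h1, h2⟩ := h.step (ψ y)
    have key : ∀ i, i ≤ n → (G.glue (ψ.viaEmbedding ⟨j, h.inj⟩)).next^[i + 1] (j y)
        = G.next^[i + 1] (j (ψ y)) := by
      intro i
      induction i with
      | zero =>
        intro _
        rw [zero_add, iterate_one, iterate_one, glue_next_apply, hj]
      | succ i ih =>
        intro hi
        rw [iterate_succ_apply', ih (by omega), glue_next_apply, hn _ (h2 _ (by omega) hi),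
          ← iterate_succ_apply' G.next]
    refine ⟨n, ?_, ?_⟩
    · rw [key n le_rfl, h1, glue_next_apply]
    · intro i hi hi'
      obtain ⟨i, rfl⟩ := Nat.exists_eq_succ_of_ne_zero hi.ne'
      rw [Nat.succ_eq_add_one, key i (by omega)]
      exact h2 _ (by omega) hi'
  · intro x hx hx'
    rw [glue_lab_of_eq (hn x hx')]
    exact h.dead x hx hx'
  · intro x hx
    obtain ⟨n, hn'⟩ := h.meets x hx
    clear hx
    induction n generalizing x with
    | zero => exact ⟨0, hn'⟩
    | succ n ih =>
      by_cases hr : x ∈ Set.range j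
      · exact ⟨0, hr⟩
      · obtain ⟨m, hm⟩ := ih (G.next x) (by rwa [← iterate_succ_apply])
        refine ⟨m + 1, ?_⟩
        rwa [iterate_succ_apply, glue_next_apply, hn x hr]

theorem Red.viaEmbedding_inv (h : Red j G' G p) (ψ : Equiv.Perm Y) (x : X) :
    p (ψ.viaEmbedding ⟨j, h.inj⟩ x) ↔ p x := by
  by_cases hx : x ∈ Set.range j
  · obtain ⟨y, rfl⟩ := hx
    have : ψ.viaEmbedding ⟨j, h.inj⟩ (j y) = j (ψ y) := ψ.viaEmbedding_apply ⟨j, h.inj⟩ y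
    rw [this]
    exact iff_of_true (h.mem _) (h.mem _)
  · rw [ψ.viaEmbedding_apply_of_notMem ⟨j, h.inj⟩ x hx]

theorem Red.isPairing_iff (h : Red j G' G p) (ψ : Equiv.Perm Y) :
    G.IsPairing (ψ.viaEmbedding ⟨j, h.inj⟩) ↔ G'.IsPairing ψ := by
  have hj : ∀ y, ψ.viaEmbedding ⟨j, h.inj⟩ (j y) = j (ψ y) :=
    fun y => ψ.viaEmbedding_apply ⟨j, h.inj⟩ y
  have hn : ∀ x, x ∉ Set.range j → ψ.viaEmbedding ⟨j, h.inj⟩ x = x :=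
    fun x hx => ψ.viaEmbedding_apply_of_notMem ⟨j, h.inj⟩ x hx
  constructor
  · rintro ⟨h1, h2⟩
    refine ⟨fun y => h.inj ?_, fun y hy => ?_⟩
    · rw [← hj, ← hj, h1]
    · rw [h.lab_eq, h.lab_eq, ← hj]
      exact h2 _ (by rw [hj]; exact fun h' => hy (h.inj h'))
  · rintro ⟨h1, h2⟩
    constructor
    · intro x
      by_cases hx : x ∈ Set.range j
      · obtain ⟨y, rfl⟩ := hx
        rw [hj, hj, h1]
      · rw [hn x hx, hn x hx]
    · intro x hx
      by_cases hx' : x ∈ Set.range j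
      · obtain ⟨y, rfl⟩ := hx'
        rw [hj] at hx ⊢
        rw [← h.lab_eq, ← h.lab_eq]
        exact h2 y fun h' => hx (by rw [h'])
      · exact absurd (hn x hx') hx

/-- Omitted points in `p` are labelled by vertices and cannot be moved by a pairing. -/
theorem Red.exists_viaEmbedding (h : Red j G' G p) {ψ : Equiv.Perm X} (hψ : G.IsPairing ψ)
    (hp : ∀ x, ψ x ≠ x → p x) : ∃ φ, G'.IsPairing φ ∧ φ.viaEmbedding ⟨j, h.inj⟩ = ψ := by
  have hr : ∀ x, ψ x ≠ x → x ∈ Set.range j := by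
    intro x hx
    by_contra hx'
    obtain ⟨v, hv⟩ := h.dead x (hp x hx) hx'
    obtain ⟨e, he, -⟩ := hψ.2 x hx
    rw [hv] at he
    cases he
  have hmem : ∀ y, ∃ y', j y' = ψ (j y) := by
    intro y
    by_cases hy : ψ (j y) = j y
    · exact ⟨y, hy.symm⟩
    · exact hr _ (hψ.apply_ne hy)
  choose φ hφ using hmem
  have hinv : Involutive φ := by
    intro y
    apply h.inj
    rw [hφ, hφ, hψ.1]
  have heq : (hinv.toPerm φ).viaEmbedding ⟨j, h.inj⟩ = ψ := by
    ext x
    by_cases hx : x ∈ Set.range j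
    · obtain ⟨y, rfl⟩ := hx
      have : (hinv.toPerm φ).viaEmbedding ⟨j, h.inj⟩ (j y) = j (φ y) :=
        (hinv.toPerm φ).viaEmbedding_apply ⟨j, h.inj⟩ y
      rw [this, hφ]
    · rw [Equiv.Perm.viaEmbedding_apply_of_notMem _ _ _ hx]
      by_contra hne
      exact hx (hr x (Ne.symm hne))
  refine ⟨hinv.toPerm φ, ?_, heq⟩
  rw [← h.isPairing_iff, heq]
  exact hψ

theorem viaEmbedding_injective {X Y : Type*} (ι : Y ↪ X) :
    Injective fun φ : Equiv.Perm Y => φ.viaEmbedding ι := by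
  intro φ φ' h
  ext y
  apply ι.injective
  rw [← φ.viaEmbedding_apply ι, ← φ'.viaEmbedding_apply ι]
  exact congrArg (fun f : Equiv.Perm X => f (ι y)) h

section Sums

variable [Finite X] [Finite Y] {R M : Type*} [CommRing R] [AddCommGroup M] [Module R M]

theorem Red.prod_low (h : Red j G' G p) {ht : X → ℕ} {ht' : Y → ℕ}
    (hht : ∀ y y', G'.Alive y → G'.Alive y' → (ht' y < ht' y' ↔ ht (j y) < ht (j y')))
    (a : X → X → R) {φ : Equiv.Perm Y} (hφ : G'.IsPairing φ) :
    ∏ x ∈ low ht (φ.viaEmbedding ⟨j, h.inj⟩), a x (φ.viaEmbedding ⟨j, h.inj⟩ x)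
      = ∏ y ∈ low ht' φ, a (j y) (j (φ y)) := by
  have hj : ∀ y, φ.viaEmbedding ⟨j, h.inj⟩ (j y) = j (φ y) :=
    fun y => φ.viaEmbedding_apply ⟨j, h.inj⟩ y
  have hlt : ∀ y, ht' y < ht' (φ y) ↔ ht (j y) < ht (j (φ y)) := by
    intro y
    by_cases hy : φ y = y
    · simp [hy]
    · obtain ⟨e, h1, h2⟩ := hφ.2 y hy
      exact hht _ _ ⟨e, h1⟩ ⟨_, h2⟩
  symm
  refine Finset.prod_bij (fun y _ => j y) ?_ (fun _ _ _ _ h' => h.inj h') ?_ ?_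
  · intro y hy
    rw [mem_low, hj, ← hlt]
    exact mem_low.1 hy
  · intro x hx
    by_cases hx' : x ∈ Set.range j
    · obtain ⟨y, rfl⟩ := hx'
      refine ⟨y, ?_, rfl⟩
      rw [mem_low, hj, ← hlt] at hx
      exact mem_low.2 hx
    · exact absurd (φ.viaEmbedding_apply_of_notMem ⟨j, h.inj⟩ x hx') (ne_of_mem_low hx)
  · intro y _
    rw [hj]

theorem Red.sum_pairings (h : Red j G' G p) {F : Equiv.Perm X → M} {F' : Equiv.Perm Y → M}
    (hF : ∀ φ, G'.IsPairing φ → F' φ = F (φ.viaEmbedding ⟨j, h.inj⟩))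
    (h0 : ∀ ψ, G.IsPairing ψ → F ψ ≠ 0 → ∀ x, ψ x ≠ x → p x) :
    ∑ φ ∈ G'.pairings, F' φ = ∑ ψ ∈ G.pairings, F ψ := by
  refine Finset.sum_of_injOn (fun φ => φ.viaEmbedding ⟨j, h.inj⟩)
    (fun _ _ _ _ h' => viaEmbedding_injective _ h') ?_ ?_ ?_
  · intro φ hφ
    rw [Finset.mem_coe, mem_pairings] at hφ ⊢
    exact (h.isPairing_iff φ).2 hφ
  · intro ψ hψ hn
    rw [mem_pairings] at hψ
    by_contra hne
    obtain ⟨φ, hφ, he⟩ := h.exists_viaEmbedding hψ (h0 ψ hψ hne)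
    exact hn ⟨φ, by rwa [Finset.mem_coe, mem_pairings], he⟩
  · intro φ hφ
    exact hF φ (mem_pairings.1 hφ)

/-- Pairings that do not come from `G'` move a point outside `p`, and the support of `a` makes their
terms vanish. Heights are compared only at points labelled by edges, since no others are paired. -/
theorem Red.psum_eq (h : Red j G' G p) {ht : X → ℕ} (hs : G.Separates ht) {ht' : Y → ℕ}
    (hht : ∀ y y', G'.Alive y → G'.Alive y' → (ht' y < ht' y' ↔ ht (j y) < ht (j y')))
    {a : X → X → R} (ha : ∀ x y, a x y ≠ 0 → p x ∧ p y) {a' : Y → Y → R}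
    (haa : ∀ y y', a' y y' = a (j y) (j y')) {F : Equiv.Perm X → M} {F' : Equiv.Perm Y → M}
    (hF : ∀ φ, G'.IsPairing φ → F' φ = F (φ.viaEmbedding ⟨j, h.inj⟩)) :
    psum G' ht' a' F' = psum G ht a F := by
  refine h.sum_pairings ?_ ?_
  · intro φ hφ
    rw [h.prod_low hht a hφ, hF φ hφ]
    simp only [haa]
  · intro ψ hψ hne x hx
    refine supp_of_weight hs ha hψ (fun x hx h0 => hne ?_) hx
    rw [Finset.prod_eq_zero hx h0, zero_smul]

theorem Red.val_glue (h : Red j G' G p) (k : Type w) [Field k] (hG : G.IsPath) (hp : G.Inv p)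
    {φ : Equiv.Perm Y} (hφ : G'.IsPairing φ) :
    (G'.glue φ).val k (fun _ => True) = (G.glue (φ.viaEmbedding ⟨j, h.inj⟩)).val k p :=
  (h.glue φ).val_eq k (hG.glue ((h.isPairing_iff φ).2 hφ)) (hp.glue (h.viaEmbedding_inv φ))

/-- Both diagrams reduce to the same diagram on the subtype of `p`. -/
theorem val_congr (k : Type w) [Field k] {G₁ G₂ : Diagram V X} (hG₁ : G₁.IsPath)
    (hG₂ : G₂.IsPath) (hp₁ : G₁.Inv p) (hp₂ : G₂.Inv p)
    (hnext : ∀ x, p x → G₁.next x = G₂.next x) (hlab : ∀ x, p x → G₁.lab x = G₂.lab x) :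
    G₁.val k p = G₂.val k p := by
  let G₀ : Diagram V {x // p x} := ⟨G₁.next.subtypePerm fun x => hp₁ x, fun x => G₁.lab x⟩
  have h : ∀ G : Diagram V X, (∀ x, p x → G₁.next x = G.next x) →
      (∀ x, p x → G₁.lab x = G.lab x) → Red Subtype.val G₀ G p := by
    intro G h1 h2
    refine ⟨Subtype.val_injective, fun y => y.2, fun y => h2 _ y.2,
      fun y => ⟨0, (h1 _ y.2).symm, fun i hi hi' => by omega⟩, fun x hx hx' => ?_,
      fun x hx => ⟨0, ⟨x, hx⟩, rfl⟩⟩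
    exact absurd ⟨⟨x, hx⟩, rfl⟩ hx'
  rw [← (h G₁ (fun _ _ => rfl) fun _ _ => rfl).val_eq k hG₁ hp₁,
    ← (h G₂ hnext hlab).val_eq k hG₂ hp₂]

end Sums

end Reduction

end Diagram

end Gluing

end NecklaceMoyal

namespace NecklaceMoyal

open Function

/-! ### Collections as diagrams -/

section Collections

variable {V : Type u} [Quiver.{v} V]

theorem filterMap_none {α β : Type*} (s : Multiset α) :
    s.filterMap (fun _ => (none : Option β)) = 0 := by
  induction s using Multiset.induction_on with
  | empty => rfl
  | cons a s ih => rw [Multiset.filterMap_cons_none _ _ rfl, ih]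

theorem exists_equiv_of_map_univ_eq {α β γ : Type*} [Fintype α] [Fintype β] {f : α → γ} {g : β → γ}
    (h : (Finset.univ : Finset α).val.map f = (Finset.univ : Finset β).val.map g) :
    ∃ e : α ≃ β, ∀ a, g (e a) = f a := by
  classical
  have hc : ∀ c, Nonempty ({a // f a = c} ≃ {b // g b = c}) := by
    intro c
    rw [← Fintype.card_eq]
    have := congrArg (Multiset.count c) h
    rw [Multiset.count_map, Multiset.count_map] at this
    rw [Fintype.card_subtype, Fintype.card_subtype]
    simpa [Finset.card, Finset.filter_val, eq_comm] using this
  exact ⟨Equiv.ofFiberEquiv fun c => (hc c).some, fun a => Equiv.ofFiberEquiv_map _ a⟩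

namespace Collection

variable {X W : Type} (P : Collection V X W)

/-- A collection as a diagram: its vertex idempotents are fixed points. -/
def toDiag : Diagram V (X ⊕ W) where
  next := Equiv.Perm.sumCongr P.next 1
  lab := Sum.elim (fun a => Sum.inl (P.edge a)) fun i => Sum.inr (P.idem i)

theorem isPath_toDiag : P.toDiag.IsPath := by
  rintro (a | i)
  · exact P.src_next a
  · rfl

@[simp] theorem toDiag_next_inl (a : X) : P.toDiag.next (Sum.inl a) = Sum.inl (P.next a) := rfl

@[simp] theorem toDiag_next_inr (i : W) : P.toDiag.next (Sum.inr i) = Sum.inr i := rfl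

@[simp] theorem toDiag_lab_inl (a : X) : P.toDiag.lab (Sum.inl a) = Sum.inl (P.edge a) := rfl

@[simp] theorem toDiag_lab_inr (i : W) : P.toDiag.lab (Sum.inr i) = Sum.inr (P.idem i) := rfl

theorem toDiag_iterate_inl (a : X) (n : ℕ) :
    P.toDiag.next^[n] (Sum.inl a) = Sum.inl (P.next^[n] a) := by
  induction n generalizing a with
  | zero => rfl
  | succ n ih => rw [iterate_succ_apply, iterate_succ_apply, toDiag_next_inl, ih]

theorem toDiag_iterate_inr (i : W) (n : ℕ) : P.toDiag.next^[n] (Sum.inr i) = Sum.inr i :=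
  iterate_fixed rfl n

theorem neck_inl [Finite X] (a : X) : P.toDiag.neck (Sum.inl a) = Sum.inl (P.word a) := by
  have hper : minimalPeriod P.toDiag.next (Sum.inl a) = minimalPeriod P.next a := by
    rw [minimalPeriod_eq_minimalPeriod_iff]
    intro n
    rw [IsPeriodicPt, IsFixedPt, toDiag_iterate_inl, Sum.inl.injEq]
    rfl
  rw [← necklaceOf_coe (P.word a) (lsrc (P.toDiag.lab (Sum.inl a))), Diagram.neck]
  congr 1
  show _ = (periodicOrbit P.next a).map P.edge
  rw [periodicOrbit_def, Cycle.map_coe, Diagram.spell, hper]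
  congr 1
  rw [List.filterMap_map, List.map_map, ← List.filterMap_eq_map]
  congr 1
  ext n
  simp [toDiag_iterate_inl]

theorem neck_inr (i : W) : P.toDiag.neck (Sum.inr i) = Sum.inr (P.idem i) := by
  rw [Diagram.neck]
  have : P.toDiag.spell (Sum.inr i) = [] := by
    rw [Diagram.spell, List.filterMap_eq_nil_iff]
    intro z hz
    obtain ⟨n, -, rfl⟩ := List.mem_map.1 hz
    rw [toDiag_iterate_inr]
    rfl
  rw [this]
  exact necklaceOf_nil _

theorem sameCycle_inl [Finite X] [Finite W] {a b : X} :
    P.toDiag.next.SameCycle (Sum.inl a) (Sum.inl b) ↔ P.next.SameCycle a b := by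
  simp [sameCycle_iff_iterate, toDiag_iterate_inl]

theorem toSym_eq_val [Finite X] [Fintype W] (k : Type w) [Field k] :
    P.toSym k = P.toDiag.val k fun _ => True := by
  classical
  rw [Diagram.val_eq_prod k P.isPath_toDiag Diagram.inv_true
    (Sum.elim (fun o : Quotient (Equiv.Perm.SameCycle.setoid P.next) => Sum.inl o.out)
      fun i : W => Sum.inr i) fun _ => trivial]
  · rw [toSym, Fintype.prod_sum_type]
    congr 1
    · refine Finset.prod_congr rfl fun o _ => ?_
      rw [Sum.elim_inl, neck_inl]
      congr 2
      conv_lhs => rw [← Quotient.out_eq o]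
      rfl
    · exact Finset.prod_congr rfl fun i _ => by rw [Sum.elim_inr, neck_inr]
  · rintro (o | i) (o' | i') h
    · rw [Sum.elim_inl, Sum.elim_inl, sameCycle_inl] at h
      rw [← Quotient.out_eq o, ← Quotient.out_eq o']
      exact congrArg Sum.inl (Quotient.sound h)
    · obtain ⟨n, hn⟩ := sameCycle_iff_iterate.1 h
      simp [toDiag_iterate_inl] at hn
    · obtain ⟨n, hn⟩ := sameCycle_iff_iterate.1 h
      simp [toDiag_iterate_inr] at hn
    · obtain ⟨n, hn⟩ := sameCycle_iff_iterate.1 h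
      simp only [Sum.elim_inr, toDiag_iterate_inr] at hn
      rw [Sum.inr.inj hn]
  · rintro (a | i) -
    · refine ⟨Sum.inl (Quotient.mk _ a), ?_⟩
      rw [Sum.elim_inl, sameCycle_inl]
      exact (sameCycle_out _ _).symm
    · exact ⟨Sum.inr i, Equiv.Perm.SameCycle.refl _ _⟩

/-- The monomial of a collection. -/
noncomputable def mono [Finite X] [Fintype W] : Necklace V →₀ ℕ :=
  ∑ o, Finsupp.single (Sum.inl (P.cycleWord o)) 1 + ∑ i, Finsupp.single (Sum.inr (P.idem i)) 1

theorem toSym_eq_monomial [Finite X] [Fintype W] (k : Type w) [Field k] :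
    P.toSym k = MvPolynomial.monomial P.mono 1 := by
  have h1 : (1 : k[X]) = 1 * 1 := (one_mul 1).symm
  rw [toSym, mono, h1, ← MvPolynomial.monomial_mul, MvPolynomial.monomial_sum_one,
    MvPolynomial.monomial_sum_one]
  rfl

variable {Y U : Type}

/-- Isomorphisms of collections. -/
structure Iso (Q : Collection V Y U) (P : Collection V X W) (α : Y ≃ X) (β : U ≃ W) : Prop where
  next_eq : ∀ a, P.next (α a) = α (Q.next a)
  edge_eq : ∀ a, P.edge (α a) = Q.edge a
  idem_eq : ∀ i, P.idem (β i) = Q.idem i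

variable {P}

theorem Iso.red {Q : Collection V Y U} {α : Y ≃ X} {β : U ≃ W} (h : Iso Q P α β) :
    Diagram.Red (Sum.map α β) Q.toDiag P.toDiag fun _ => True := by
  have hs : Surjective (Sum.map α β) := α.surjective.sumMap β.surjective
  refine ⟨α.injective.sumMap β.injective, fun _ => trivial, ?_, ?_, ?_, ?_⟩
  · rintro (a | i)
    · simp [h.edge_eq]
    · simp [h.idem_eq]
  · rintro (a | i)
    · exact ⟨0, by simp [h.next_eq], fun i hi hi' => by omega⟩
    · exact ⟨0, by simp, fun i hi hi' => by omega⟩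
  · exact fun x _ hx => absurd (hs x) hx
  · exact fun x _ => ⟨0, hs _⟩

variable (P)

/-- A chosen representative of a cyclic word may start anywhere on the cycle; `s` is its offset from
`a`. -/
theorem exists_list_eq [Finite X] (a : X) (l : List (DEdge V)) (hl : (l : Cycle _) = (P.word a).1) :
    ∃ s, l = (List.range (minimalPeriod P.next a)).map fun t => P.edge (P.next^[t] (P.next^[s] a)) := by
  change (l : Cycle _) = (periodicOrbit P.next a).map P.edge at hl
  rw [periodicOrbit_def, Cycle.map_coe, Cycle.coe_eq_coe] at hl
  obtain ⟨s, hs⟩ := hl.symm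
  refine ⟨s, ?_⟩
  rw [← hs]
  apply List.ext_getElem
  · simp
  · intro t h1 h2
    rw [List.getElem_rotate]
    simp only [List.getElem_map, List.getElem_range, List.length_map, List.length_range]
    rw [iterate_mod_minimalPeriod_eq, iterate_add_apply]

theorem filterMap_necklaces [Finite X] [Fintype W] :
    ((necklaces P.mono).filterMap Sum.getLeft? : Multiset (CycWord V))
        = Finset.univ.val.map P.cycleWord ∧
      ((necklaces P.mono).filterMap Sum.getRight? : Multiset V) = Finset.univ.val.map P.idem := by
  have h : ((necklaces P.mono : List _) : Multiset (Necklace V))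
      = Finset.univ.val.map (fun o => Sum.inl (P.cycleWord o))
        + Finset.univ.val.map fun i => Sum.inr (P.idem i) := by
    rw [necklaces, Multiset.coe_toList, mono, map_add, map_sum, map_sum]
    simp only [Finsupp.toMultiset_single, one_smul]
    have hs : ∀ {α β : Type _} (s : Finset α) (f : α → β),
        ∑ i ∈ s, ({f i} : Multiset β) = s.val.map f := fun s f => by
      rw [← Multiset.sum_map_singleton (s.val.map f), Multiset.map_map]
      rfl
    congr 1
    · exact hs _ _
    · exact hs _ _
  rw [← Multiset.filterMap_coe, ← Multiset.filterMap_coe, h, Multiset.filterMap_add,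
    Multiset.filterMap_add]
  simp only [Multiset.filterMap_map]
  constructor
  · rw [show (Sum.getLeft? ∘ fun i => (Sum.inr (P.idem i) : Necklace V)) = fun _ => none from rfl,
      filterMap_none, add_zero]
    exact congrFun (Multiset.filterMap_eq_map P.cycleWord) _
  · rw [show (Sum.getRight? ∘ fun o => (Sum.inl (P.cycleWord o) : Necklace V)) = fun _ => none
      from rfl, filterMap_none, zero_add]
    exact congrFun (Multiset.filterMap_eq_map P.idem) _

theorem ofLists_iterate (c : List (CycWord V)) (d : List V) (i : Fin c.length)
    (s : Fin (c.get i).rep.length) (n : ℕ) :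
    (ofLists c d).next^[n] ⟨i, s⟩
      = ⟨i, ⟨(s + n) % (c.get i).rep.length, Nat.mod_lt _ s.pos⟩⟩ := by
  induction n with
  | zero => exact congrArg (Sigma.mk i) (Fin.ext (Nat.mod_eq_of_lt s.2).symm)
  | succ n ih =>
    rw [iterate_succ_apply', ih]
    show (⟨i, finRotate _ _⟩ : Σ i : Fin c.length, Fin (c.get i).rep.length) = _
    congr 1
    have : NeZero (c.get i).rep.length := s.neZero
    rw [finRotate_apply]
    ext
    rw [Fin.val_add]
    simp [← add_assoc]

theorem CycWord_rep_coe (c : CycWord V) : (c.rep : Cycle (DEdge V)) = c.1 := Quotient.out_eq _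

theorem rep_length_pos (c : CycWord V) : 0 < c.rep.length := by
  rw [List.length_pos_iff]
  intro h
  have := c.2.1
  rw [← CycWord_rep_coe, h] at this
  exact this rfl

theorem toSym_ofLists (k : Type w) [Field k] (c : List (CycWord V)) (d : List V) :
    (ofLists c d).toSym k = (∏ i : Fin c.length, MvPolynomial.X (Sum.inl (c.get i)))
      * ∏ i : Fin d.length, MvPolynomial.X (Sum.inr (d.get i)) := by
  have hword : ∀ i : Fin c.length, (ofLists c d).word ⟨i, ⟨0, rep_length_pos _⟩⟩ = c.get i := by
    intro i
    have hper : minimalPeriod (ofLists c d).next ⟨i, ⟨0, rep_length_pos _⟩⟩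
        = (c.get i).rep.length := by
      refine Nat.dvd_antisymm (IsPeriodicPt.minimalPeriod_dvd ?_) ?_
      · rw [IsPeriodicPt, IsFixedPt, ofLists_iterate]
        simp
      · have h := iterate_minimalPeriod (f := (ofLists c d).next)
          (x := ⟨i, ⟨0, rep_length_pos _⟩⟩)
        rw [ofLists_iterate] at h
        simp only [Sigma.mk.injEq, heq_eq_eq, true_and, Fin.mk.injEq, zero_add] at h
        exact Nat.dvd_of_mod_eq_zero h
    apply Subtype.ext
    show (periodicOrbit (ofLists c d).next _).map (ofLists c d).edge = _
    rw [periodicOrbit_def, Cycle.map_coe, hper, ← CycWord_rep_coe]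
    congr 1
    apply List.ext_getElem
    · simp
    · intro t h1 h2
      simp only [List.getElem_map, List.getElem_range, ofLists_iterate]
      show (c.get i).rep.get ⟨(0 + t) % _, _⟩ = (c.get i).rep.get ⟨t, h2⟩
      congr 1
      exact Fin.ext ((congrArg (· % _) (zero_add t)).trans (Nat.mod_eq_of_lt h2))
  rw [toSym_eq_val, Diagram.val_eq_prod k (ofLists c d).isPath_toDiag Diagram.inv_true
    (Sum.elim (fun i : Fin c.length => Sum.inl ⟨i, ⟨0, rep_length_pos _⟩⟩)
      fun i => Sum.inr i) fun _ => trivial]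
  · rw [Fintype.prod_sum_type]
    congr 1
    · refine Finset.prod_congr rfl fun i _ => ?_
      rw [Sum.elim_inl, neck_inl, hword]
    · exact Finset.prod_congr rfl fun i _ => by rw [Sum.elim_inr, neck_inr]; rfl
  · rintro (i | i) (i' | i') h
    · rw [Sum.elim_inl, Sum.elim_inl, sameCycle_inl] at h
      obtain ⟨n, hn⟩ := sameCycle_iff_iterate.1 h
      rw [ofLists_iterate] at hn
      exact congrArg Sum.inl (congrArg Sigma.fst hn)
    · obtain ⟨n, hn⟩ := sameCycle_iff_iterate.1 h
      simp [toDiag_iterate_inl] at hn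
    · obtain ⟨n, hn⟩ := sameCycle_iff_iterate.1 h
      simp [toDiag_iterate_inr] at hn
    · obtain ⟨n, hn⟩ := sameCycle_iff_iterate.1 h
      simp only [Sum.elim_inr, toDiag_iterate_inr] at hn
      rw [Sum.inr.inj hn]
  · rintro (⟨i, s⟩ | i) -
    · refine ⟨Sum.inl i, Equiv.Perm.SameCycle.symm ?_⟩
      rw [Sum.elim_inl, sameCycle_inl, sameCycle_iff_iterate]
      refine ⟨s, ?_⟩
      rw [ofLists_iterate]
      exact congrArg (Sigma.mk i) (Fin.ext ((congrArg (· % _) (zero_add _)).trans (Nat.mod_eq_of_lt s.2)))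
    · exact ⟨Sum.inr i, Equiv.Perm.SameCycle.refl _ _⟩

theorem toSym_present (k : Type w) [Field k] (m : Necklace V →₀ ℕ) :
    (present m).toSym k = MvPolynomial.monomial m 1 := by
  have key : ∀ L : List (Necklace V),
      (∏ i : Fin (L.filterMap Sum.getLeft?).length,
          MvPolynomial.X (R := k[X]) (Sum.inl ((L.filterMap Sum.getLeft?).get i) : Necklace V))
        * ∏ i : Fin (L.filterMap Sum.getRight?).length,
          MvPolynomial.X (Sum.inr ((L.filterMap Sum.getRight?).get i) : Necklace V)
        = (L.map MvPolynomial.X).prod := by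
    intro L
    have e1 : ∀ l : List (CycWord V), (∏ i : Fin l.length,
        MvPolynomial.X (R := k[X]) (Sum.inl (l.get i) : Necklace V))
        = (l.map fun c => MvPolynomial.X (Sum.inl c)).prod := fun l => by
      rw [← List.prod_ofFn]
      congr 1
      exact List.ofFn_getElem_eq_map l fun c => MvPolynomial.X (Sum.inl c)
    have e2 : ∀ l : List V, (∏ i : Fin l.length,
        MvPolynomial.X (R := k[X]) (Sum.inr (l.get i) : Necklace V))
        = (l.map fun c => MvPolynomial.X (Sum.inr c)).prod := fun l => by
      rw [← List.prod_ofFn]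
      congr 1
      exact List.ofFn_getElem_eq_map l fun c => MvPolynomial.X (Sum.inr c)
    rw [e1, e2]
    induction L with
    | nil => simp
    | cons x L ih =>
      rcases x with c | v
      · rw [List.filterMap_cons_some (f := Sum.getLeft?) (a := Sum.inl c) (b := c) rfl, List.filterMap_cons_none rfl, List.map_cons,
          List.map_cons, List.prod_cons, List.prod_cons, ← ih, mul_assoc]
      · rw [List.filterMap_cons_none rfl, List.filterMap_cons_some (f := Sum.getRight?) (a := Sum.inr v) (b := v) rfl, List.map_cons,
          List.map_cons, List.prod_cons, List.prod_cons, ← ih, mul_left_comm]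
  rw [toSym_ofLists, key, ← Multiset.prod_coe, ← Multiset.map_coe, necklaces, Multiset.coe_toList]
  rw [MvPolynomial.monomial_eq, Finsupp.toMultiset_map, Finsupp.prod_toMultiset]
  rw [Finsupp.prod_mapDomain_index (fun _ => pow_zero _) fun _ _ _ => pow_add _ _ _, map_one,
    one_mul]

/-- Independence of the presentation. The chosen list of necklaces agrees with the cycles of `P` as
a multiset, which gives a matching `e1`; on each cycle the representing path singles out a starting
point `a i`, from which the edges are numbered. -/
theorem exists_iso_present [Finite X] [Fintype W] :
    ∃ α β, Iso (present P.mono) P α β := by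
  obtain ⟨h1, h2⟩ := P.filterMap_necklaces
  obtain ⟨e1, he1⟩ : ∃ e : Fin ((necklaces P.mono).filterMap Sum.getLeft?).length ≃ _,
      ∀ i, P.cycleWord (e i) = ((necklaces P.mono).filterMap Sum.getLeft?).get i := by
    apply exists_equiv_of_map_univ_eq
    rw [← h1, Fin.univ_val_map, List.ofFn_get]
  obtain ⟨e2, he2⟩ : ∃ e : Fin ((necklaces P.mono).filterMap Sum.getRight?).length ≃ W,
      ∀ i, P.idem (e i) = ((necklaces P.mono).filterMap Sum.getRight?).get i := by
    apply exists_equiv_of_map_univ_eq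
    rw [← h2, Fin.univ_val_map, List.ofFn_get]
  have hst : ∀ i, ∃ a, Quotient.mk (Equiv.Perm.SameCycle.setoid P.next) a = e1 i ∧
      (((necklaces P.mono).filterMap Sum.getLeft?).get i).rep
        = (List.range (minimalPeriod P.next a)).map fun t => P.edge (P.next^[t] a) := by
    intro i
    have hw : P.word (e1 i).out = ((necklaces P.mono).filterMap Sum.getLeft?).get i := by
      rw [← he1, ← congrArg P.cycleWord (Quotient.out_eq (e1 i))]
      rfl
    obtain ⟨s, hs⟩ := P.exists_list_eq (e1 i).out _ (by rw [hw]; exact CycWord_rep_coe _)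
    refine ⟨P.next^[s] (e1 i).out, ?_, ?_⟩
    · conv_rhs => rw [← Quotient.out_eq (e1 i)]
      exact Quotient.sound (sameCycle_iff_iterate.2 ⟨s, rfl⟩ : P.next.SameCycle _ _).symm
    · rw [minimalPeriod_apply_iterate (P.next.injective.mem_periodicPts _)]
      exact hs
  choose a ha1 ha2 using hst
  have hlen : ∀ i, (((necklaces P.mono).filterMap Sum.getLeft?).get i).rep.length
      = minimalPeriod P.next (a i) := fun i => by rw [ha2]; simp
  have hbij : Bijective fun z : (Σ i : Fin ((necklaces P.mono).filterMap Sum.getLeft?).length,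
      Fin (((necklaces P.mono).filterMap Sum.getLeft?).get i).rep.length) =>
        P.next^[z.2] (a z.1) := by
    constructor
    · rintro ⟨i, s⟩ ⟨i', s'⟩ h
      dsimp only at h
      have hi : i = i' := by
        apply e1.injective
        rw [← ha1, ← ha1]
        refine Quotient.sound (Equiv.Perm.SameCycle.trans (y := P.next^[s] (a i)) ?_ ?_)
        · exact sameCycle_iff_iterate.2 ⟨_, rfl⟩
        · rw [h]
          exact (sameCycle_iff_iterate.2 ⟨_, rfl⟩ : P.next.SameCycle _ _).symm
      subst hi
      have hs := iterate_injOn_Iio_minimalPeriod (f := P.next) (x := a i)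
        (Set.mem_Iio.2 (by rw [← hlen]; exact s.2)) (Set.mem_Iio.2 (by rw [← hlen]; exact s'.2)) h
      rw [Fin.ext hs]
    · intro x
      obtain ⟨n, hn⟩ := sameCycle_iff_iterate.1 (Quotient.exact
        (ha1 (e1.symm (Quotient.mk (Equiv.Perm.SameCycle.setoid P.next) x)) |>.trans
          (e1.apply_symm_apply _)) : P.next.SameCycle _ _)
      refine ⟨⟨e1.symm (Quotient.mk _ x), ⟨n % minimalPeriod P.next
        (a (e1.symm (Quotient.mk _ x))), ?_⟩⟩, ?_⟩
      · rw [hlen]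
        exact Nat.mod_lt _ (minimalPeriod_pos_of_mem_periodicPts
          (P.next.injective.mem_periodicPts _))
      · dsimp only
        rw [iterate_mod_minimalPeriod_eq, hn]
  refine ⟨Equiv.ofBijective _ hbij, e2, ?_, ?_, he2⟩
  · rintro ⟨i, s⟩
    have h := ofLists_iterate ((necklaces P.mono).filterMap Sum.getLeft?)
      ((necklaces P.mono).filterMap Sum.getRight?) i s 1
    rw [iterate_one] at h
    show P.next (P.next^[s] (a i)) = _
    rw [h, Equiv.ofBijective_apply]
    dsimp only
    rw [← iterate_succ_apply' P.next, ← iterate_mod_minimalPeriod_eq, ← hlen]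
  · rintro ⟨i, s⟩
    show P.edge (P.next^[s] (a i)) = (List.get _ s)
    have : ∀ (l l' : List (DEdge V)) (h : l = l') (s : Fin l.length),
        l.get s = l'.get (Fin.cast (by rw [h]) s) := by
      rintro l _ rfl s
      rfl
    rw [this _ _ (ha2 i)]
    simp

end Collection

end Collections

end NecklaceMoyal

namespace NecklaceMoyal

open Function

/-! ### Normal forms of diagrams, and gluing of collections -/

section NormalForm

variable {V : Type u} [Quiver.{v} V]

namespace Diagram

variable {X : Type} {G : Diagram V X} {p : X → Prop}

theorem exists_inr_of_not_alive {x : X} (h : ¬ G.Alive x) : ∃ v, G.lab x = Sum.inr v := by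
  rcases hl : G.lab x with e | v
  · exact absurd ⟨e, hl⟩ h
  · exact ⟨v, rfl⟩

/-- A criterion for reduction to a collection: `α` must enumerate the points of `p` that carry
edges, and `β` must choose one point on each cycle of `p` without edges. -/
theorem red_of_collection [Finite X] {A B : Type} {Q : Collection V A B} {α : A → X} {β : B → X}
    (hα : Injective α) (hαp : ∀ a, p (α a)) (hβp : ∀ b, p (β b))
    (hlα : ∀ a, G.lab (α a) = Sum.inl (Q.edge a)) (hlβ : ∀ b, G.lab (β b) = Sum.inr (Q.idem b))
    (hstep : ∀ a, ∃ n, G.next^[n + 1] (α a) = α (Q.next a) ∧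
      ∀ i, 0 < i → i ≤ n → ¬ G.Alive (G.next^[i] (α a)))
    (hcov : ∀ x, p x → G.Alive x → ∃ a, α a = x)
    (hβd : ∀ b x, G.next.SameCycle (β b) x → ¬ G.Alive x)
    (hβu : ∀ b b', G.next.SameCycle (β b) (β b') → b = b')
    (hβc : ∀ x, p x → (∀ y, G.next.SameCycle x y → ¬ G.Alive y) →
      ∃ b, G.next.SameCycle x (β b)) (hp : G.Inv p) :
    Red (Sum.elim α β) Q.toDiag G p := by
  have hβi : Injective β := fun b b' h => hβu b b' (by rw [h])
  refine ⟨hα.sumElim hβi fun a b h => ?_, ?_, ?_, ?_, ?_, ?_⟩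
  · have := hlα a
    rw [h, hlβ] at this
    cases this
  · rintro (a | b)
    exacts [hαp a, hβp b]
  · rintro (a | b)
    exacts [(hlα a).symm, (hlβ b).symm]
  · rintro (a | b)
    · obtain ⟨n, h1, h2⟩ := hstep a
      refine ⟨n, h1, ?_⟩
      rintro i hi hi' ⟨a' | b, h⟩
      · refine h2 i hi hi' ?_
        rw [Sum.elim_inl, Sum.elim_inl] at h
        rw [← h]
        exact ⟨_, hlα a'⟩
      · refine hβd b (α a) ?_ ⟨_, hlα a⟩
        rw [Sum.elim_inr, Sum.elim_inl] at h
        rw [h]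
        exact (sameCycle_iff_iterate.2 ⟨i, rfl⟩ : G.next.SameCycle _ _).symm
    · have hpos := G.minimalPeriod_pos (β b)
      -- An idempotent is followed by itself, and it is the only kept point on its cycle, so the
      -- return takes a full period.
      refine ⟨minimalPeriod G.next (β b) - 1, ?_, ?_⟩
      · rw [Nat.sub_add_cancel hpos]
        exact iterate_minimalPeriod
      · rintro i hi hi' ⟨a | b', h⟩
        · rw [Sum.elim_inl, Sum.elim_inr] at h
          refine hβd b _ (sameCycle_iff_iterate.2 ⟨i, rfl⟩) ⟨Q.edge a, ?_⟩
          rw [← h, hlα]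
        · rw [Sum.elim_inr, Sum.elim_inr] at h
          have := hβu b b' (sameCycle_iff_iterate.2 ⟨i, h.symm⟩)
          subst this
          have := IsPeriodicPt.minimalPeriod_le hi h.symm
          omega
  · intro x hx hn
    refine exists_inr_of_not_alive fun ha => hn ?_
    obtain ⟨a, rfl⟩ := hcov x hx ha
    exact ⟨Sum.inl a, rfl⟩
  · intro x hx
    by_cases h : ∀ y, G.next.SameCycle x y → ¬ G.Alive y
    · obtain ⟨b, hb⟩ := hβc x hx h
      obtain ⟨n, hn⟩ := sameCycle_iff_iterate.1 hb
      exact ⟨n, Sum.inr b, hn.symm⟩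
    · push Not at h
      obtain ⟨y, hy, ha⟩ := h
      obtain ⟨n, hn⟩ := sameCycle_iff_iterate.1 hy
      obtain ⟨a, rfl⟩ := hcov y ((hp.sameCycle hy).1 hx) ha
      exact ⟨n, Sum.inl a, hn.symm⟩

theorem IsPath.lsrc_iterate (hG : G.IsPath) {x : X} {n : ℕ}
    (h : ∀ i, 0 < i → i ≤ n → ¬ G.Alive (G.next^[i] x)) :
    lsrc (G.lab (G.next^[n + 1] x)) = ltgt (G.lab x) := by
  induction n with
  | zero => exact hG x
  | succ n ih =>
    rw [iterate_succ_apply', hG, ← ih fun i hi hi' => h i hi (by omega)]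
    obtain ⟨v, hv⟩ := exists_inr_of_not_alive (h (n + 1) (by omega) le_rfl)
    rw [hv]
    rfl

/-- Each diagram is represented by a collection. -/
theorem exists_collection [Finite X] (hG : G.IsPath) (hp : G.Inv p) :
    ∃ (A B : Type) (_ : Finite A) (_ : Finite B) (Q : Collection V A B) (j : A ⊕ B → X),
      Red j Q.toDiag G p := by
  classical
  let S : X → Prop := fun x => G.Alive x ∧ p x
  have hex : ∀ a : {x // S x}, ∃ e, G.lab a.1 = Sum.inl e := fun a => a.2.1
  choose e he using hex
  have hstep : ∀ a : {x // S x}, G.next^[returnTime G.next S a - 1 + 1] a.1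
        = (firstReturn G.next S a).1 ∧
      ∀ i, 0 < i → i ≤ returnTime G.next S a - 1 → ¬ G.Alive (G.next^[i] a.1) := by
    intro a
    have hpos := returnTime_pos G.next S a
    refine ⟨by rw [Nat.sub_add_cancel hpos]; rfl, fun i hi hi' ha => ?_⟩
    exact not_of_lt_returnTime G.next S a hi (by omega) ⟨ha, (hp.iterate i _).2 a.2.2⟩
  -- Points carrying edges form the cyclic words, via the first return map; each cycle without such
  -- points contributes one idempotent.
  let Q : Collection V {x // S x} {o : Quotient (Equiv.Perm.SameCycle.setoid G.next) //
      p o.out ∧ ∀ x, G.next.SameCycle o.out x → ¬ G.Alive x} :=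
    { next := firstReturn G.next S
      edge := e
      src_next := by
        intro a
        have h := hG.lsrc_iterate (hstep a).2
        rw [(hstep a).1, he, he] at h
        exact h
      idem := fun o => lsrc (G.lab o.1.out) }
  refine ⟨_, _, inferInstance, inferInstance, Q,
    Sum.elim Subtype.val fun o => o.1.out, red_of_collection Subtype.val_injective
      (fun a => a.2.2) (fun b => b.2.1) he ?_ (fun a => ⟨_, hstep a⟩) ?_ (fun b => b.2.2) ?_ ?_ hp⟩
  · intro b
    obtain ⟨v, hv⟩ := exists_inr_of_not_alive (b.2.2 _ (Equiv.Perm.SameCycle.refl _ _))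
    show _ = Sum.inr (lsrc (G.lab b.1.out))
    rw [hv]
    rfl
  · exact fun x hx ha => ⟨⟨x, ha, hx⟩, rfl⟩
  · intro b b' h
    apply Subtype.ext
    rw [← Quotient.out_eq b.1, ← Quotient.out_eq b'.1]
    exact Quotient.sound h
  · intro x hx hd
    have ho := sameCycle_out G.next x
    exact ⟨⟨Quotient.mk _ x, (hp.sameCycle ho).2 hx, fun y hy => hd y (ho.symm.trans hy)⟩, ho.symm⟩

end Diagram

namespace Collection

variable {X W : Type} {P : Collection V X W}

/-- A permutation of the abstract edges as a permutation of the diagram. -/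
def sumPerm (W : Type) (ψ : Equiv.Perm X) : Equiv.Perm (X ⊕ W) := Equiv.Perm.sumCongr ψ 1

@[simp] theorem sumPerm_inl (ψ : Equiv.Perm X) (a : X) :
    sumPerm W ψ (Sum.inl a) = Sum.inl (ψ a) := rfl

@[simp] theorem sumPerm_inr (ψ : Equiv.Perm X) (i : W) :
    sumPerm W ψ (Sum.inr i) = Sum.inr i := rfl

theorem isPairing_sumPerm (ψ : P.Pairing) : P.toDiag.IsPairing (sumPerm W ψ.1) := by
  constructor
  · rintro (a | i)
    · simp [ψ.2.1]
    · rfl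
  · rintro (a | i) h
    · have h' : ψ.1 a ≠ a := fun h' => h (by simp [h'])
      exact ⟨P.edge a, rfl, by simp [ψ.2.2 a h']⟩
    · exact absurd rfl h

theorem exists_sumPerm {ψ : Equiv.Perm (X ⊕ W)} (hψ : P.toDiag.IsPairing ψ) :
    ∃ φ : P.Pairing, sumPerm W φ.1 = ψ := by
  have hr : ∀ i, ψ (Sum.inr i) = Sum.inr i := by
    intro i
    by_contra h
    obtain ⟨e, he, -⟩ := hψ.2 _ h
    cases he
  have hl : ∀ a, ∃ b, ψ (Sum.inl a) = Sum.inl b := by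
    intro a
    rcases h : ψ (Sum.inl a) with b | i
    · exact ⟨b, rfl⟩
    · have := hψ.1 (Sum.inl a)
      rw [h, hr] at this
      cases this
  choose φ hφ using hl
  have hinv : Involutive φ := by
    intro a
    have := hψ.1 (Sum.inl a)
    rw [hφ, hφ] at this
    exact Sum.inl.inj this
  refine ⟨⟨hinv.toPerm φ, hinv, fun a ha => ?_⟩, ?_⟩
  · obtain ⟨e, h1, h2⟩ := hψ.2 (Sum.inl a) fun h => ha (Sum.inl.inj ((hφ a).symm.trans h))
    rw [hφ] at h2
    cases h1
    exact Sum.inl.inj h2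
  · ext z
    rcases z with a | i
    · exact (hφ a).symm
    · exact (hr i).symm

theorem sumPerm_injective : Injective (sumPerm W : Equiv.Perm X → _) := by
  intro φ φ' h
  ext a
  exact Sum.inl.inj (congrArg (fun f : Equiv.Perm (X ⊕ W) => f (Sum.inl a)) h)

theorem sum_pairing [Finite X] [Finite W] {M : Type*} [AddCommMonoid M]
    {F : Equiv.Perm (X ⊕ W) → M} {F' : P.Pairing → M} (h : ∀ ψ, F' ψ = F (sumPerm W ψ.1)) :
    ∑ ψ, F' ψ = ∑ ψ ∈ P.toDiag.pairings, F ψ := by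
  refine Finset.sum_bij (fun ψ _ => sumPerm W ψ.1) ?_ ?_ ?_ ?_
  · exact fun ψ _ => Diagram.mem_pairings.2 (isPairing_sumPerm ψ)
  · exact fun ψ _ ψ' _ h => Subtype.ext (sumPerm_injective h)
  · intro ψ hψ
    obtain ⟨φ, hφ⟩ := exists_sumPerm (Diagram.mem_pairings.1 hψ)
    exact ⟨φ, Finset.mem_univ _, hφ⟩
  · exact fun ψ _ => h ψ

/-- The diagram of a collection cut and glued along a pairing. -/
noncomputable def glueDiag (ψ : P.Pairing) : Diagram V (X ⊕ W) := P.toDiag.glue (sumPerm W ψ.1)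

theorem isPath_glueDiag (ψ : P.Pairing) : (glueDiag ψ).IsPath :=
  P.isPath_toDiag.glue (isPairing_sumPerm ψ)

theorem glueDiag_iterate_inl (ψ : P.Pairing) (a : X) (n : ℕ) :
    (glueDiag ψ).next^[n] (Sum.inl a) = Sum.inl ((flow ψ)^[n] a) := by
  induction n generalizing a with
  | zero => rfl
  | succ n ih =>
    rw [iterate_succ_apply, iterate_succ_apply, ← ih]
    rfl

theorem glueDiag_iterate_inr (ψ : P.Pairing) (i : W) (n : ℕ) :
    (glueDiag ψ).next^[n] (Sum.inr i) = Sum.inr i :=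
  iterate_fixed rfl n

theorem glueDiag_alive (ψ : P.Pairing) (z : X ⊕ W) :
    (glueDiag ψ).Alive z ↔ ∃ a, z = Sum.inl a ∧ ψ.1 a = a := by
  constructor
  · rintro ⟨e, he⟩
    obtain ⟨h1, h2⟩ := Diagram.glue_lab_eq_inl.1 he
    rcases z with a | i
    · exact ⟨a, rfl, Sum.inl.inj h1⟩
    · cases h2
  · rintro ⟨a, rfl, h⟩
    exact ⟨P.edge a, Diagram.glue_lab_eq_inl.2 ⟨by rw [sumPerm_inl, h], rfl⟩⟩

/-- The component of a point of the diagram. -/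
def compOf (ψ : P.Pairing) : X ⊕ W → Comp ψ := Sum.map (orb ψ) id

/-- A point of each component. -/
noncomputable def compRep (ψ : P.Pairing) : Comp ψ → X ⊕ W := Sum.map Quotient.out id

theorem compOf_compRep (ψ : P.Pairing) (i : Comp ψ) : compOf ψ (compRep ψ i) = i := by
  rcases i with o | i
  · exact congrArg Sum.inl (Quotient.out_eq o)
  · rfl

theorem compOf_eq_iff [Finite X] [Finite W] (ψ : P.Pairing) {z z' : X ⊕ W} :
    compOf ψ z = compOf ψ z' ↔ (glueDiag ψ).next.SameCycle z z' := by
  rw [sameCycle_iff_iterate]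
  rcases z with a | i <;> rcases z' with a' | i'
  · simp only [glueDiag_iterate_inl, Sum.inl.injEq, ← sameCycle_iff_iterate]
    exact Sum.inl_injective.eq_iff.trans Quotient.eq
  · simp [glueDiag_iterate_inl, compOf]
  · simp [glueDiag_iterate_inr, compOf]
  · simp [glueDiag_iterate_inr, compOf]

theorem inv_compOf [Finite X] [Finite W] (ψ : P.Pairing) (q : Comp ψ → Prop) :
    (glueDiag ψ).Inv fun z => q (compOf ψ z) := by
  intro z
  have : compOf ψ ((glueDiag ψ).next z) = compOf ψ z :=
    (compOf_eq_iff ψ).2 ((sameCycle_iff_iterate.2 ⟨1, rfl⟩ :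
      (glueDiag ψ).next.SameCycle z _).symm)
  exact iff_of_eq (congrArg q this)

/-- The points of the diagram that correspond to the data of a part. -/
noncomputable def partMap (ψ : P.Pairing) (q : Comp ψ → Prop) :
    {a : X // Keep ψ q a} ⊕ {i : Comp ψ // KeepIdem ψ q i} → X ⊕ W :=
  Sum.elim (fun a => Sum.inl a.1) fun i => compRep ψ i.1

/-- Links the two models of gluing. The first return map of `part` skips exactly those points on the
chosen orbits that `glueDiag` relabels by vertices, and an orbit inside the pairing is represented
by one of its points. -/
theorem red_part [Finite X] [Finite W] (ψ : P.Pairing) (q : Comp ψ → Prop) :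
    Diagram.Red (partMap ψ q) (part ψ q).toDiag (glueDiag ψ) fun z => q (compOf ψ z) := by
  refine Diagram.red_of_collection (Sum.inl_injective.comp Subtype.val_injective)
    (fun a => a.2.2) (fun b => ?_) ?_ ?_ ?_ ?_ ?_ ?_ ?_ (inv_compOf ψ q)
  · rw [compOf_compRep]
    exact b.2.1
  · intro a
    exact Diagram.glue_lab_eq_inl.2 ⟨congrArg Sum.inl a.2.1, rfl⟩
  · rintro ⟨o | i, h⟩
    · have : ψ.1 o.out ≠ o.out := h.2 _ (congrArg Sum.inl (Quotient.out_eq o).symm)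
      exact Diagram.glue_lab_of_ne fun h' => this (Sum.inl.inj h')
    · exact Diagram.glue_lab_of_eq rfl
  · intro a
    have hpos := returnTime_pos (flow ψ) (Keep ψ q) a
    refine ⟨returnTime (flow ψ) (Keep ψ q) a - 1, ?_, ?_⟩
    · rw [Nat.sub_add_cancel hpos, glueDiag_iterate_inl]
      rfl
    · intro i hi hi'
      rw [glueDiag_iterate_inl, glueDiag_alive]
      rintro ⟨b, hb, hb'⟩
      refine not_of_lt_returnTime (flow ψ) (Keep ψ q) a hi (by omega) ?_
      rw [Sum.inl.inj hb]
      refine ⟨hb', ?_⟩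
      rw [← Sum.inl.inj hb, orb_iterate]
      exact a.2.2
  · intro z hz ha
    obtain ⟨a, rfl, ha'⟩ := (glueDiag_alive ψ z).1 ha
    exact ⟨⟨a, ha', hz⟩, rfl⟩
  · intro b z h ha
    obtain ⟨a, rfl, ha'⟩ := (glueDiag_alive ψ z).1 ha
    rw [← compOf_eq_iff, compOf_compRep] at h
    exact b.2.2 a h ha'
  · intro b b' h
    rw [← compOf_eq_iff, compOf_compRep, compOf_compRep] at h
    exact Subtype.ext h
  · intro z hz hd
    refine ⟨⟨compOf ψ z, hz, fun a ha h => ?_⟩, ?_⟩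
    · exact hd (Sum.inl a) ((compOf_eq_iff ψ).1 ha) ((glueDiag_alive ψ _).2 ⟨a, rfl, h⟩)
    · rw [← compOf_eq_iff, compOf_compRep]

theorem toSym_part [Fintype X] [Fintype W] (k : Type w) [Field k] (ψ : P.Pairing)
    (q : Comp ψ → Prop) :
    (part ψ q).toSym k = (glueDiag ψ).val k fun z => q (compOf ψ z) := by
  rw [toSym_eq_val, (red_part ψ q).val_eq k (isPath_glueDiag ψ) (inv_compOf ψ q)]

end Collection

end NormalForm

end NecklaceMoyal

namespace NecklaceMoyal

open Function

/-! ### Ordered and unordered choices of pairs -/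

section Ordered

variable {V : Type u} [Quiver.{v} V]

namespace Collection

variable {X W : Type} {P : Collection V X W}

/-- All pairs consist of one point that satisfies `T` and one that does not. -/
def Splits (T : X → Prop) (ψ : P.Pairing) : Prop := ∀ a, ψ.1 a ≠ a → (T (ψ.1 a) ↔ ¬ T a)

theorem OrdPairing.toPairing_apply {N : ℕ} (ι : P.OrdPairing N) (s : Fin N ⊕ Fin N) :
    ι.toPairing.1 (ι.1 s) = ι.1 s.swap :=
  Equiv.Perm.viaEmbedding_apply _ ι.1 s

theorem OrdPairing.mem_range {N : ℕ} (ι : P.OrdPairing N) {a : X} :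
    ι.toPairing.1 a ≠ a ↔ a ∈ Set.range ι.1 := by
  constructor
  · intro h
    by_contra hn
    exact h (Equiv.Perm.viaEmbedding_apply_of_notMem _ ι.1 a hn)
  · rintro ⟨s, rfl⟩ h
    rw [OrdPairing.toPairing_apply] at h
    have := ι.1.injective h
    rcases s with s | s <;> cases this

section

variable {T : X → Prop} {N : ℕ} {ι : P.OrdPairing N}
  (h : ∀ i, T (ι.1 (Sum.inl i)) ∧ ¬ T (ι.1 (Sum.inr i)))
include h

theorem OrdPairing.splits : Splits T ι.toPairing := by
  intro a ha
  obtain ⟨s | s, rfl⟩ := ι.mem_range.1 ha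
  · rw [OrdPairing.toPairing_apply]
    exact iff_of_false (h s).2 (not_not.2 (h s).1)
  · rw [OrdPairing.toPairing_apply]
    exact iff_of_true (h s).1 (h s).2

/-- The first members of the pairs, as the moved points that satisfy `T`. -/
noncomputable def OrdPairing.equivMoved :
    Fin N ≃ {a : X // ι.toPairing.1 a ≠ a ∧ T a} :=
  Equiv.ofBijective (fun i => ⟨ι.1 (Sum.inl i), ι.mem_range.2 ⟨_, rfl⟩, (h i).1⟩) (by
    constructor
    · intro i i' hi
      exact Sum.inl.inj (ι.1.injective (congrArg Subtype.val hi))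
    · rintro ⟨a, ha, hT⟩
      obtain ⟨s | s, rfl⟩ := ι.mem_range.1 ha
      · exact ⟨s, rfl⟩
      · exact absurd hT (h s).2)

end

open Classical in
-- An ordered choice of `N` pairs is a pairing together with a numbering of its moved points in `T`.
-- The fibre over `ψ` is therefore the set of bijections from `Fin N` to these points.
theorem sum_ordPairing [Fintype X] {M : Type*} [AddCommMonoid M] (T : X → Prop) (N : ℕ)
    (g : P.Pairing → M) :
    ∑ ι : P.OrdPairing N with ∀ i, T (ι.1 (Sum.inl i)) ∧ ¬ T (ι.1 (Sum.inr i)), g ι.toPairing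
      = ∑ ψ : P.Pairing with Splits T ψ,
        if (Finset.univ.filter fun a => ψ.1 a ≠ a ∧ T a).card = N then N.factorial • g ψ else 0 := by
  rw [← Finset.sum_fiberwise_of_maps_to (g := OrdPairing.toPairing)
    (t := Finset.univ.filter fun ψ : P.Pairing => Splits T ψ)]
  · refine Finset.sum_congr rfl fun ψ hψ => ?_
    rw [Finset.mem_filter] at hψ
    have hS := hψ.2
    rw [Finset.sum_congr rfl (g := fun _ => g ψ) fun ι hι => by rw [(Finset.mem_filter.1 hι).2],
      Finset.sum_const]
    split_ifs with hN
    · congr 1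
      have hc : Fintype.card {a // ψ.1 a ≠ a ∧ T a} = N := by
        rw [Fintype.card_subtype, hN]
      have hf : N.factorial
          = (Finset.univ : Finset (Fin N ≃ {a // ψ.1 a ≠ a ∧ T a})).card := by
        rw [Finset.card_univ, Fintype.card_equiv
          (Fintype.equivOfCardEq ((Fintype.card_fin N).trans hc.symm)), Fintype.card_fin]
      rw [hf]
      symm
      refine Finset.card_bij (fun σ _ => ⟨⟨Sum.elim (fun i => (σ i).1) fun i => ψ.1 (σ i).1, ?_⟩,
        fun i => ?_⟩) ?_ ?_ ?_
      · refine Injective.sumElim (Subtype.val_injective.comp σ.injective)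
          (ψ.1.injective.comp (Subtype.val_injective.comp σ.injective)) fun i i' hi => ?_
        have := (σ i).2.2
        rw [hi] at this
        exact (hS _ (σ i').2.1).1 this (σ i').2.2
      · exact ψ.2.2 _ (σ i).2.1
      · intro σ _
        refine Finset.mem_filter.2 ⟨Finset.mem_filter.2 ⟨Finset.mem_univ _,
          fun i => ⟨(σ i).2.2, fun hT => ?_⟩⟩, ?_⟩
        · exact (hS _ (σ i).2.1).1 hT (σ i).2.2
        · apply Subtype.ext
          ext a
          by_cases ha : ψ.1 a = a
          · rw [ha]
            refine Equiv.Perm.viaEmbedding_apply_of_notMem _ _ a ?_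
            rintro ⟨i | i, rfl⟩
            · exact (σ i).2.1 ha
            · exact (σ i).2.1 (ψ.1.injective ha)
          · by_cases hT : T a
            · obtain ⟨i, hi⟩ := σ.surjective ⟨a, ha, hT⟩
              have ha' : a = (σ i).1 := by rw [hi]
              subst ha'
              exact Equiv.Perm.viaEmbedding_apply _ _ (Sum.inl i)
            · obtain ⟨i, hi⟩ := σ.surjective ⟨ψ.1 a, fun h' => ha (ψ.1.injective h'),
                (hS a ha).2 hT⟩
              have ha' : a = ψ.1 (σ i).1 := by rw [hi, ψ.2.1]
              rw [ha', ψ.2.1]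
              exact Equiv.Perm.viaEmbedding_apply _ _ (Sum.inr i)
      · intro σ _ σ' _ h
        ext i
        have := congrArg (fun ι : P.OrdPairing N => ι.1 (Sum.inl i)) h
        exact this
      · intro ι hι
        rw [Finset.mem_filter, Finset.mem_filter] at hι
        obtain ⟨⟨-, h⟩, rfl⟩ := hι
        refine ⟨OrdPairing.equivMoved h, Finset.mem_univ _, ?_⟩
        apply Subtype.ext
        ext s
        rcases s with i | i
        · rfl
        · exact ι.toPairing_apply (Sum.inl i)
    · rw [Finset.card_eq_zero.2, zero_smul]
      rw [Finset.filter_eq_empty_iff]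
      intro ι hι hψ'
      subst hψ'
      have := Fintype.card_congr (OrdPairing.equivMoved (Finset.mem_filter.1 hι).2)
      rw [Fintype.card_fin, Fintype.card_subtype] at this
      exact hN this.symm
  · intro ι hι
    rw [Finset.mem_filter] at hι ⊢
    exact ⟨Finset.mem_univ _, OrdPairing.splits hι.2⟩

open Classical in
theorem prod_ordPairing [Fintype X] {R : Type*} [CommMonoid R] {T : X → Prop} {N : ℕ}
    {ι : P.OrdPairing N} (h : ∀ i, T (ι.1 (Sum.inl i)) ∧ ¬ T (ι.1 (Sum.inr i))) (f : X → R) :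
    ∏ i, f (ι.1 (Sum.inl i)) = ∏ a with ι.toPairing.1 a ≠ a ∧ T a, f a := by
  rw [Finset.prod_subtype (p := fun a => ι.toPairing.1 a ≠ a ∧ T a) _ (fun a => by simp),
    ← (OrdPairing.equivMoved h).prod_comp]
  rfl

open Classical in
-- The `N!` numberings of the pairs cancel the coefficient `1/N!`. The bound `B` ensures that each
-- pairing is met in the truncated exponential.
theorem sum_exp [Fintype X] (k : Type w) [Field k] [CharZero k] {M : Type*} [AddCommGroup M]
    [Module k[X] M] (T : X → Prop) (g : P.Pairing → M) (B : ℕ)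
    (hB : ∀ ψ : P.Pairing, Splits T ψ → (Finset.univ.filter fun a => ψ.1 a ≠ a ∧ T a).card < B) :
    ∑ N ∈ Finset.range B, (Polynomial.C ((N.factorial : k)⁻¹) * halfH k ^ N) •
        ∑ ι : P.OrdPairing N with ∀ i, T (ι.1 (Sum.inl i)) ∧ ¬ T (ι.1 (Sum.inr i)), g ι.toPairing
      = ∑ ψ : P.Pairing with Splits T ψ,
        halfH k ^ (Finset.univ.filter fun a => ψ.1 a ≠ a ∧ T a).card • g ψ := by
  simp only [sum_ordPairing, Finset.smul_sum]
  rw [Finset.sum_comm]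
  refine Finset.sum_congr rfl fun ψ hψ => ?_
  simp only [smul_ite, smul_zero]
  rw [Finset.sum_ite_eq, if_pos (Finset.mem_range.2 (hB ψ (Finset.mem_filter.1 hψ).2)),
    ← Nat.cast_smul_eq_nsmul k[X], smul_smul, mul_right_comm]
  congr 1
  rw [← map_natCast (Polynomial.C : k →+* k[X]), ← map_mul, inv_mul_cancel₀, map_one, one_mul]
  exact Nat.cast_ne_zero.2 (Nat.factorial_ne_zero _)

end Collection

end Ordered

end NecklaceMoyal

namespace NecklaceMoyal

open Function

/-! ### The Moyal operations on diagrams -/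

section Forms

variable {V : Type u} [Quiver.{v} V]

/-- The sign `1`, `0` or `-1` according as `a < b`, `a = b` or `a > b`. -/
def colSign {n : ℕ} (a b : Fin n) : ℤ := ((b : ℤ) - a).sign

theorem colSign_swap {n : ℕ} (a b : Fin n) : colSign a b = -colSign b a := by
  rw [colSign, colSign, ← Int.sign_neg, neg_sub]

theorem colSign_self {n : ℕ} (a : Fin n) : colSign a a = 0 := by simp [colSign]

namespace Diagram

variable {X : Type} (G : Diagram V X) (k : Type w) [Field k]

/-- `h / 2` with the sign of a point. -/
noncomputable def wgt (x : X) : k[X] := (lsign (G.lab x) : k[X]) * halfH k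

/-- The height function for which edges are lower than reverse edges. -/
def qht (x : X) : ℕ := Sum.elim (Sum.elim (fun _ => 0) fun _ => 1) (fun _ => 1) (G.lab x)

open Classical in
/-- The weight of a pair in the Moyal product. -/
noncomputable def crossW (p p' : X → Prop) (x y : X) : k[X] :=
  (if p x ∧ p' y then G.wgt k x else 0) + if p' x ∧ p y then G.wgt k y else 0

open Classical in
/-- The weight of a pair in the Moyal coproduct, for a colouring `c`. -/
noncomputable def colW (p : X → Prop) {n : ℕ} (c : X → Fin n) (x y : X) : k[X] :=
  if p x ∧ p y then G.wgt k x * (colSign (c x) (c y) : k[X]) else 0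

/-- Colourings of the points that satisfy `p`, extended by `0`. -/
noncomputable def cols [Finite X] (n : ℕ) [NeZero n] (p : X → Prop) : Finset (X → Fin n) :=
  (Set.toFinite {c : X → Fin n | ∀ x, ¬ p x → c x = 0}).toFinset

/-- Colourings that are constant on the cycles. -/
noncomputable def flowCols [Finite X] (n : ℕ) [NeZero n] (p : X → Prop) : Finset (X → Fin n) :=
  (Set.toFinite {c : X → Fin n | (∀ x, c (G.next x) = c x) ∧ ∀ x, ¬ p x → c x = 0}).toFinset

/-- The Moyal product of the collections of cycles given by `p` and `p'`. -/
noncomputable def mulForm [Finite X] (p p' : X → Prop) : SymL V k :=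
  psum G G.qht (G.crossW k p p') fun ψ => (G.glue ψ).val k fun x => p x ∨ p' x

/-- The Moyal coproduct of the collection of cycles given by `p`. -/
noncomputable def comulForm [Finite X] (p : X → Prop) : SymL V k ⊗[k[X]] SymL V k :=
  ∑ ψ ∈ G.pairings, ∑ c ∈ (G.glue ψ).flowCols 2 p,
    (∏ x ∈ low G.qht ψ, G.colW k p c x (ψ x)) •
      ((G.glue ψ).val k (fun x => p x ∧ c x = 0) ⊗ₜ[k[X]]
        (G.glue ψ).val k fun x => p x ∧ c x = 1)

variable {G k}

@[simp] theorem mem_cols [Finite X] {n : ℕ} [NeZero n] {p : X → Prop} {c : X → Fin n} :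
    c ∈ cols n p ↔ ∀ x, ¬ p x → c x = 0 := by simp [cols]

@[simp] theorem mem_flowCols [Finite X] {n : ℕ} [NeZero n] {p : X → Prop} {c : X → Fin n} :
    c ∈ G.flowCols n p ↔ (∀ x, c (G.next x) = c x) ∧ ∀ x, ¬ p x → c x = 0 := by simp [flowCols]

theorem separates_qht : G.Separates G.qht := by
  intro x y e hx hy
  rw [qht, qht, hx, hy]
  cases e <;> simp [edgeRev]

theorem wgt_partner {ψ : Equiv.Perm X} (hψ : G.IsPairing ψ) {x : X} (hx : ψ x ≠ x) :
    G.wgt k (ψ x) = -G.wgt k x := by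
  obtain ⟨e, h1, h2⟩ := hψ.2 x hx
  rw [wgt, wgt, h1, h2]
  simp [lsign, edgeSign_edgeRev]

theorem wgt_glue {ψ : Equiv.Perm X} {x : X} (h : ψ x = x) : (G.glue ψ).wgt k x = G.wgt k x := by
  rw [wgt, wgt, glue_lab_of_eq h]

theorem crossW_glue {ψ : Equiv.Perm X} {p p' : X → Prop} {x y : X} (hx : ψ x = x) (hy : ψ y = y) :
    (G.glue ψ).crossW k p p' x y = G.crossW k p p' x y := by
  rw [crossW, crossW, wgt_glue hx, wgt_glue hy]

theorem colW_glue {ψ : Equiv.Perm X} {p : X → Prop} {n : ℕ} {c : X → Fin n} {x y : X}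
    (hx : ψ x = x) : (G.glue ψ).colW k p c x y = G.colW k p c x y := by
  rw [colW, colW, wgt_glue hx]

theorem crossW_swap (p p' : X → Prop) (x y : X) : G.crossW k p p' x y = G.crossW k p p' y x := by
  classical
  rw [crossW, crossW, add_comm]
  congr 1 <;> exact if_congr and_comm rfl rfl

/-- Exchanging the members of a pair reverses both the sign of the edge and the sign of the colour
difference. -/
theorem colW_swap {ψ : Equiv.Perm X} (hψ : G.IsPairing ψ) (p : X → Prop) {n : ℕ} (c : X → Fin n)
    {x : X} (hx : ψ x ≠ x) : G.colW k p c x (ψ x) = G.colW k p c (ψ x) x := by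
  classical
  rw [colW, colW, wgt_partner hψ hx, colSign_swap]
  exact if_congr and_comm (by simp) rfl

theorem colW_supp (p : X → Prop) {n : ℕ} (c : X → Fin n) (x y : X)
    (h : G.colW k p c x y ≠ 0) : p x ∧ p y := by
  by_contra hn
  exact h (if_neg hn)

theorem crossW_supp (p p' : X → Prop) (x y : X)
    (h : G.crossW k p p' x y ≠ 0) : (p x ∨ p' x) ∧ (p y ∨ p' y) := by
  by_contra hn
  refine h ?_
  rw [crossW, if_neg fun h' => hn ⟨Or.inl h'.1, Or.inr h'.2⟩,
    if_neg fun h' => hn ⟨Or.inr h'.1, Or.inl h'.2⟩, add_zero]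

section Low

variable [Finite X] {R M : Type*} [CommRing R] [AddCommGroup M] [Module R M]

/-- A height function only selects one member of each pair, and `f` takes the same value at both.
Heights are therefore immaterial for symmetric weights such as those of the Moyal operations. -/
theorem prod_low_eq {ht ht' : X → ℕ} {ψ : Equiv.Perm X} (hψ : ∀ x, ψ (ψ x) = x)
    (h : ∀ x, ψ x ≠ x → ht x ≠ ht (ψ x)) (h' : ∀ x, ψ x ≠ x → ht' x ≠ ht' (ψ x)) (f : X → R)
    (hf : ∀ x, ψ x ≠ x → f x = f (ψ x)) : ∏ x ∈ low ht ψ, f x = ∏ x ∈ low ht' ψ, f x := by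
  classical
  have key : ∀ {ht ht' : X → ℕ}, (∀ x, ψ x ≠ x → ht' x ≠ ht' (ψ x)) → ∀ x ∈ low ht ψ,
      (if ht' x < ht' (ψ x) then x else ψ x) ∈ low ht' ψ := by
    intro ht ht' h' x hx
    split_ifs with hlt
    · exact mem_low.2 hlt
    · rw [mem_low, hψ]
      exact lt_of_le_of_ne (not_lt.1 hlt) (h' x (ne_of_mem_low hx)).symm
  have inv : ∀ {ht ht' : X → ℕ}, ∀ x ∈ low ht ψ,
      (if ht (if ht' x < ht' (ψ x) then x else ψ x) < ht (ψ (if ht' x < ht' (ψ x) then x else ψ x))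
        then (if ht' x < ht' (ψ x) then x else ψ x)
        else ψ (if ht' x < ht' (ψ x) then x else ψ x)) = x := by
    intro ht ht' x hx
    rw [mem_low] at hx
    by_cases h1 : ht' x < ht' (ψ x)
    · rw [if_pos h1, if_pos hx]
    · rw [if_neg h1, hψ, if_neg hx.not_gt]
  refine Finset.prod_bij' (fun x _ => if ht' x < ht' (ψ x) then x else ψ x)
    (fun x _ => if ht x < ht (ψ x) then x else ψ x) (key h') (key h) inv inv ?_
  intro x hx
  split_ifs
  · rfl
  · exact hf x (ne_of_mem_low hx)

omit [Finite X] in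
theorem Separates.ne {ht : X → ℕ} (hs : G.Separates ht) {ψ : Equiv.Perm X}
    (hψ : G.IsPairing ψ) {x : X} (hx : ψ x ≠ x) : ht x ≠ ht (ψ x) := by
  obtain ⟨e, h1, h2⟩ := hψ.2 x hx
  exact hs x (ψ x) e h1 h2

theorem Separates.prod_low_eq {ht ht' : X → ℕ} (hs : G.Separates ht) (hs' : G.Separates ht')
    {a : X → X → R} {ψ : Equiv.Perm X} (hψ : G.IsPairing ψ)
    (ha : ∀ x, ψ x ≠ x → a x (ψ x) = a (ψ x) x) :
    ∏ x ∈ low ht ψ, a x (ψ x) = ∏ x ∈ low ht' ψ, a x (ψ x) :=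
  Diagram.prod_low_eq (f := fun x => a x (ψ x)) hψ.1 (fun x hx => hs.ne hψ (x := x) hx)
    (fun x hx => hs'.ne hψ (x := x) hx) fun x hx => by rw [ha x hx, hψ.1]

theorem psum_change_ht {ht ht' : X → ℕ} (hs : G.Separates ht) (hs' : G.Separates ht')
    {a : X → X → R} (ha : ∀ ψ, G.IsPairing ψ → ∀ x, ψ x ≠ x → a x (ψ x) = a (ψ x) x)
    (F : Equiv.Perm X → M) : psum G ht a F = psum G ht' a F :=
  Finset.sum_congr rfl fun ψ hψ => by
    rw [hs.prod_low_eq hs' (mem_pairings.1 hψ) (ha ψ (mem_pairings.1 hψ))]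

end Low

open Classical in
/-- The coproduct as a sum over colourings. -/
theorem comulForm_eq [Finite X] {ht : X → ℕ} (hs : G.Separates ht) (p : X → Prop) :
    G.comulForm k p = ∑ c ∈ cols 2 p, psum G ht (G.colW k p c) fun ψ =>
      if ∀ x, c (G.next (ψ x)) = c x then
        (G.glue ψ).val k (fun x => p x ∧ c x = 0) ⊗ₜ[k[X]]
          (G.glue ψ).val k (fun x => p x ∧ c x = 1) else 0 := by
  rw [comulForm, Finset.sum_congr rfl fun c _ => psum_change_ht hs separates_qht
    (a := G.colW k p c) (fun ψ hψ x hx => colW_swap hψ p c hx) _]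
  simp only [psum]
  rw [Finset.sum_comm]
  refine Finset.sum_congr rfl fun ψ _ => ?_
  simp only [smul_ite, smul_zero]
  rw [← Finset.sum_filter]
  refine Finset.sum_congr ?_ fun _ _ => rfl
  ext c
  simp [and_comm]

/-! ### Invariance under reduction -/

variable {Y : Type} {j : Y → X} {G' : Diagram V Y} {p : X → Prop}

theorem Red.wgt_eq (h : Red j G' G p) (y : Y) : G'.wgt k y = G.wgt k (j y) := by
  rw [wgt, wgt, h.lab_eq]

theorem Red.qht_eq (h : Red j G' G p) (y : Y) : G'.qht y = G.qht (j y) := by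
  rw [qht, qht, h.lab_eq]

theorem Red.mulForm_eq [Finite X] [Finite Y] {q q' : X → Prop}
    (h : Red j G' G fun x => q x ∨ q' x) (hG : G.IsPath) (hq : G.Inv q) (hq' : G.Inv q') :
    G'.mulForm k (fun y => q (j y)) (fun y => q' (j y)) = G.mulForm k q q' := by
  have hp : G.Inv fun x => q x ∨ q' x := fun x => or_congr (hq x) (hq' x)
  refine h.psum_eq (M := SymL V k) separates_qht (fun y y' _ _ => by rw [h.qht_eq, h.qht_eq])
    (crossW_supp q q') (fun y y' => ?_) fun φ hφ => ?_
  · rw [crossW, crossW, h.wgt_eq, h.wgt_eq]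
  · rw [← h.val_glue k hG hp hφ]
    congr 1
    ext y
    exact iff_true_intro (h.mem y)

/-- A colouring constant on cycles is determined by its values at kept points, as each cycle in `p`
meets them; outside `p` it is `0` by convention. -/
theorem Red.sum_flowCols (h : Red j G' G p) [Finite X] [Finite Y] (hp : G.Inv p) {n : ℕ} [NeZero n]
    {M : Type*} [AddCommMonoid M] {F : (X → Fin n) → M} {F' : (Y → Fin n) → M}
    (hF : ∀ c ∈ G.flowCols n p, F' (c ∘ j) = F c) :
    ∑ c ∈ G'.flowCols n (fun _ => True), F' c = ∑ c ∈ G.flowCols n p, F c := by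
  classical
  have hit : ∀ {c : X → Fin n}, (∀ x, c (G.next x) = c x) → ∀ m x, c (G.next^[m] x) = c x := by
    intro c hc m x
    induction m with
    | zero => rfl
    | succ m ih => rw [iterate_succ_apply', hc, ih]
  symm
  refine Finset.sum_bij (fun c _ => c ∘ j) ?_ ?_ ?_ fun c hc => (hF c hc).symm
  · intro c hc
    rw [mem_flowCols] at hc ⊢
    refine ⟨fun y => ?_, fun _ hy => absurd trivial hy⟩
    obtain ⟨m, hm, -⟩ := h.step y
    rw [comp_apply, comp_apply, ← hm, hit hc.1]
  · intro c hc c' hc' he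
    rw [mem_flowCols] at hc hc'
    ext x
    by_cases hx : p x
    · obtain ⟨m, y, hy⟩ := h.meets x hx
      rw [← hit hc.1 m, ← hit hc'.1 m, ← hy]
      exact congrArg Fin.val (congrFun he y)
    · rw [hc.2 x hx, hc'.2 x hx]
  · intro c' hc'
    rw [mem_flowCols] at hc'
    have hc'' : ∀ {y y'}, G'.next.SameCycle y y' → c' y = c' y' := by
      intro y y' hy
      obtain ⟨m, rfl⟩ := sameCycle_iff_iterate.1 hy
      clear hy
      induction m with
      | zero => rfl
      | succ m ih => rw [iterate_succ_apply', hc'.1, ih]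
    have hex : ∀ x, ∃ a : Fin n, (p x → ∀ y, G.next.SameCycle x (j y) → a = c' y) ∧
        (¬ p x → a = 0) := by
      intro x
      by_cases hx : p x
      · obtain ⟨m, y, hy⟩ := h.meets x hx
        refine ⟨c' y, fun _ y' hy' => hc'' (h.sameCycle_iff.1 ?_), fun h' => absurd hx h'⟩
        rw [hy]
        exact (sameCycle_iff_iterate.2 ⟨m, rfl⟩ : G.next.SameCycle x _).symm.trans hy'
      · exact ⟨0, fun h' => absurd h' hx, fun _ => rfl⟩
    choose c hc1 hc2 using hex
    refine ⟨c, ?_, ?_⟩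
    · rw [mem_flowCols]
      refine ⟨fun x => ?_, hc2⟩
      by_cases hx : p x
      · obtain ⟨m, y, hy⟩ := h.meets x hx
        have h1 : G.next.SameCycle x (j y) := sameCycle_iff_iterate.2 ⟨m, hy.symm⟩
        have h2 : G.next.SameCycle x (G.next x) := sameCycle_iff_iterate.2 ⟨1, rfl⟩
        rw [hc1 x hx y h1, hc1 _ ((hp x).2 hx) y (h2.symm.trans h1)]
      · rw [hc2 x hx, hc2 _ fun h' => hx ((hp x).1 h')]
    · ext y
      rw [comp_apply, hc1 _ (h.mem y) y (Equiv.Perm.SameCycle.refl _ _)]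

theorem inv_of_mem_flowCols [Finite X] {n : ℕ} [NeZero n] {c : X → Fin n}
    (hc : c ∈ G.flowCols n p) (a : Fin n) : G.Inv fun x => c x = a := by
  intro x
  show c (G.next x) = a ↔ c x = a
  rw [(mem_flowCols.1 hc).1]

theorem Red.comulForm_eq [Finite X] [Finite Y] (h : Red j G' G p) (hG : G.IsPath)
    (hp : G.Inv p) : G'.comulForm k (fun _ => True) = G.comulForm k p := by
  refine h.sum_pairings (M := SymL V k ⊗[k[X]] SymL V k) ?_ ?_
  · intro φ hφ
    have hG' := hG.glue ((h.isPairing_iff φ).2 hφ)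
    have hp' := hp.glue (h.viaEmbedding_inv φ)
    refine (h.glue φ).sum_flowCols hp' fun c hc => ?_
    have hv : ∀ a : Fin 2, (G'.glue φ).val k (fun y => True ∧ (c ∘ j) y = a)
        = (G.glue (φ.viaEmbedding ⟨j, h.inj⟩)).val k fun x => p x ∧ c x = a := by
      intro a
      rw [← (h.glue φ).val_eq_and k hG' hp' (inv_of_mem_flowCols hc a)]
      simp
    rw [hv, hv, h.prod_low (ht := G.qht) (ht' := G'.qht) (fun y y' _ _ => by rw [h.qht_eq, h.qht_eq]) _ hφ]
    congr 1
    refine Finset.prod_congr rfl fun y _ => ?_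
    rw [colW, colW, h.wgt_eq]
    simp [h.mem]
  · intro ψ hψ hne x hx
    obtain ⟨c, hc, hne⟩ := Finset.exists_ne_zero_of_sum_ne_zero hne
    refine supp_of_weight separates_qht (colW_supp (G := G) (k := k) p c) hψ
      (fun x hx h0 => hne ?_) hx
    rw [Finset.prod_eq_zero hx h0, zero_smul]

end Diagram

end Forms

end NecklaceMoyal

namespace NecklaceMoyal

open Function

/-! ### The explicit formulas for collections -/

section Formulas

variable {V : Type u} [Quiver.{v} V]

namespace Collection

open Diagram

variable {X W : Type} (P : Collection V X W)

variable {P} in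
open Classical in
-- With the heights `qht` the lower member of each pair is the one in `Q`.
theorem prod_low_sumPerm [Fintype X] [Finite W] {R : Type*} [CommRing R] (ψ : P.Pairing)
    (f : X ⊕ W → R) :
    ∏ z ∈ low P.toDiag.qht (sumPerm W ψ.1), f z
      = ∏ a with ψ.1 a ≠ a ∧ (P.edge a).isLeft = true, f (Sum.inl a) := by
  have hlt : ∀ a, P.toDiag.qht (Sum.inl a) < P.toDiag.qht (Sum.inl (ψ.1 a)) ↔
      ψ.1 a ≠ a ∧ (P.edge a).isLeft = true := by
    intro a
    by_cases h : ψ.1 a = a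
    · simp [h]
    · rw [qht, qht, toDiag_lab_inl, toDiag_lab_inl, ψ.2.2 a h]
      rcases P.edge a with e | e <;> simp [edgeRev, h]
  symm
  refine Finset.prod_bij (fun a _ => Sum.inl a) ?_ (fun _ _ _ _ h => Sum.inl.inj h) ?_
    fun _ _ => rfl
  · intro a ha
    exact mem_low.2 ((hlt a).2 (Finset.mem_filter.1 ha).2)
  · rintro (a | i) hz
    · exact ⟨a, Finset.mem_filter.2 ⟨Finset.mem_univ _, (hlt a).1 (mem_low.1 hz)⟩, rfl⟩
    · exact absurd (mem_low.1 hz) (lt_irrefl _)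

variable {P} in
open Classical in
theorem card_moved [Fintype X] (T : X → Prop) (ψ : P.Pairing) (h : Splits T ψ) :
    (Finset.univ.filter fun a => ψ.1 a ≠ a).card / 2
      = (Finset.univ.filter fun a => ψ.1 a ≠ a ∧ T a).card := by
  have h1 := Finset.card_filter_add_card_filter_not (s := Finset.univ.filter fun a => ψ.1 a ≠ a) T
  rw [Finset.filter_filter, Finset.filter_filter] at h1
  have h2 : (Finset.univ.filter fun a => ψ.1 a ≠ a ∧ ¬ T a).card
      = (Finset.univ.filter fun a => ψ.1 a ≠ a ∧ T a).card := by
    refine Finset.card_bij' (fun a _ => ψ.1 a) (fun a _ => ψ.1 a) ?_ ?_ (fun a _ => ψ.2.1 a)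
      fun a _ => ψ.2.1 a
    · intro a ha
      obtain ⟨h3, h4⟩ := (Finset.mem_filter.1 ha).2
      exact Finset.mem_filter.2 ⟨Finset.mem_univ _, fun h' => h3 (ψ.1.injective h'), (h a h3).2 h4⟩
    · intro a ha
      obtain ⟨h3, h4⟩ := (Finset.mem_filter.1 ha).2
      exact Finset.mem_filter.2 ⟨Finset.mem_univ _, fun h' => h3 (ψ.1.injective h'),
        fun h' => (h a h3).1 h' h4⟩
  omega

variable {P} in
theorem splits_isLeft (ψ : P.Pairing) : Splits (fun a => (P.edge a).isLeft = true) ψ := by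
  intro a ha
  have h := ψ.2.2 a ha
  show (P.edge (ψ.1 a)).isLeft = true ↔ ¬ (P.edge a).isLeft = true
  rw [h]
  cases P.edge a <;> simp [edgeRev]

variable {P} in
theorem sum_comp [Finite X] [Finite W] {M : Type*} [AddCommMonoid M] (ψ : P.Pairing) {n : ℕ}
    [NeZero n] [Fintype (Comp ψ → Fin n)] {F : (X ⊕ W → Fin n) → M} {F' : (Comp ψ → Fin n) → M}
    (h : ∀ c, F' c = F (c ∘ compOf ψ)) :
    ∑ c, F' c = ∑ c ∈ (glueDiag ψ).flowCols n (fun _ => True), F c := by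
  have hs : Surjective (compOf ψ) := fun i => ⟨_, compOf_compRep ψ i⟩
  refine Finset.sum_bij (fun c _ => c ∘ compOf ψ) ?_ ?_ ?_ fun c _ => h c
  · intro c _
    rw [mem_flowCols]
    refine ⟨fun z => congrArg c ((compOf_eq_iff ψ).2 ?_), fun _ hz => absurd trivial hz⟩
    exact (sameCycle_iff_iterate.2 ⟨1, rfl⟩ : (glueDiag ψ).next.SameCycle z _).symm
  · exact fun c _ c' _ he => hs.injective_comp_right he
  · intro c hc
    rw [mem_flowCols] at hc
    refine ⟨fun i => c (compRep ψ i), Finset.mem_univ _, ?_⟩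
    ext z
    have := (compOf_eq_iff ψ).1 (compOf_compRep ψ (compOf ψ z))
    obtain ⟨n, hn⟩ := sameCycle_iff_iterate.1 this
    have key : ∀ (n : ℕ) x, c ((glueDiag ψ).next^[n] x) = c x := by
      intro n x
      induction n with
      | zero => rfl
      | succ n ih => rw [iterate_succ_apply', hc.1, ih]
    exact congrArg Fin.val ((key n _).symm.trans (congrArg c hn))

variable {P} in
-- Since `ψ` is an involution, the flow sends `ψ a` to `next a`. So the target of `a` lies in the
-- component of the start of its partner, and `s_a` compares the colours of the two members of the
-- pair.
theorem orb_next (ψ : P.Pairing) (a : X) : orb ψ (P.next a) = orb ψ (ψ.1 a) := by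
  rw [← orb_iterate ψ (ψ.1 a) 1]
  show _ = orb ψ (P.next (ψ.1 (ψ.1 a)))
  rw [ψ.2.1]

theorem int_smul_tensor (k : Type w) [Field k] (n : ℤ) (t : SymL V k ⊗[k[X]] SymL V k) :
    n • t = (n : k[X]) • t :=
  (int_smul_eq_zsmul _ n t).trans (Int.cast_smul_eq_zsmul k[X] n t).symm

theorem comulSum_eq [Fintype X] [Fintype W] (k : Type w) [Field k] :
    P.comulSum k = P.toDiag.comulForm k fun _ => True := by
  classical
  rw [comulSum, comulForm]
  refine sum_pairing fun ψ => ?_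
  rw [Finset.smul_sum]
  refine sum_comp ψ fun c => ?_
  rw [split, toSym_part, toSym_part, prod_low_sumPerm ψ
    fun z => P.toDiag.colW k (fun _ => True) (c ∘ compOf ψ) z (sumPerm W ψ.1 z),
    int_smul_tensor, smul_smul]
  congr 1
  · rw [card_moved _ ψ (splits_isLeft ψ), Int.cast_prod, ← Finset.prod_const]
    trans ∏ a : X with ψ.1 a ≠ a ∧ (P.edge a).isLeft = true, halfH k * (arrowSign c a : k[X])
    · rw [Finset.prod_mul_distrib]
      congr!
    refine Finset.prod_congr (by congr) fun a ha => ?_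
    obtain ⟨h1, h2⟩ := (Finset.mem_filter.1 ha).2
    have h4 : lsign (P.toDiag.lab (Sum.inl a)) = 1 := by
      rw [toDiag_lab_inl]
      rcases hE : P.edge a with e | e
      · rfl
      · rw [hE] at h2
        exact absurd h2 Bool.false_ne_true
    rw [colW, if_pos ⟨trivial, trivial⟩, wgt, h4, Int.cast_one, one_mul, arrowSign, orb_next]
    congr 2
    show _ = colSign (c (Sum.inl (orb ψ a))) (c (Sum.inl (orb ψ (ψ.1 a))))
    generalize c (Sum.inl (orb ψ a)) = s
    generalize c (Sum.inl (orb ψ (ψ.1 a))) = t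
    revert s t
    decide
  · have h : ∀ j, (fun z => c (compOf ψ z) = j) = fun z => True ∧ (c ∘ compOf ψ) z = j :=
      fun j => funext fun z => (true_and _).symm
    rw [h 0, h 1]
    rfl

theorem comulExp_eq [Fintype X] [Fintype W] (k : Type w) [Field k] [CharZero k] :
    P.comulExp k = P.comulSum k := by
  classical
  have hT : ∀ {N : ℕ} (ι : P.OrdPairing N), (∀ i, (P.edge (ι.1 (Sum.inl i))).isLeft = true) ↔
      ∀ i, (P.edge (ι.1 (Sum.inl i))).isLeft = true ∧
        ¬ (P.edge (ι.1 (Sum.inr i))).isLeft = true := by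
    intro N ι
    refine forall_congr' fun i => ?_
    rw [ι.2 i]
    cases P.edge (ι.1 (Sum.inl i)) <;> simp [edgeRev]
  have hP : ∀ N, comulPow k P N = ∑ ι : P.OrdPairing N with
      ∀ i, (P.edge (ι.1 (Sum.inl i))).isLeft = true ∧ ¬ (P.edge (ι.1 (Sum.inr i))).isLeft = true,
      ∑ c : Comp ι.toPairing → Fin 2,
        (∏ a : X with ι.toPairing.1 a ≠ a ∧ (P.edge a).isLeft = true, arrowSign c a) •
          split k ι.toPairing c := by
    intro N
    rw [comulPow]
    simp only [hT]
    refine Finset.sum_congr rfl fun ι hι => Finset.sum_congr rfl fun c _ => ?_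
    rw [prod_ordPairing (T := fun a => (P.edge a).isLeft = true) (Finset.mem_filter.1 hι).2]
    congr!
  rw [comulExp, comulSum]
  simp only [hP]
  have h := sum_exp k (fun a => (P.edge a).isLeft = true) (fun ψ : P.Pairing =>
    ∑ c : Comp ψ → Fin 2, (∏ a : X with ψ.1 a ≠ a ∧ (P.edge a).isLeft = true, arrowSign c a) •
      split k ψ c) (Fintype.card X + 1)
    fun ψ _ => Nat.lt_succ_of_le (Finset.card_le_univ _)
  rw [Finset.filter_true_of_mem fun ψ _ => splits_isLeft ψ] at h
  refine Eq.trans ?_ (h.trans ?_)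
  · congr!
  · refine Finset.sum_congr rfl fun ψ _ => ?_
    rw [card_moved _ ψ (splits_isLeft ψ)]

/-! ### Unions of two collections and the Moyal product -/

variable {X' W' : Type} (R : Collection V X' W')

/-- The points of the first of two collections. -/
def onLeft (z : (X ⊕ X') ⊕ (W ⊕ W')) : Prop := Sum.elim Sum.isLeft Sum.isLeft z = true

/-- The points of the second of two collections. -/
def onRight (z : (X ⊕ X') ⊕ (W ⊕ W')) : Prop := ¬ onLeft z

theorem inv_onLeft : (P.union R).toDiag.Inv onLeft := by
  rintro ((a | a) | (i | i)) <;> rfl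

theorem inv_onRight : (P.union R).toDiag.Inv onRight := fun z => not_congr (inv_onLeft P R z)

theorem red_inl : Red (Sum.map Sum.inl Sum.inl) P.toDiag (P.union R).toDiag onLeft := by
  have hn : ∀ z, onLeft z → z ∈ Set.range
      (Sum.map Sum.inl Sum.inl : X ⊕ W → (X ⊕ X') ⊕ (W ⊕ W')) := by
    rintro ((a | a) | (i | i)) h
    · exact ⟨Sum.inl a, rfl⟩
    · cases h
    · exact ⟨Sum.inr i, rfl⟩
    · cases h
  refine ⟨Sum.inl_injective.sumMap Sum.inl_injective, ?_, ?_, ?_, ?_, ?_⟩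
  · rintro (a | i) <;> rfl
  · rintro (a | i) <;> rfl
  · rintro (a | i)
    · exact ⟨0, rfl, fun i hi hi' => by omega⟩
    · exact ⟨0, rfl, fun i hi hi' => by omega⟩
  · exact fun z hz hz' => absurd (hn z hz) hz'
  · exact fun z hz => ⟨0, hn z hz⟩

theorem red_inr : Red (Sum.map Sum.inr Sum.inr) R.toDiag (P.union R).toDiag onRight := by
  have hn : ∀ z, onRight z → z ∈ Set.range
      (Sum.map Sum.inr Sum.inr : X' ⊕ W' → (X ⊕ X') ⊕ (W ⊕ W')) := by
    rintro ((a | a) | (i | i)) h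
    · exact absurd rfl h
    · exact ⟨Sum.inl a, rfl⟩
    · exact absurd rfl h
    · exact ⟨Sum.inr i, rfl⟩
  refine ⟨Sum.inr_injective.sumMap Sum.inr_injective, ?_, ?_, ?_, ?_, ?_⟩
  · rintro (a | i) <;> exact Bool.false_ne_true
  · rintro (a | i) <;> rfl
  · rintro (a | i)
    · exact ⟨0, rfl, fun i hi hi' => by omega⟩
    · exact ⟨0, rfl, fun i hi hi' => by omega⟩
  · exact fun z hz hz' => absurd (hn z hz) hz'
  · exact fun z hz => ⟨0, hn z hz⟩

theorem val_onLeft [Finite X] [Fintype W] [Finite X'] [Fintype W'] (k : Type w) [Field k] :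
    (P.union R).toDiag.val k onLeft = P.toSym k := by
  rw [toSym_eq_val, (red_inl P R).val_eq k (P.union R).isPath_toDiag (inv_onLeft P R)]

theorem val_onRight [Finite X] [Fintype W] [Finite X'] [Fintype W'] (k : Type w) [Field k] :
    (P.union R).toDiag.val k onRight = R.toSym k := by
  rw [toSym_eq_val, (red_inr P R).val_eq k (P.union R).isPath_toDiag (inv_onRight P R)]

open Classical in
-- A reverse edge in `P` is paired with an edge of `Q` in `R`, so the negative signs can be counted
-- in `R`.
theorem prod_edgeSign_left [Fintype X] [Fintype X'] (ψ : (P.union R).Pairing)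
    (h : ∀ z, ψ.1 z ≠ z → (ψ.1 z).isLeft ≠ z.isLeft) :
    ∏ a : X with ψ.1 (Sum.inl a) ≠ Sum.inl a, edgeSign (P.edge a)
      = (-1) ^ (Finset.univ.filter fun b : X' =>
        ψ.1 (Sum.inr b) ≠ Sum.inr b ∧ (R.edge b).isLeft = true).card := by
  have hex : ∀ a, ψ.1 (Sum.inl a) ≠ Sum.inl a → ∃ b, ψ.1 (Sum.inl a) = Sum.inr b := by
    intro a ha
    have := h _ ha
    rcases hb : ψ.1 (Sum.inl a) with b | b
    · rw [hb] at this
      exact absurd rfl this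
    · exact ⟨b, rfl⟩
  have hex' : ∀ b, ψ.1 (Sum.inr b) ≠ Sum.inr b → ∃ a, ψ.1 (Sum.inr b) = Sum.inl a := by
    intro b hb
    have := h _ hb
    rcases ha : ψ.1 (Sum.inr b) with a | a
    · exact ⟨a, rfl⟩
    · rw [ha] at this
      exact absurd rfl this
  have e2 : ∏ a : X with ψ.1 (Sum.inl a) ≠ Sum.inl a, edgeSign (P.edge a)
      = ∏ b : X' with ψ.1 (Sum.inr b) ≠ Sum.inr b, if (R.edge b).isLeft = true then (-1 : ℤ) else 1 := by
    choose f hf using hex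
    refine Finset.prod_bij (fun a ha => f a (Finset.mem_filter.1 ha).2) ?_ ?_ ?_ ?_
    · intro a ha
      refine Finset.mem_filter.2 ⟨Finset.mem_univ _, ?_⟩
      rw [← hf a (Finset.mem_filter.1 ha).2, ψ.2.1]
      exact fun h' => (Finset.mem_filter.1 ha).2 h'.symm
    · intro a ha a' ha' he
      have h1 := hf a (Finset.mem_filter.1 ha).2
      have h2 := hf a' (Finset.mem_filter.1 ha').2
      rw [he, ← h2] at h1
      exact Sum.inl.inj (ψ.1.injective h1)
    · intro b hb
      obtain ⟨a, ha⟩ := hex' b (Finset.mem_filter.1 hb).2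
      have ha' : ψ.1 (Sum.inl a) = Sum.inr b := by rw [← ha, ψ.2.1]
      have hm : ψ.1 (Sum.inl a) ≠ Sum.inl a := by rw [ha']; exact Sum.inr_ne_inl
      refine ⟨a, Finset.mem_filter.2 ⟨Finset.mem_univ _, hm⟩, ?_⟩
      exact Sum.inr.inj ((hf a hm).symm.trans ha')
    · intro a ha
      have h1 := ψ.2.2 (Sum.inl a) (Finset.mem_filter.1 ha).2
      rw [hf a (Finset.mem_filter.1 ha).2] at h1
      change R.edge _ = edgeRev (P.edge a) at h1
      rw [h1]
      cases P.edge a <;> simp [edgeRev, edgeSign]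
  rw [e2, ← Finset.prod_filter, Finset.filter_filter, Finset.prod_const]

theorem mulSum_eq [Fintype X] [Fintype W] [Fintype X'] [Fintype W'] (k : Type w) [Field k] :
    P.mulSum k R = (P.union R).toDiag.mulForm k onLeft onRight := by
  classical
  rw [mulSum, mulForm, psum, Finset.sum_filter]
  refine sum_pairing fun ψ => ?_
  have hval : (glue ψ).toSym k
      = (glueDiag ψ).val k fun x : (X ⊕ X') ⊕ (W ⊕ W') => onLeft x ∨ onRight x := by
    rw [toSym_part]
    congr 1
    ext z
    exact iff_of_true trivial (em _)
  split_ifs with h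
  · rw [hval]
    change _ = _ • (glueDiag ψ).val k _
    congr 1
    -- The weight `crossW` is symmetric, so the heights may be changed to put the first factor below
    -- the second. The lower members are then exactly the moved points of `P`.
    let ht : (X ⊕ X') ⊕ (W ⊕ W') → ℕ := fun z => if onLeft z then 0 else 1
    have hψ := isPairing_sumPerm (W := W ⊕ W') ψ
    have hcross : ∀ z, sumPerm (W ⊕ W') ψ.1 z ≠ z → (onLeft (sumPerm (W ⊕ W') ψ.1 z) ↔
        ¬ onLeft z) := by
      rintro (a | i) hz
      · have := h a fun h' => hz (congrArg Sum.inl h')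
        show (ψ.1 a).isLeft = true ↔ ¬ a.isLeft = true
        revert this
        cases (ψ.1 a).isLeft <;> cases a.isLeft <;> simp
      · exact absurd rfl hz
    rw [Diagram.prod_low_eq (ht' := ht) (f := fun z => (P.union R).toDiag.crossW k onLeft onRight z
      (sumPerm (W ⊕ W') ψ.1 z)) hψ.1 (fun z hz => separates_qht.ne hψ (x := z) hz) (fun z hz => by
        have := hcross z hz
        by_cases hl : onLeft z <;> simp_all [ht]) (fun z _ => by rw [crossW_swap, hψ.1])]
    have hlow : ∀ a, Sum.inl a ∈ low ht (sumPerm (W ⊕ W') ψ.1) ↔ ψ.1 a ≠ a ∧ a.isLeft = true := by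
      intro a
      rw [mem_low]
      by_cases ha : ψ.1 a = a
      · simp [ha]
      · have := hcross (Sum.inl a) fun h' => ha (Sum.inl.inj h')
        rw [sumPerm_inl] at this ⊢
        by_cases hl : onLeft (Sum.inl a : (X ⊕ X') ⊕ (W ⊕ W'))
        · have hl' : a.isLeft = true := hl
          simp [ht, hl, ha, hl', this]
        · have hl' : ¬ a.isLeft = true := hl
          simp only [ht, this, hl, not_false_eq_true, if_true, if_false]
          simp [hl']
    have e1 : ∏ z ∈ low ht (sumPerm (W ⊕ W') ψ.1), (P.union R).toDiag.crossW k onLeft onRight z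
        (sumPerm (W ⊕ W') ψ.1 z)
        = ∏ a : X with ψ.1 (Sum.inl a) ≠ Sum.inl a, (edgeSign (P.edge a) : k[X]) * halfH k := by
      symm
      refine Finset.prod_bij (fun a _ => Sum.inl (Sum.inl a)) ?_
        (fun _ _ _ _ h => Sum.inl.inj (Sum.inl.inj h)) ?_ ?_
      · intro a ha
        exact (hlow _).2 ⟨(Finset.mem_filter.1 ha).2, rfl⟩
      · rintro ((a | a) | i) hz
        · exact ⟨a, Finset.mem_filter.2 ⟨Finset.mem_univ _, ((hlow _).1 hz).1⟩, rfl⟩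
        · exact absurd ((hlow _).1 hz).2 (by simp)
        · exact absurd (mem_low.1 hz) (lt_irrefl _)
      · intro a ha
        have h1 : onRight (sumPerm (W ⊕ W') ψ.1 (Sum.inl (Sum.inl a))) := fun h' =>
          (hcross (Sum.inl (Sum.inl a)) fun h'' =>
            (Finset.mem_filter.1 ha).2 (Sum.inl.inj h'')).1 h' rfl
        rw [crossW, if_pos ⟨rfl, h1⟩, if_neg fun h' => h1 h'.2, add_zero]
        rfl
    rw [e1, Finset.prod_mul_distrib, Finset.prod_const, mul_comm, ← Int.cast_prod]
    rw [prod_edgeSign_left P R ψ h, Int.cast_pow, Int.cast_neg, Int.cast_one]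
  -- A pair inside one factor has `crossW` equal to `0`, so these pairings, absent from `mulSum`,
  -- contribute nothing.
  · push Not at h
    obtain ⟨a, ha, hs⟩ := h
    have hψ := isPairing_sumPerm (W := W ⊕ W') ψ
    have hz : ∀ a : X ⊕ X', (ψ.1 a).isLeft = a.isLeft → (P.union R).toDiag.crossW k onLeft onRight
        (Sum.inl a : (X ⊕ X') ⊕ (W ⊕ W')) (Sum.inl (ψ.1 a)) = 0 := by
      intro a hs
      have hl : onLeft (Sum.inl a : (X ⊕ X') ⊕ (W ⊕ W')) ↔
          onLeft (Sum.inl (ψ.1 a) : (X ⊕ X') ⊕ (W ⊕ W')) := by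
        show a.isLeft = true ↔ (ψ.1 a).isLeft = true
        rw [hs]
      rw [crossW, if_neg fun h' => h'.2 (hl.1 h'.1), if_neg fun h' => h'.1 (hl.2 h'.2), add_zero]
    rw [Finset.prod_eq_zero_iff.2, zero_smul]
    rcases separates_qht.lt_or_lt hψ (x := Sum.inl a) fun h' => ha (Sum.inl.inj h') with hlt | hlt
    · exact ⟨_, mem_low.2 hlt, hz a hs⟩
    · refine ⟨_, mem_low.2 hlt, hz (ψ.1 a) ?_⟩
      rw [ψ.2.1, hs]

theorem mulExp_eq [Fintype X] [Fintype W] [Fintype X'] [Fintype W'] (k : Type w) [Field k]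
    [CharZero k] : P.mulExp k R = P.mulSum k R := by
  classical
  have hT : ∀ {N : ℕ} (ι : (P.union R).OrdPairing N),
      (∀ i, (ι.1 (Sum.inl i)).isLeft = true ∧ (ι.1 (Sum.inr i)).isRight = true) ↔
        ∀ i, (ι.1 (Sum.inl i)).isLeft = true ∧ ¬ (ι.1 (Sum.inr i)).isLeft = true := by
    intro N ι
    simp
  have hP : ∀ N, mulPow k P R N = ∑ ι : (P.union R).OrdPairing N with
      ∀ i, (ι.1 (Sum.inl i)).isLeft = true ∧ ¬ (ι.1 (Sum.inr i)).isLeft = true,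
      (∏ a : X ⊕ X' with ι.toPairing.1 a ≠ a ∧ a.isLeft = true,
        edgeSign ((P.union R).edge a)) • (glue ι.toPairing).toSym k := by
    intro N
    rw [mulPow]
    simp only [hT]
    refine Finset.sum_congr rfl fun ι hι => ?_
    rw [prod_ordPairing (T := fun a => a.isLeft = true) (Finset.mem_filter.1 hι).2
      fun a => edgeSign ((P.union R).edge a)]
    congr!
  have hcard : ∀ ψ : (P.union R).Pairing,
      (Finset.univ.filter fun a : X ⊕ X' => ψ.1 a ≠ a ∧ a.isLeft = true).card
        = (Finset.univ.filter fun a : X => ψ.1 (Sum.inl a) ≠ Sum.inl a).card := by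
    intro ψ
    symm
    refine Finset.card_bij (fun a _ => Sum.inl a) ?_ (fun _ _ _ _ h => Sum.inl.inj h) ?_
    · intro a ha
      exact Finset.mem_filter.2 ⟨Finset.mem_univ _, (Finset.mem_filter.1 ha).2, rfl⟩
    · rintro (a | a) ha
      · exact ⟨a, Finset.mem_filter.2 ⟨Finset.mem_univ _, (Finset.mem_filter.1 ha).2.1⟩, rfl⟩
      · exact absurd (Finset.mem_filter.1 ha).2.2 (by simp)
  rw [mulExp]
  simp only [hP]
  -- Each pair uses one edge of `P`, so there are at most `#X` pairs; this justifies the truncation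
  -- in `mulExp`.
  have h := sum_exp k (fun a : X ⊕ X' => a.isLeft = true) (fun ψ : (P.union R).Pairing =>
    (∏ a : X ⊕ X' with ψ.1 a ≠ a ∧ a.isLeft = true,
        edgeSign ((P.union R).edge a)) • (glue ψ).toSym k) (Fintype.card X + 1)
    fun ψ _ => by
      have := hcard ψ
      refine lt_of_le_of_lt (le_of_eq ?_) (Nat.lt_succ_of_le
        (Finset.card_le_univ (Finset.univ.filter fun a : X => ψ.1 (Sum.inl a) ≠ Sum.inl a)))
      rw [← this]
      congr!
  refine Eq.trans ?_ (h.trans ?_)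
  · congr!
  have hS : ∀ ψ : (P.union R).Pairing, Splits (fun a => a.isLeft = true) ψ ↔
      ∀ z, ψ.1 z ≠ z → (ψ.1 z).isLeft ≠ z.isLeft := by
    refine fun ψ => forall_congr' fun z => imp_congr_right fun _ => ?_
    show ((ψ.1 z).isLeft = true ↔ ¬ z.isLeft = true) ↔ _
    cases (ψ.1 z).isLeft <;> cases z.isLeft <;> simp
  rw [mulSum]
  refine Finset.sum_congr (Finset.filter_congr fun ψ _ => hS ψ) fun ψ hψ => ?_
  have hψ := (Finset.mem_filter.1 hψ).2
  have e1 : ∏ a : X ⊕ X' with ψ.1 a ≠ a ∧ a.isLeft = true, edgeSign ((P.union R).edge a)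
      = ∏ a : X with ψ.1 (Sum.inl a) ≠ Sum.inl a, edgeSign (P.edge a) := by
    symm
    refine Finset.prod_bij (fun a _ => Sum.inl a) ?_ (fun _ _ _ _ h => Sum.inl.inj h) ?_
      fun _ _ => rfl
    · intro a ha
      exact Finset.mem_filter.2 ⟨Finset.mem_univ _, (Finset.mem_filter.1 ha).2, rfl⟩
    · rintro (a | a) ha
      · exact ⟨a, Finset.mem_filter.2 ⟨Finset.mem_univ _, (Finset.mem_filter.1 ha).2.1⟩, rfl⟩
      · exact absurd (Finset.mem_filter.1 ha).2.2 (by simp)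
  rw [e1, prod_edgeSign_left P R ψ hψ, ← Int.cast_smul_eq_zsmul k[X], smul_smul, Int.cast_pow,
    Int.cast_neg, Int.cast_one, ← hcard ψ]
  congr!

end Collection

end Formulas

end NecklaceMoyal

namespace NecklaceMoyal

open Function

/-! ### The Moyal operations evaluated on diagrams -/

section Evaluation

variable {V : Type u} [Quiver.{v} V]

namespace Diagram

variable {X Y Z : Type} {G : Diagram V X} {G' : Diagram V Y} {G'' : Diagram V Z} {j : Y → X}
  {p p' : X → Prop}

theorem Red.comp_equiv (h : Red j G' G p) (e : Z ≃ Y) (h' : Red e G'' G' fun _ => True) :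
    Red (j ∘ e) G'' G p := by
  have hr : Set.range (j ∘ e) = Set.range j := e.surjective.range_comp j
  refine ⟨h.inj.comp e.injective, fun z => h.mem _, fun z => (h'.lab_eq z).trans (h.lab_eq _),
    fun z => ?_, ?_, ?_⟩
  · obtain ⟨m, hm, hm'⟩ := h'.step z
    -- As `e` is surjective, no step of the second reduction can omit a point.
    obtain rfl : m = 0 := by
      by_contra hne
      exact hm' 1 one_pos (Nat.one_le_iff_ne_zero.2 hne) (e.surjective _)
    obtain ⟨n, hn, hn'⟩ := h.step (e z)
    refine ⟨n, hn.trans (congrArg j hm), ?_⟩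
    rw [hr]
    exact hn'
  · rw [hr]
    exact h.dead
  · rw [hr]
    exact h.meets

/-- The Moyal operations are defined through chosen presentations of monomials. Combining the normal
form with `exists_iso_present`, any part of a diagram reduces to the chosen presentation of its own
monomial. -/
theorem exists_present [Finite X] (hG : G.IsPath) (hp : G.Inv p) (k : Type w) [Field k] :
    ∃ m j, G.val k p = MvPolynomial.monomial m 1 ∧ Red j (present m).toDiag G p := by
  obtain ⟨A, B, hA, hB, Q, j, h⟩ := exists_collection hG hp
  have := Fintype.ofFinite A
  have := Fintype.ofFinite B
  obtain ⟨α, β, hi⟩ := Q.exists_iso_present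
  refine ⟨Q.mono, _, ?_, h.comp_equiv (Equiv.sumCongr α β) hi.red⟩
  rw [← h.val_eq k hG hp, ← Q.toSym_eq_val, Q.toSym_eq_monomial]

variable {A B A' B' : Type} {P : Collection V A B} {R : Collection V A' B'}
  {j : A ⊕ B → X} {j' : A' ⊕ B' → X}

/-- The embedding of the points of the union of two collections. -/
def unionMap (j : A ⊕ B → X) (j' : A' ⊕ B' → X) : (A ⊕ A') ⊕ (B ⊕ B') → X :=
  Sum.elim (Sum.elim (j ∘ Sum.inl) (j' ∘ Sum.inl)) (Sum.elim (j ∘ Sum.inr) (j' ∘ Sum.inr))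

theorem range_unionMap : Set.range (unionMap j j') = Set.range j ∪ Set.range j' := by
  ext x
  constructor
  · rintro ⟨(a | a) | (i | i), rfl⟩
    · exact Or.inl ⟨_, rfl⟩
    · exact Or.inr ⟨_, rfl⟩
    · exact Or.inl ⟨_, rfl⟩
    · exact Or.inr ⟨_, rfl⟩
  · rintro (⟨a | i, rfl⟩ | ⟨a | i, rfl⟩)
    · exact ⟨Sum.inl (Sum.inl a), rfl⟩
    · exact ⟨Sum.inr (Sum.inl i), rfl⟩
    · exact ⟨Sum.inl (Sum.inr a), rfl⟩
    · exact ⟨Sum.inr (Sum.inr i), rfl⟩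

theorem Red.union (h : Red j P.toDiag G p) (h' : Red j' R.toDiag G p') (hp : G.Inv p)
    (hp' : G.Inv p') (hd : ∀ x, p x → ¬ p' x) :
    Red (unionMap j j') (P.union R).toDiag G fun x => p x ∨ p' x := by
  have hne : ∀ z z', j z ≠ j' z' := fun z z' he => hd _ (h.mem z) (he ▸ h'.mem z')
  have key : ∀ z, (∃ n, G.next^[n + 1] (j z) = j (P.toDiag.next z) ∧
      ∀ i, 0 < i → i ≤ n → G.next^[i] (j z) ∉ Set.range (unionMap j j')) := by
    intro z
    obtain ⟨n, hn, hn'⟩ := h.step z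
    refine ⟨n, hn, fun i h0 hi => ?_⟩
    rw [range_unionMap]
    rintro (hr | ⟨z', hr⟩)
    · exact hn' i h0 hi hr
    · refine hd _ ((hp.iterate i _).2 (h.mem z)) ?_
      rw [← hr]
      exact h'.mem z'
  have key' : ∀ z, (∃ n, G.next^[n + 1] (j' z) = j' (R.toDiag.next z) ∧
      ∀ i, 0 < i → i ≤ n → G.next^[i] (j' z) ∉ Set.range (unionMap j j')) := by
    intro z
    obtain ⟨n, hn, hn'⟩ := h'.step z
    refine ⟨n, hn, fun i h0 hi => ?_⟩
    rw [range_unionMap]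
    rintro (⟨z', hr⟩ | hr)
    · refine hd _ (h.mem z') ?_
      rw [hr]
      exact (hp'.iterate i _).2 (h'.mem z)
    · exact hn' i h0 hi hr
  refine ⟨?_, ?_, ?_, ?_, ?_, ?_⟩
  · rintro ((a | a) | (i | i)) ((b | b) | (l | l)) he
    · exact congrArg (Sum.inl ∘ Sum.inl) (Sum.inl.inj (h.inj he))
    · exact absurd he (hne _ _)
    · exact absurd (h.inj he) Sum.inl_ne_inr
    · exact absurd he (hne _ _)
    · exact absurd he.symm (hne _ _)
    · exact congrArg (Sum.inl ∘ Sum.inr) (Sum.inl.inj (h'.inj he))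
    · exact absurd he.symm (hne _ _)
    · exact absurd (h'.inj he) Sum.inl_ne_inr
    · exact absurd (h.inj he) Sum.inr_ne_inl
    · exact absurd he (hne _ _)
    · exact congrArg (Sum.inr ∘ Sum.inl) (Sum.inr.inj (h.inj he))
    · exact absurd he (hne _ _)
    · exact absurd he.symm (hne _ _)
    · exact absurd (h'.inj he) Sum.inr_ne_inl
    · exact absurd he.symm (hne _ _)
    · exact congrArg (Sum.inr ∘ Sum.inr) (Sum.inr.inj (h'.inj he))
  · rintro ((a | a) | (i | i))
    · exact Or.inl (h.mem _)
    · exact Or.inr (h'.mem _)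
    · exact Or.inl (h.mem _)
    · exact Or.inr (h'.mem _)
  · rintro ((a | a) | (i | i))
    · exact h.lab_eq (Sum.inl a)
    · exact h'.lab_eq (Sum.inl a)
    · exact h.lab_eq (Sum.inr i)
    · exact h'.lab_eq (Sum.inr i)
  · rintro ((a | a) | (i | i))
    · exact key (Sum.inl a)
    · exact key' (Sum.inl a)
    · exact key (Sum.inr i)
    · exact key' (Sum.inr i)
  · rw [range_unionMap]
    rintro x (hx | hx) hn
    · exact h.dead x hx fun h' => hn (Or.inl h')
    · exact h'.dead x hx fun h' => hn (Or.inr h')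
  · rw [range_unionMap]
    rintro x (hx | hx)
    · obtain ⟨m, hm⟩ := h.meets x hx
      exact ⟨m, Or.inl hm⟩
    · obtain ⟨m, hm⟩ := h'.meets x hx
      exact ⟨m, Or.inr hm⟩

/-- The union of the chosen presentations of the two monomials is a reduction of the part `p ∨ p'`
of `G`, and `mulForm` is invariant under reduction. Iterated products can thus be computed inside
one diagram, without renewed presentations. -/
theorem moyalMul_val [Finite X] (hG : G.IsPath) (hp : G.Inv p) (hp' : G.Inv p')
    (hd : ∀ x, p x → ¬ p' x) (k : Type w) [Field k] [CharZero k] :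
    moyalMul V k (G.val k p) (G.val k p') = G.mulForm k p p' := by
  obtain ⟨m, j, hm, h⟩ := exists_present hG hp k
  obtain ⟨m', j', hm', h'⟩ := exists_present hG hp' k
  have e : ∀ m : Necklace V →₀ ℕ, MvPolynomial.monomial m (1 : k[X])
      = MvPolynomial.basisMonomials (Necklace V) k[X] m := fun m => by
    rw [MvPolynomial.coe_basisMonomials]
  rw [hm, hm', e, e, moyalMul, Module.Basis.constr_basis, Module.Basis.constr_basis,
    Collection.mulExp_eq, Collection.mulSum_eq, ← (h.union h' hp hp' hd).mulForm_eq hG hp hp']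
  congr 1 <;> ext ((a | a) | (i | i))
  · exact iff_of_true rfl (h.mem _)
  · exact iff_of_false Bool.false_ne_true fun hx => hd _ hx (h'.mem _)
  · exact iff_of_true rfl (h.mem _)
  · exact iff_of_false Bool.false_ne_true fun hx => hd _ hx (h'.mem _)
  · exact iff_of_false (fun hx => hx rfl) fun hx => hd _ (h.mem _) hx
  · exact iff_of_true Bool.false_ne_true (h'.mem _)
  · exact iff_of_false (fun hx => hx rfl) fun hx => hd _ (h.mem _) hx
  · exact iff_of_true Bool.false_ne_true (h'.mem _)

theorem moyalComul_val [Finite X] (hG : G.IsPath) (hp : G.Inv p)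
    (k : Type w) [Field k] [CharZero k] :
    moyalComul V k (G.val k p) = G.comulForm k p := by
  obtain ⟨m, j, hm, h⟩ := exists_present hG hp k
  have e : MvPolynomial.monomial m (1 : k[X])
      = MvPolynomial.basisMonomials (Necklace V) k[X] m := by
    rw [MvPolynomial.coe_basisMonomials]
  rw [hm, e, moyalComul, Module.Basis.constr_basis, Collection.comulExp_eq, Collection.comulSum_eq,
    h.comulForm_eq hG hp]

end Diagram

namespace Collection

variable {X W X' W' : Type} [Fintype X] [Fintype W] [Fintype X'] [Fintype W']
  (P : Collection V X W) (k : Type w) [Field k]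

theorem moyalMul_toSym [CharZero k] (R : Collection V X' W') :
    moyalMul V k (P.toSym k) (R.toSym k) = P.mulSum k R := by
  rw [← val_onLeft P R k, ← val_onRight P R k, Diagram.moyalMul_val (P.union R).isPath_toDiag
    (inv_onLeft P R) (inv_onRight P R) (fun _ => not_not.2), mulSum_eq]

theorem moyalComul_toSym [CharZero k] : moyalComul V k (P.toSym k) = P.comulSum k := by
  rw [toSym_eq_val, Diagram.moyalComul_val P.isPath_toDiag Diagram.inv_true, comulSum_eq]

omit [Fintype X] [Fintype X'] in
theorem Iso.withHeights_eq {P : Collection V X W} {Q : Collection V X' W'} {α : X' ≃ X}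
    {β : W' ≃ W} (h : Iso Q P α β) {n : ℕ} (H : X ≃ Fin n) :
    Q.withHeights (α.trans H) = P.withHeights H := by
  refine HColl.ext_val rfl (fun i => ?_) (fun i => ?_) ?_
  · exact congrArg (fun z => (H z : ℕ))
      ((h.next_eq _).symm.trans (congrArg P.next (α.apply_symm_apply _)))
  · exact (h.edge_eq _).symm.trans (congrArg P.edge (α.apply_symm_apply _))
  · show Finset.univ.val.map Q.idem = Finset.univ.val.map P.idem
    rw [← Multiset.map_univ_val_equiv β, Multiset.map_map]
    exact Multiset.map_congr rfl fun i _ => (h.idem_eq i).symm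

theorem Iso.average_eq {P : Collection V X W} {Q : Collection V X' W'} {α : X' ≃ X}
    {β : W' ≃ W} (h : Iso Q P α β) : Q.average k = P.average k := by
  classical
  have hc := Fintype.card_congr α
  have : ∀ n, n = Fintype.card X →
      (Polynomial.C ((n.factorial : k)⁻¹) • ∑ H : X' ≃ Fin n, (Q.withHeights H).toAlg k
        = P.average k) := by
    rintro n rfl
    rw [average]
    congr 1
    refine (Fintype.sum_bijective (fun H : X ≃ Fin (Fintype.card X) => α.trans H) ⟨?_, ?_⟩ _ _
      fun H => ?_).symm
    · intro H H' he
      ext x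
      have := congrArg Fin.val (Equiv.congr_fun he (α.symm x))
      simpa using this
    · intro H
      exact ⟨α.symm.trans H, by ext; simp⟩
    · rw [h.withHeights_eq H]
  exact this _ hc

theorem symmetrization_toSym : symmetrization V k (P.toSym k) = P.average k := by
  obtain ⟨α, β, h⟩ := P.exists_iso_present
  have e : MvPolynomial.monomial P.mono (1 : k[X])
      = MvPolynomial.basisMonomials (Necklace V) k[X] P.mono := by
    rw [MvPolynomial.coe_basisMonomials]
  rw [toSym_eq_monomial, e, symmetrization, Module.Basis.constr_basis, h.average_eq k]

end Collection

end Evaluation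

end NecklaceMoyal

namespace NecklaceMoyal

open Function

/-! ### The inverse of symmetrization, on diagrams with heights -/

section Quant

variable {V : Type u} [Quiver.{v} V]

namespace Diagram

variable {X Y : Type} {G : Diagram V X} {G' : Diagram V Y} {j : Y → X} {p p' : X → Prop}

open Classical in
/-- The weight of a point, for pairs inside `p`. -/
noncomputable def selfW (G : Diagram V X) (k : Type w) [Field k] (p : X → Prop) (x y : X) : k[X] :=
  if p x ∧ p y then G.wgt k x else 0

/-- The sum over all pairings of the signed powers of `h / 2` times the results of cutting and
gluing; the sign of a pair is the sign of its lower member. -/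
noncomputable def quant [Finite X] (G : Diagram V X) (ht : X → ℕ) (k : Type w) [Field k]
    (p : X → Prop) : SymL V k :=
  psum G ht (G.selfW k p) fun ψ => (G.glue ψ).val k p

variable {ht : X → ℕ} {k : Type w} [Field k]

theorem selfW_supp (p : X → Prop) (x y : X) (h : G.selfW k p x y ≠ 0) : p x ∧ p y := by
  by_contra hn
  exact h (if_neg hn)

theorem selfW_glue {ψ : Equiv.Perm X} {x y : X} (hx : ψ x = x) :
    (G.glue ψ).selfW k p x y = G.selfW k p x y := by
  rw [selfW, selfW, wgt_glue hx]

theorem Red.quant_eq [Finite X] [Finite Y] (h : Red j G' G p) (hG : G.IsPath) (hp : G.Inv p)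
    (hs : G.Separates ht) {ht' : Y → ℕ}
    (hht : ∀ y y', G'.Alive y → G'.Alive y' → (ht' y < ht' y' ↔ ht (j y) < ht (j y'))) :
    G'.quant ht' k (fun _ => True) = G.quant ht k p := by
  refine h.psum_eq (M := SymL V k) hs hht (selfW_supp p) (fun y y' => ?_)
    fun φ hφ => h.val_glue k hG hp hφ
  rw [selfW, selfW, if_pos ⟨trivial, trivial⟩, if_pos ⟨h.mem y, h.mem y'⟩, h.wgt_eq]

theorem inv_glue_of_supp {ψ : Equiv.Perm X} (hp : G.Inv p) (hψ : G.IsPairing ψ)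
    (h : ∀ x, ψ x ≠ x → p x) : (G.glue ψ).Inv p := by
  refine hp.glue fun x => ?_
  by_cases hx : ψ x = x
  · rw [hx]
  · exact iff_of_true (h _ (hψ.apply_ne hx)) (h x hx)

theorem inv_glue_of_not_supp {ψ : Equiv.Perm X} (hp : G.Inv p) (hψ : G.IsPairing ψ)
    (h : ∀ x, ψ x ≠ x → ¬ p x) : (G.glue ψ).Inv p := by
  refine hp.glue fun x => ?_
  by_cases hx : ψ x = x
  · rw [hx]
  · exact iff_of_false (h _ (hψ.apply_ne hx)) (h x hx)

/-- Gluing outside `p` leaves the cycles in `p` untouched. -/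
theorem val_glue_mul_left [Finite X] (hG : G.IsPath) {ψ₁ ψ₂ : Equiv.Perm X}
    (h₁ : G.IsPairing ψ₁) (h₂ : (G.glue ψ₁).IsPairing ψ₂) (hi : (G.glue ψ₁).Inv p)
    (hn : ∀ x, ψ₂ x ≠ x → ¬ p x) :
    ((G.glue ψ₁).glue ψ₂).val k p = (G.glue ψ₁).val k p := by
  have hf : ∀ x, p x → ψ₂ x = x := fun x hx => by_contra fun h => hn x h hx
  refine val_congr k ((hG.glue h₁).glue h₂) (hG.glue h₁) (inv_glue_of_not_supp hi h₂ hn) hi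
    (fun x hx => ?_) fun x hx => glue_lab_of_eq (hf x hx)
  show (G.glue ψ₁).next (ψ₂ x) = _
  rw [hf x hx]

/-- A pairing of the whole consists of pairs inside `p`, pairs inside `p'` and crossing pairs. Since
`p` lies below `p'`, the lower member of a crossing pair belongs to `p`, so its sign is the one in
the Moyal product. -/
theorem quant_or [Finite X] [CharZero k] (hG : G.IsPath) (hp : G.Inv p) (hp' : G.Inv p')
    (hd : ∀ x, p x → ¬ p' x) (hs : G.Separates ht)
    (hlt : ∀ x y, p x → p' y → G.Alive x → G.Alive y → ht x < ht y) :
    G.quant ht k (fun x => p x ∨ p' x)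
      = moyalMul V k (G.quant ht k p) (G.quant ht k p') := by
  have e1 : moyalMul V k (G.quant ht k p) (G.quant ht k p')
      = psum G ht (G.selfW k p) fun ψ₁ => psum G ht (G.selfW k p') fun ψ₂ =>
        moyalMul V k ((G.glue ψ₁).val k p) ((G.glue ψ₂).val k p') := by
    rw [quant, ← LinearMap.flip_apply, map_psum]
    congr 1
    ext1 ψ₁
    rw [LinearMap.flip_apply, quant, map_psum]
  rw [e1, psum_psum hs (selfW_supp p) fun x y h =>
    ⟨fun hx => hd x hx (selfW_supp p' x y h).1, fun hy => hd y hy (selfW_supp p' x y h).2⟩]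
  -- For `ψ₁` in `p` and `ψ₂` in `p'`, both values can be read off from the diagram glued along `ψ₁
  -- * ψ₂`. The Moyal product then adds the crossing pairs, and `psum_glue` merges them with `ψ₂`.
  have e2 : ∀ ψ₁, G.IsPairing ψ₁ → (∀ x ∈ low ht ψ₁, G.selfW k p x (ψ₁ x) ≠ 0) →
      psum (G.glue ψ₁) ht (G.selfW k p') (fun ψ₂ =>
        moyalMul V k ((G.glue ψ₁).val k p) ((G.glue ψ₂).val k p'))
      = psum (G.glue ψ₁) ht (fun x y => G.selfW k p' x y + G.crossW k p p' x y) fun ψ =>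
        (G.glue (ψ₁ * ψ)).val k fun x => p x ∨ p' x := by
    intro ψ₁ h₁ hne₁
    have hs₁ : ∀ x, ψ₁ x ≠ x → p x := fun x => supp_of_weight hs (selfW_supp p) h₁ hne₁
    rw [← psum_glue (hs.glue ψ₁)]
    refine psum_congr (fun _ _ => rfl) fun ψ₂ h₂ hne₂ => ?_
    have hs₂ : ∀ x, ψ₂ x ≠ x → p' x := fun x =>
      supp_of_weight (hs.glue ψ₁) (selfW_supp p') h₂ hne₂
    obtain ⟨h₂', hdis⟩ := isPairing_glue.1 h₂
    have hn₂ : ∀ x, ψ₂ x ≠ x → ¬ p x := fun x hx hx' => hd x hx' (hs₂ x hx)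
    have hn₁ : ∀ x, ψ₁ x ≠ x → ¬ p' x := fun x hx => hd x (hs₁ x hx)
    have h12 := h₁.mul h₂' hdis
    have hc : (G.glue ψ₂).glue ψ₁ = (G.glue ψ₁).glue ψ₂ := by
      rw [glue_glue hdis, glue_glue hdis.symm, hdis.commute.eq]
    rw [← val_glue_mul_left hG h₁ h₂ (inv_glue_of_supp hp h₁ hs₁) hn₂,
      ← val_glue_mul_left hG h₂' (isPairing_glue.2 ⟨h₁, hdis.symm⟩)
        (inv_glue_of_supp hp' h₂' hs₂) hn₁, hc, glue_glue hdis]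
    have hi : (G.glue (ψ₁ * ψ₂)).Inv p := by
      rw [← glue_glue hdis]
      exact inv_glue_of_not_supp (inv_glue_of_supp hp h₁ hs₁) h₂ hn₂
    have hi' : (G.glue (ψ₁ * ψ₂)).Inv p' := by
      rw [← glue_glue hdis]
      exact inv_glue_of_supp (inv_glue_of_not_supp hp' h₁ hn₁) h₂ hs₂
    rw [moyalMul_val (hG.glue h12) hi hi' hd, mulForm, psum_change_ht separates_qht (hs.glue _)
      fun ψ _ x _ => crossW_swap p p' x (ψ x)]
    refine psum_congr (fun ψ₃ h₃ => ?_) fun ψ₃ h₃ _ => ?_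
    · have hdis₃ := (isPairing_glue.1 h₃).2
      refine Finset.prod_congr rfl fun x hx => ?_
      have hx₃ := ne_of_mem_low hx
      exact crossW_glue ((hdis₃ x).resolve_right hx₃)
        ((hdis₃ (ψ₃ x)).resolve_right fun h' => hx₃ (ψ₃.injective h'))
    · rw [glue_glue (isPairing_glue.1 h₃).2, mul_assoc]
  rw [psum_congr (fun _ _ => rfl) e2,
    psum_glue hs _ _ fun ψ => (G.glue ψ).val k fun x => p x ∨ p' x, quant]
  refine psum_congr (fun ψ hψ => Finset.prod_congr rfl fun x hx => ?_) fun _ _ _ => rfl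
  obtain ⟨e, hx1, hx2⟩ := hψ.2 x (ne_of_mem_low hx)
  have hlt' := mem_low.1 hx
  -- This is where the order of the factors enters: a lower point in `p'` cannot have its partner in
  -- `p`.
  have hn : ¬ (p' x ∧ p (ψ x)) := fun h => (hlt _ _ h.2 h.1 ⟨_, hx2⟩ ⟨_, hx1⟩).not_gt hlt'
  have h1 := hd x
  have h2 := hd (ψ x)
  rw [selfW, selfW, selfW, crossW]
  by_cases a1 : p x <;> by_cases a2 : p' x <;> by_cases a3 : p (ψ x) <;> by_cases a4 : p' (ψ x) <;>
    simp_all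

end Diagram

end Quant

end NecklaceMoyal

namespace NecklaceMoyal

open Function

/-! ### Change of heights -/

section ChangeHeights

variable {V : Type u} [Quiver.{v} V]

namespace Diagram

variable {X : Type} [Finite X] {G : Diagram V X} {ht ht' : X → ℕ}

section Pair

variable {R M : Type*} [CommRing R] [AddCommGroup M] [Module R M]

open Classical in
-- Only the identity and the transposition avoid a zero factor. Together with `psum_glue` this
-- separates the pair `{i, j}` from all others.
theorem psum_single (hs : G.Separates ht) {i j : X} (hτ : G.IsPairing (Equiv.swap i j))
    (hij : ht i < ht j) (c : R) (F : Equiv.Perm X → M) :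
    psum G ht (fun x y => if x = i ∧ y = j then c else 0) F = F 1 + c • F (Equiv.swap i j) := by
  have hne : i ≠ j := fun h => hij.ne (congrArg ht h)
  have h1 : (1 : Equiv.Perm X) ≠ Equiv.swap i j := fun h => by
    have := Equiv.congr_fun h i
    rw [Equiv.swap_apply_left] at this
    exact hne this
  have hlow1 : low ht (1 : Equiv.Perm X) = ∅ := by
    ext x
    simp
  have hlow : low ht (Equiv.swap i j) = {i} := by
    ext x
    rw [mem_low, Finset.mem_singleton]
    constructor
    · intro hx
      by_contra hxi
      by_cases hxj : x = j
      · subst hxj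
        rw [Equiv.swap_apply_right] at hx
        exact hx.not_gt hij
      · rw [Equiv.swap_apply_of_ne_of_ne hxi hxj] at hx
        exact lt_irrefl _ hx
    · rintro rfl
      rwa [Equiv.swap_apply_left]
  rw [psum, ← Finset.sum_subset (s₁ := {1, Equiv.swap i j}), Finset.sum_pair h1, hlow1, hlow,
    Finset.prod_empty, one_smul, Finset.prod_singleton, Equiv.swap_apply_left, if_pos ⟨rfl, rfl⟩]
  · intro ψ hψ
    rw [Finset.mem_insert, Finset.mem_singleton] at hψ
    rcases hψ with rfl | rfl
    · exact mem_pairings.2 isPairing_one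
    · exact mem_pairings.2 hτ
  · intro ψ hψ hn
    have hψ := mem_pairings.1 hψ
    rw [Finset.mem_insert, Finset.mem_singleton, not_or] at hn
    by_contra h0
    have hall : ∀ x ∈ low ht ψ, x = i ∧ ψ x = j := by
      intro x hx
      by_contra hx'
      exact h0 (by rw [Finset.prod_eq_zero hx (if_neg hx'), zero_smul])
    have hmv : ∀ x, ψ x ≠ x → (x = i ∧ ψ x = j) ∨ (x = j ∧ ψ x = i) := by
      intro x hx
      rcases hs.lt_or_lt hψ hx with h | h
      · exact Or.inl (hall x (mem_low.2 h))
      · have := hall (ψ x) (mem_low.2 h)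
        rw [hψ.1] at this
        exact Or.inr this.symm
    have hex : ∃ x, ψ x ≠ x := by
      by_contra h
      push Not at h
      exact hn.1 (Equiv.ext h)
    have hψi : ψ i = j := by
      obtain ⟨x, hx⟩ := hex
      rcases hmv x hx with ⟨rfl, h⟩ | ⟨rfl, h⟩
      · exact h
      · rw [← h, hψ.1]
    refine hn.2 (Equiv.ext fun x => ?_)
    by_cases hxi : x = i
    · rw [hxi, Equiv.swap_apply_left, hψi]
    by_cases hxj : x = j
    · rw [hxj, Equiv.swap_apply_right, ← hψi, hψ.1]
    rw [Equiv.swap_apply_of_ne_of_ne hxi hxj]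
    by_contra hx
    rcases hmv x hx with h | h
    · exact hxi h.1
    · exact hxj h.1

end Pair

variable {k : Type w} [Field k]

open Classical in
/-- The weight of a point, for all pairs but `{i, j}`. -/
noncomputable def exceptW (G : Diagram V X) (k : Type w) [Field k] (i j x y : X) : k[X] :=
  if (x = i ∧ y = j) ∨ (x = j ∧ y = i) then 0 else G.wgt k x

/-- The heights `ht` and `ht'` differ by the interchange of the consecutive heights of `i`
and `j`. -/
structure Adjacent (G : Diagram V X) (ht ht' : X → ℕ) (i j : X) : Prop where
  lt : ht i < ht j
  lt' : ht' j < ht' i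
  iff : ∀ x y, G.Alive x → G.Alive y → ¬ ((x = i ∧ y = j) ∨ (x = j ∧ y = i)) →
    (ht x < ht y ↔ ht' x < ht' y)

omit [Finite X] in
theorem IsPairing.alive {ψ : Equiv.Perm X} (hψ : G.IsPairing ψ) {x : X} (hx : ψ x ≠ x) :
    G.Alive x ∧ G.Alive (ψ x) := by
  obtain ⟨e, h1, h2⟩ := hψ.2 x hx
  exact ⟨⟨_, h1⟩, ⟨_, h2⟩⟩

/-- If `i` and `j` are paired, both products contain the factor `0`; otherwise both heights select
the same lower points. -/
theorem Adjacent.prod_exceptW {i j : X} (h : G.Adjacent ht ht' i j) {ψ : Equiv.Perm X}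
    (hψ : G.IsPairing ψ) :
    ∏ x ∈ low ht ψ, G.exceptW k i j x (ψ x) = ∏ x ∈ low ht' ψ, G.exceptW k i j x (ψ x) := by
  by_cases hij : ψ i = j
  · have hji : ψ j = i := by rw [← hij, hψ.1]
    have hi : i ∈ low ht ψ := mem_low.2 (by rw [hij]; exact h.lt)
    have hj : j ∈ low ht' ψ := mem_low.2 (by rw [hji]; exact h.lt')
    have hi' : G.exceptW k i j i (ψ i) = 0 := if_pos (Or.inl ⟨rfl, hij⟩)
    have hj' : G.exceptW k i j j (ψ j) = 0 := if_pos (Or.inr ⟨rfl, hji⟩)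
    exact (Finset.prod_eq_zero hi hi').trans (Finset.prod_eq_zero hj hj').symm
  · refine Finset.prod_congr ?_ fun _ _ => rfl
    ext x
    rw [mem_low, mem_low]
    by_cases hx : ψ x = x
    · rw [hx]
      exact iff_of_false (lt_irrefl _) (lt_irrefl _)
    · refine h.iff _ _ (hψ.alive hx).1 (hψ.alive hx).2 ?_
      rintro (⟨rfl, h'⟩ | ⟨rfl, h'⟩)
      · exact hij h'
      · exact hij (by rw [← h', hψ.1])

omit [Finite X] in
theorem lsign_wgt {x : X} {e : DEdge V} (h : G.lab x = Sum.inl e) :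
    G.wgt k x = (edgeSign e : k[X]) * halfH k := by
  rw [wgt, h]
  rfl

/-- No pairing matches `i` with `j`, so the interchange alters no weight. -/
theorem Adjacent.quant_commute {i j : X} (h : G.Adjacent ht ht' i j)
    (hn : ¬ ∃ e, G.lab i = Sum.inl e ∧ G.lab j = Sum.inl (edgeRev e)) :
    G.quant ht k (fun _ => True) = G.quant ht' k fun _ => True := by
  have key : ∀ ht'' : X → ℕ, G.quant ht'' k (fun _ => True)
      = psum G ht'' (G.exceptW k i j) fun ψ => (G.glue ψ).val k fun _ => True := by
    intro ht''
    refine psum_congr (fun ψ hψ => Finset.prod_congr rfl fun x hx => ?_) fun _ _ _ => rfl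
    rw [selfW, if_pos ⟨trivial, trivial⟩, exceptW, if_neg]
    have hx := ne_of_mem_low hx
    rintro (⟨rfl, h'⟩ | ⟨rfl, h'⟩)
    · rw [← h'] at hn
      exact hn (hψ.2 _ hx)
    · have := hψ.2 _ (hψ.apply_ne hx)
      rw [hψ.1, h'] at this
      exact hn this
  rw [key, key, psum, psum]
  exact Finset.sum_congr rfl fun ψ hψ => by rw [h.prod_exceptW (mem_pairings.1 hψ)]

omit [Finite X] in
theorem isPairing_swap {i j : X} [DecidableEq X] {e : DEdge V} (hi : G.lab i = Sum.inl e)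
    (hj : G.lab j = Sum.inl (edgeRev e)) : G.IsPairing (Equiv.swap i j) := by
  refine ⟨fun x => by simp, fun x hx => ?_⟩
  by_cases h1 : x = i
  · subst h1
    rw [Equiv.swap_apply_left]
    exact ⟨e, hi, hj⟩
  by_cases h2 : x = j
  · subst h2
    rw [Equiv.swap_apply_right]
    exact ⟨edgeRev e, hj, by rw [edgeRev_edgeRev, hi]⟩
  exact absurd (Equiv.swap_apply_of_ne_of_ne h1 h2) hx

/-- Split the pairings according to whether they contain `{i, j}`. Those that do not contribute
equally for both heights; those that do differ in the weight of this pair, `wgt i` against `wgt j =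
-wgt i`, and their remaining pairs form the quantization of the glued diagram. -/
theorem Adjacent.quant_contract [DecidableEq X] [CharZero k] {i j : X} (h : G.Adjacent ht ht' i j)
    {e : DEdge V} (hi : G.lab i = Sum.inl e) (hj : G.lab j = Sum.inl (edgeRev e))
    (hs : G.Separates ht) (hs' : G.Separates ht') :
    G.quant ht k (fun _ => True) = G.quant ht' k (fun _ => True)
      + (edgeSign e • (Polynomial.X : k[X])) • (G.glue (Equiv.swap i j)).quant ht k
        fun _ => True := by
  have hτ := isPairing_swap hi hj
  have hij : i ≠ j := fun h' => h.lt.ne (congrArg ht h')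
  have key : ∀ {ht : X → ℕ} (hs : G.Separates ht) {i j : X} (hij : ht i < ht j)
      (hτ : G.IsPairing (Equiv.swap i j)), G.quant ht k (fun _ => True)
        = psum G ht (G.exceptW k i j) (fun ψ => (G.glue ψ).val k fun _ => True)
          + G.wgt k i • psum (G.glue (Equiv.swap i j)) ht (G.exceptW k i j)
            fun ψ => (G.glue (Equiv.swap i j * ψ)).val k fun _ => True := by
    intro ht hs i j hij hτ
    classical
    have := psum_single hs (by convert hτ) hij (G.wgt k i) fun ψ₁ =>
      psum (G.glue ψ₁) ht (G.exceptW k i j) fun ψ₂ => (G.glue (ψ₁ * ψ₂)).val k fun _ => True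
    rw [psum_glue hs _ _ fun ψ => (G.glue ψ).val k fun _ => True] at this
    simp only [one_mul, glue_one] at this
    refine Eq.trans ?_ (this.trans (by congr!))
    refine psum_congr (fun ψ hψ => Finset.prod_congr rfl fun x hx => ?_) fun _ _ _ => rfl
    rw [selfW, if_pos ⟨trivial, trivial⟩, exceptW]
    have hlt := mem_low.1 hx
    by_cases h1 : x = i ∧ ψ x = j
    · rw [if_pos h1, if_pos (Or.inl h1), add_zero, h1.1]
    · rw [if_neg h1, zero_add, if_neg]
      rintro (h2 | ⟨h2, h3⟩)
      · exact h1 h2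
      · rw [h3, h2] at hlt
        exact hlt.not_gt hij
  have e1 := key hs h.lt hτ
  have e2 := key hs' h.lt' (by rwa [Equiv.swap_comm])
  have hsym : G.exceptW k j i = G.exceptW k i j := by
    ext1 x
    ext1 y
    rw [exceptW, exceptW]
    congr 1
    exact propext or_comm
  have hw : G.wgt k j = -G.wgt k i := by
    have := wgt_partner (k := k) hτ (x := i) (by rw [Equiv.swap_apply_left]; exact hij.symm)
    rwa [Equiv.swap_apply_left] at this
  have hchange : ∀ {ψ₁ : Equiv.Perm X} (F : Equiv.Perm X → SymL V k),
      psum (G.glue ψ₁) ht (G.exceptW k i j) F = psum (G.glue ψ₁) ht' (G.exceptW k i j) F :=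
    fun F => Finset.sum_congr rfl fun ψ hψ => by
      rw [h.prod_exceptW (isPairing_glue.1 (mem_pairings.1 hψ)).1]
  have hchange' := hchange (ψ₁ := 1) fun ψ => (G.glue ψ).val k fun _ => True
  rw [glue_one] at hchange'
  rw [Equiv.swap_comm j i, hsym, ← hchange, ← hchange', hw] at e2
  have e3 : (G.glue (Equiv.swap i j)).quant ht k (fun _ => True)
      = psum (G.glue (Equiv.swap i j)) ht (G.exceptW k i j)
        fun ψ => (G.glue (Equiv.swap i j * ψ)).val k fun _ => True := by
    refine psum_congr (fun ψ hψ => Finset.prod_congr rfl fun x hx => ?_) fun ψ hψ _ => ?_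
    · have hdis := (isPairing_glue.1 hψ).2
      have hx := (hdis x).resolve_right (ne_of_mem_low hx)
      rw [selfW_glue hx, selfW, if_pos ⟨trivial, trivial⟩, exceptW, if_neg]
      rintro (⟨rfl, -⟩ | ⟨rfl, -⟩)
      · rw [Equiv.swap_apply_left] at hx
        exact hij hx.symm
      · rw [Equiv.swap_apply_right] at hx
        exact hij hx
    · rw [glue_glue (isPairing_glue.1 hψ).2]
  -- The two opposite weights `±h/2` combine to the full `h` of the relation.
  have hX : (edgeSign e • (Polynomial.X : k[X])) = G.wgt k i - -G.wgt k i := by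
    rw [lsign_wgt hi, halfH, zsmul_eq_mul, sub_neg_eq_add, ← mul_add, ← add_mul, ← map_add,
      ← two_mul, mul_inv_cancel₀ two_ne_zero, map_one, one_mul]
  rw [e1, e2, e3, hX, sub_smul]
  abel

theorem prod_low_split {R : Type*} [CommMonoid R] [DecidableEq X] {ψ : Equiv.Perm X}
    (hψ : ∀ x, ψ (ψ x) = x) {x : X} (hx : ht x ≠ ht (ψ x)) (f : X → R) :
    ∏ z ∈ low ht ψ, f z = (if ht x < ht (ψ x) then f x else f (ψ x)) *
      ∏ z ∈ (low ht ψ).filter fun z => ¬ (z = x ∨ z = ψ x), f z := by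
  rw [← Finset.prod_filter_mul_prod_filter_not (low ht ψ) fun z => z = x ∨ z = ψ x]
  congr 1
  split_ifs with h
  · rw [show (low ht ψ).filter (fun z => z = x ∨ z = ψ x) = {x} from ?_, Finset.prod_singleton]
    ext z
    rw [Finset.mem_filter, mem_low, Finset.mem_singleton]
    constructor
    · rintro ⟨h1, rfl | rfl⟩
      · rfl
      · rw [hψ] at h1
        exact absurd h h1.not_gt
    · rintro rfl
      exact ⟨h, Or.inl rfl⟩
  · have h := lt_of_le_of_ne (not_lt.1 h) hx.symm
    rw [show (low ht ψ).filter (fun z => z = x ∨ z = ψ x) = {ψ x} from ?_, Finset.prod_singleton]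
    ext z
    rw [Finset.mem_filter, mem_low, Finset.mem_singleton]
    constructor
    · rintro ⟨h1, rfl | rfl⟩
      · exact absurd h h1.not_gt
      · rfl
    · rintro rfl
      rw [hψ]
      exact ⟨h, Or.inr rfl⟩

/-- Only the pair `{x, ψ x}` notices the exchange: its other member becomes the lower one, and this
has the opposite sign. -/
theorem prod_wgt_swap [DecidableEq X] {ψ : Equiv.Perm X} (hψ : G.IsPairing ψ) {x : X}
    (hne : ht x ≠ ht (ψ x)) (hψx : ψ x ≠ x) :
    ∏ z ∈ low (ht ∘ Equiv.swap x (ψ x)) ψ, G.wgt k z = -∏ z ∈ low ht ψ, G.wgt k z := by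
  rw [prod_low_split hψ.1 hne, prod_low_split (ht := ht ∘ Equiv.swap x (ψ x)) hψ.1 (x := x)
    (by simpa using hne.symm), ← neg_mul]
  congr 1
  · rw [comp_apply, comp_apply, Equiv.swap_apply_left, Equiv.swap_apply_right, wgt_partner hψ hψx]
    rcases lt_or_gt_of_ne hne with h | h
    · rw [if_pos h, if_neg h.not_gt]
    · rw [if_pos h, if_neg h.not_gt, neg_neg]
  · refine Finset.prod_congr ?_ fun _ _ => rfl
    ext z
    rw [Finset.mem_filter, Finset.mem_filter, mem_low, mem_low]
    refine and_congr_left fun hz => ?_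
    rw [not_or] at hz
    rw [comp_apply, comp_apply, Equiv.swap_apply_of_ne_of_ne hz.1 hz.2,
      Equiv.swap_apply_of_ne_of_ne (fun h => hz.2 (by rw [← h, hψ.1])) fun h =>
        hz.1 (ψ.injective h)]

end Diagram

end ChangeHeights

end NecklaceMoyal

namespace NecklaceMoyal

open Function

/-! ### The inverse of symmetrization, on collections with heights -/

section QuantHeights

variable {V : Type u} [Quiver.{v} V]

open Diagram

theorem Collection.separates_toDiag {X W : Type} (P : Collection V X W) {ht : X ⊕ W → ℕ}
    (h : Injective fun a => ht (Sum.inl a)) : P.toDiag.Separates ht := by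
  rintro (a | a) (b | b) e ha hb hab
  · obtain rfl := h hab
    rw [ha] at hb
    exact edgeRev_ne e (Sum.inl.inj hb).symm
  · cases hb
  · cases ha
  · cases ha

namespace HColl

variable (a b : HColl V) (k : Type w) [Field k]

/-- The heights of the points of a collection with heights. -/
def ht : Fin a.n ⊕ Fin a.idem.toList.length → ℕ := Sum.elim Fin.val fun _ => 0

/-- The image of a collection with heights under the inverse of the symmetrization map. -/
noncomputable def quant : SymL V k := a.toCollection.toDiag.quant a.ht k fun _ => True

theorem separates_ht : a.toCollection.toDiag.Separates a.ht :=
  a.toCollection.separates_toDiag Fin.val_injective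

variable {a}

/-- Quantization sees the heights only through their order on the edges, and the idempotents only as
a multiset, so any labelled presentation may be used. -/
theorem quant_eq_of {X W : Type} [Finite X] [Fintype W] {P : Collection V X W} (α : Fin a.n ≃ X)
    (hnext : ∀ i, P.next (α i) = α (a.next i)) (hedge : ∀ i, P.edge (α i) = a.edge i)
    (hidem : a.idem = Finset.univ.val.map P.idem) {ht : X ⊕ W → ℕ}
    (hht : ∀ i i' : Fin a.n, i < i' ↔ ht (Sum.inl (α i)) < ht (Sum.inl (α i'))) :
    a.quant k = P.toDiag.quant ht k fun _ => True := by
  obtain ⟨β, hβ⟩ := exists_equiv_of_map_univ_eq (f := a.idem.toList.get) (g := P.idem) (by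
    rw [← hidem, Fin.univ_val_map, List.ofFn_get, Multiset.coe_toList])
  have h : Collection.Iso a.toCollection P α β := ⟨hnext, hedge, hβ⟩
  refine h.red.quant_eq P.isPath_toDiag inv_true (P.separates_toDiag fun x x' hx => ?_) ?_
  · obtain ⟨i, rfl⟩ := α.surjective x
    obtain ⟨i', rfl⟩ := α.surjective x'
    rcases lt_trichotomy i i' with h | h | h
    · exact absurd hx ((hht _ _).1 h).ne
    · rw [h]
    · exact absurd hx ((hht _ _).1 h).ne'
  · rintro (i | i) (i' | i') ⟨e, he⟩ ⟨e', he'⟩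
    · exact hht i i'
    · cases he'
    · cases he
    · cases he

variable {X W : Type} [Fintype X] [Fintype W] (P : Collection V X W)

theorem quant_withHeights {n : ℕ} (H : X ≃ Fin n) :
    (P.withHeights H).quant k
      = P.toDiag.quant (Sum.elim (fun x => (H x : ℕ)) fun _ => 0) k fun _ => True := by
  refine quant_eq_of k (a := P.withHeights H) H.symm (fun i => ?_) (fun i => rfl) rfl fun i i' => ?_
  · exact (H.symm_apply_apply _).symm
  · have key : ∀ i i' : Fin n, i < i' ↔ (H (H.symm i) : ℕ) < H (H.symm i') := fun i i' => by
      rw [H.apply_symm_apply, H.apply_symm_apply]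
      rfl
    exact key i i'

theorem quant_ordHeights [LinearOrder X] {ht : X ⊕ W → ℕ}
    (hht : ∀ x x' : X, x < x' ↔ ht (Sum.inl x) < ht (Sum.inl x')) :
    P.ordHeights.quant k = P.toDiag.quant ht k fun _ => True := by
  refine quant_eq_of k (a := P.ordHeights) (Fintype.orderIsoFinOfCardEq X rfl).toEquiv
    (fun i => ?_) (fun i => rfl) rfl fun i i' => ?_
  · exact ((Fintype.orderIsoFinOfCardEq X rfl).apply_symm_apply _).symm
  · rw [← hht]
    exact (Fintype.orderIsoFinOfCardEq X rfl).lt_iff_lt.symm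

theorem quant_part (ψ : a.toCollection.Pairing) (q : Collection.Comp ψ → Prop) :
    (Collection.part ψ q).ordHeights.quant k
      = (Collection.glueDiag ψ).quant a.ht k fun z => q (Collection.compOf ψ z) := by
  rw [← (Collection.red_part ψ q).quant_eq (Collection.isPath_glueDiag ψ)
    (Collection.inv_compOf ψ q) (a.separates_ht.glue _) (ht' := a.ht ∘ Collection.partMap ψ q)
    fun _ _ _ _ => Iff.rfl]
  exact quant_ordHeights k _ fun _ _ => Iff.rfl

/-- The product is the union of the two collections with the heights of `b` shifted above those of
`a`, which is the situation of `quant_or`. -/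
theorem quant_mul [CharZero k] : (a * b).quant k = moyalMul V k (a.quant k) (b.quant k) := by
  let U := a.toCollection.union b.toCollection
  let h : (Fin a.n ⊕ Fin b.n) ⊕ (Fin a.idem.toList.length ⊕ Fin b.idem.toList.length) → ℕ :=
    Sum.elim (fun s => (finSumFinEquiv s : ℕ)) fun _ => 0
  have hs : U.toDiag.Separates h :=
    U.separates_toDiag (Fin.val_injective.comp finSumFinEquiv.injective)
  have e1 : (a * b).quant k = U.toDiag.quant h k fun _ => True := by
    refine quant_eq_of k (a := a.mul b) finSumFinEquiv.symm (fun i => ?_) (fun i => rfl) ?_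
      fun i i' => ?_
    · exact (finSumFinEquiv.symm_apply_apply _).symm
    · show a.idem + b.idem = _
      have : ∀ s : Multiset V, (Finset.univ : Finset (Fin s.toList.length)).val.map s.toList.get = s :=
        fun s => by rw [Fin.univ_val_map, List.ofFn_get, Multiset.coe_toList]
      conv_lhs => rw [← this a.idem, ← this b.idem]
      show _ = Multiset.map (Sum.elim _ _) _
      rw [← Finset.univ_disjSum_univ, Finset.val_disjSum, Multiset.disjSum, Multiset.map_add,
        Multiset.map_map, Multiset.map_map]
      rfl
    · have key : ∀ i i' : Fin (a.n + b.n), i < i' ↔ (finSumFinEquiv (finSumFinEquiv.symm i) : ℕ)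
          < finSumFinEquiv (finSumFinEquiv.symm i') := fun i i' => by
        rw [Equiv.apply_symm_apply, Equiv.apply_symm_apply]
        rfl
      exact key i i'
  have e2 : a.quant k = U.toDiag.quant h k Collection.onLeft := by
    refine (Collection.red_inl a.toCollection b.toCollection).quant_eq U.isPath_toDiag
      (Collection.inv_onLeft _ _) hs ?_
    rintro (i | i) (i' | i') ⟨e, he⟩ ⟨e', he'⟩
    · show (i : ℕ) < i' ↔ (finSumFinEquiv (Sum.inl i) : ℕ) < finSumFinEquiv (Sum.inl i')
      simp
    · cases he'
    · cases he
    · cases he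
  have e3 : b.quant k = U.toDiag.quant h k Collection.onRight := by
    refine (Collection.red_inr a.toCollection b.toCollection).quant_eq U.isPath_toDiag
      (Collection.inv_onRight _ _) hs ?_
    rintro (i | i) (i' | i') ⟨e, he⟩ ⟨e', he'⟩
    · show (i : ℕ) < i' ↔ (finSumFinEquiv (Sum.inr i) : ℕ) < finSumFinEquiv (Sum.inr i')
      simp
    · cases he'
    · cases he
    · cases he
  rw [e1, e2, e3, ← quant_or U.isPath_toDiag (Collection.inv_onLeft _ _)
    (Collection.inv_onRight _ _) (fun _ => not_not.2) hs]
  · congr 1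
    ext z
    exact iff_of_true trivial (em _)
  · rintro ((i | i) | i) ((i' | i') | i') hx hy ⟨e, he⟩ ⟨e', he'⟩
    · exact absurd rfl hy
    · show (finSumFinEquiv (Sum.inl i) : ℕ) < finSumFinEquiv (Sum.inr i')
      simp
      omega
    · cases he'
    · cases hx
    · cases hx
    · cases hx
    · cases he
    · cases he
    · cases he

theorem quant_one : (1 : HColl V).quant k = 1 := by
  have : IsEmpty (Fin (1 : HColl V).n) := inferInstanceAs (IsEmpty (Fin 0))
  have : IsEmpty (Fin (1 : HColl V).idem.toList.length) := by
    have : (1 : HColl V).idem.toList.length = 0 := by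
      show (0 : Multiset V).toList.length = 0
      simp
    rw [this]
    infer_instance
  have hp : (1 : HColl V).toCollection.toDiag.pairings = {1} := by
    ext ψ
    rw [Subsingleton.elim ψ 1]
    simp [isPairing_one]
  rw [quant, Diagram.quant, psum, hp, Finset.sum_singleton, Finset.eq_empty_of_isEmpty (low _ _),
    Finset.prod_empty, one_smul, glue_one, val_eq_prod k (Collection.isPath_toDiag _) inv_true
      (ι := Empty) Empty.elim (fun i => i.elim) (fun i => i.elim) fun x => isEmptyElim x]
  simp

theorem quant_interchange (i j : Fin a.n) {h : Fin a.n ⊕ Fin a.idem.toList.length → ℕ}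
    (hh : ∀ x : Fin a.n, h (Sum.inl x) = (Equiv.swap i j x : ℕ)) :
    (a.interchange i j).quant k = a.toCollection.toDiag.quant h k fun _ => True := by
  refine quant_eq_of k (a := a.interchange i j) (Equiv.swap i j) (fun x => ?_) (fun x => rfl) ?_
    fun x x' => ?_
  · exact (Equiv.swap_apply_self i j _).symm
  · show a.idem = Finset.univ.val.map a.idem.toList.get
    rw [Fin.univ_val_map, List.ofFn_get, Multiset.coe_toList]
  · have key : ∀ x x' : Fin a.n, x < x' ↔
        h (Sum.inl (Equiv.swap i j x)) < h (Sum.inl (Equiv.swap i j x')) := fun x x' => by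
      rw [hh, hh, Equiv.swap_apply_self, Equiv.swap_apply_self]
      rfl
    exact key x x'

theorem adjacent_interchange {i j : Fin a.n} (hij : (j : ℕ) = i + 1) :
    a.toCollection.toDiag.Adjacent a.ht
      (Sum.elim (fun x => (Equiv.swap i j x : ℕ)) fun _ => 0) (Sum.inl i) (Sum.inl j) := by
  refine ⟨?_, ?_, ?_⟩
  · show (i : ℕ) < j
    omega
  · show (Equiv.swap i j j : ℕ) < Equiv.swap i j i
    rw [Equiv.swap_apply_left, Equiv.swap_apply_right]
    omega
  · rintro (x | x) (y | y) ⟨e, he⟩ ⟨e', he'⟩ h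
    · show (x : ℕ) < y ↔ (Equiv.swap i j x : ℕ) < Equiv.swap i j y
      have h : ¬ ((x = i ∧ y = j) ∨ (x = j ∧ y = i)) := by simpa using h
      rw [Equiv.swap_apply_def, Equiv.swap_apply_def]
      simp only [Fin.ext_iff] at h ⊢
      split_ifs <;> omega
    · cases he'
    · cases he
    · cases he

theorem quant_interchange_of_ne {i j : Fin a.n} (hij : (j : ℕ) = i + 1)
    (h : a.edge j ≠ edgeRev (a.edge i)) : a.quant k = (a.interchange i j).quant k := by
  rw [quant_interchange k i j
    (h := Sum.elim (fun x => (Equiv.swap i j x : ℕ)) fun _ => 0) fun _ => rfl]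
  refine (adjacent_interchange hij).quant_commute ?_
  rintro ⟨e, h1, h2⟩
  have h1 : a.edge i = e := Sum.inl.inj h1
  have h2 : a.edge j = edgeRev e := Sum.inl.inj h2
  exact h (by rw [h2, h1])

theorem quant_interchange_of_eq [CharZero k] {i j : Fin a.n} (hij : (j : ℕ) = i + 1)
    (h : a.edge j = edgeRev (a.edge i)) :
    a.quant k = (a.interchange i j).quant k + (edgeSign (a.edge i) • (Polynomial.X : k[X])) •
      (Collection.glue (a.swapPairing i j h)).ordHeights.quant k := by
  rw [quant_interchange k i j
    (h := Sum.elim (fun x => (Equiv.swap i j x : ℕ)) fun _ => 0) fun _ => rfl, quant_part, Collection.glueDiag, Collection.sumPerm,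
    show (a.swapPairing i j h).1 = Equiv.swap i j from rfl, Equiv.Perm.sumCongr_swap_one]
  refine (adjacent_interchange hij).quant_contract (e := a.edge i) rfl (congrArg Sum.inl h)
    a.separates_ht (a.toCollection.separates_toDiag ?_)
  exact Fin.val_injective.comp (Equiv.swap i j).injective

end HColl

namespace Collection

variable {X W : Type} [Fintype X] [Fintype W] (P : Collection V X W) (k : Type w) [Field k]

open Classical in
-- The identity pairing contributes `P` once for each of the `N!` height assignments. For any other
-- pairing choose a moved point `x`: exchanging the heights of `x` and its partner is an involution
-- of the assignments without fixed points that reverses the sign, so the terms cancel.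
theorem sum_quant_withHeights [CharZero k] :
    ∑ H : X ≃ Fin (Fintype.card X), (P.withHeights H).quant k
      = ((Fintype.card X).factorial : k[X]) • P.toSym k := by
  simp only [HColl.quant_withHeights, Diagram.quant, psum]
  rw [Finset.sum_comm, Finset.sum_eq_single 1]
  · have hlow : ∀ ht : X ⊕ W → ℕ, low ht (1 : Equiv.Perm (X ⊕ W)) = ∅ := fun ht => by
      ext x
      simp
    simp only [hlow, Finset.prod_empty, one_smul, glue_one]
    rw [Finset.sum_const, Finset.card_univ, Fintype.card_equiv (Fintype.equivFin X),
      ← Nat.cast_smul_eq_nsmul k[X], toSym_eq_val]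
  · intro ψ hψ hne
    obtain ⟨ψ, rfl⟩ := exists_sumPerm (mem_pairings.1 hψ)
    rw [← Finset.sum_smul]
    have hex : ∃ x, ψ.1 x ≠ x := by
      by_contra h
      push Not at h
      refine hne (Equiv.ext ?_)
      rintro (x | i)
      · exact congrArg Sum.inl (h x)
      · rfl
    obtain ⟨x, hx⟩ := hex
    have hx' : sumPerm W ψ.1 (Sum.inl x) ≠ Sum.inl x := fun h => hx (Sum.inl.inj h)
    rw [Finset.sum_involution (fun H _ => (Equiv.swap x (ψ.1 x)).trans H), zero_smul]
    · intro H _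
      have := prod_wgt_swap (k := k) (ht := Sum.elim (fun x => (H x : ℕ)) fun _ => 0)
        (mem_pairings.1 hψ) (x := Sum.inl x)
        (fun h => hx (H.injective (Fin.ext h)).symm) hx'
      have hc : (Sum.elim (fun x => (H x : ℕ)) fun _ => 0) ∘ Equiv.swap (Sum.inl x : X ⊕ W)
          (sumPerm W ψ.1 (Sum.inl x))
          = Sum.elim (fun z => (((Equiv.swap x (ψ.1 x)).trans H) z : ℕ)) fun _ => 0 := by
        rw [sumPerm_inl, ← Equiv.Perm.sumCongr_swap_one]
        ext (z | z) <;> rfl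
      rw [hc] at this
      simp only [selfW, and_self, if_true]
      rw [this, add_neg_cancel]
    · intro H _ _ h
      have := Equiv.congr_fun h x
      rw [Equiv.trans_apply, Equiv.swap_apply_left] at this
      exact hx (H.injective this)
    · exact fun _ _ => Finset.mem_univ _
    · intro H _
      ext z
      simp
  · exact fun h => absurd (mem_pairings.2 isPairing_one) h

end Collection

end QuantHeights

end NecklaceMoyal

namespace NecklaceMoyal

open Function

/-! ### Symmetrization is bijective -/

section Bijective

variable {V : Type u} [Quiver.{v} V] (k : Type w) [Field k]

/-! ### The algebra of quantized collections and the left inverse of symmetrization -/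

section Char

variable [CharZero k]

theorem C_inv_factorial_mul (n : ℕ) :
    Polynomial.C ((n.factorial : k)⁻¹) * (n.factorial : k[X]) = 1 := by
  rw [← map_natCast (Polynomial.C : k →+* k[X]), ← map_mul, inv_mul_cancel₀, map_one]
  exact Nat.cast_ne_zero.2 (Nat.factorial_ne_zero _)

open Classical in
theorem Collection.toSym_eq_sum_quant {X W : Type} [Fintype X] [Fintype W]
    (P : Collection V X W) : P.toSym k = Polynomial.C (((Fintype.card X).factorial : k)⁻¹) •
      ∑ H : X ≃ Fin (Fintype.card X), (P.withHeights H).quant k := by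
  rw [P.sum_quant_withHeights, smul_smul, C_inv_factorial_mul, one_smul]

/-- Every monomial is an average of quantized collections, so linear identities can be tested on the
latter. -/
theorem span_quant : Submodule.span k[X] (Set.range fun a : HColl V => a.quant k) = ⊤ := by
  classical
  rw [eq_top_iff, ← (MvPolynomial.basisMonomials (Necklace V) k[X]).span_eq, Submodule.span_le]
  rintro _ ⟨m, rfl⟩
  rw [MvPolynomial.coe_basisMonomials]
  dsimp only
  rw [← Collection.toSym_present k m, Collection.toSym_eq_sum_quant]
  exact Submodule.smul_mem _ _ (Submodule.sum_mem _ fun H _ => Submodule.subset_span ⟨_, rfl⟩)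

variable {k} in
theorem quant_induction {p : SymL V k → Prop} (h : ∀ a : HColl V, p (a.quant k))
    (hadd : ∀ f g, p f → p g → p (f + g)) (hsmul : ∀ (c : k[X]) f, p f → p (c • f)) (f) : p f := by
  have hf : f ∈ Submodule.span k[X] (Set.range fun a : HColl V => a.quant k) := by
    rw [span_quant]
    trivial
  induction hf using Submodule.span_induction with
  | mem _ h' =>
    obtain ⟨a, rfl⟩ := h'
    exact h a
  | zero => simpa using hsmul 0 _ (h 1)
  | add f g _ _ hf hg => exact hadd f g hf hg
  | smul c f _ hf => exact hsmul c f hf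

/-- On the spanning set of quantized collections the Moyal product is stacking, which is
associative. -/
theorem moyalMul_assoc (f g l : SymL V k) :
    moyalMul V k (moyalMul V k f g) l = moyalMul V k f (moyalMul V k g l) := by
  induction f using quant_induction with
  | h a =>
    induction g using quant_induction with
    | h b =>
      induction l using quant_induction with
      | h c => rw [← HColl.quant_mul, ← HColl.quant_mul, ← HColl.quant_mul, ← HColl.quant_mul, mul_assoc]
      | hadd l l' h h' => rw [map_add, map_add, map_add, h, h']
      | hsmul r l h => rw [map_smul, map_smul, map_smul, h]
    | hadd g g' h h' => simp only [map_add, LinearMap.add_apply, h, h']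
    | hsmul r g h => simp only [map_smul, LinearMap.smul_apply, h]
  | hadd f f' h h' => simp only [map_add, LinearMap.add_apply, h, h']
  | hsmul r f h => simp only [map_smul, LinearMap.smul_apply, h]

theorem moyalMul_one_left (f : SymL V k) : moyalMul V k 1 f = f := by
  induction f using quant_induction with
  | h a => rw [← HColl.quant_one, ← HColl.quant_mul, one_mul]
  | hadd f f' h h' => rw [map_add, h, h']
  | hsmul r f h => rw [map_smul, h]

theorem moyalMul_one_right (f : SymL V k) : moyalMul V k f 1 = f := by
  induction f using quant_induction with
  | h a => rw [← HColl.quant_one, ← HColl.quant_mul, mul_one]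
  | hadd f f' h h' => rw [map_add, LinearMap.add_apply, h, h']
  | hsmul r f h => rw [map_smul, LinearMap.smul_apply, h]

variable (V)

/-- Collections with heights act on `(Sym L)[h]` by Moyal products. -/
noncomputable def moyalHom : HColl V →* Module.End k[X] (SymL V k) where
  -- The target is an endomorphism algebra because `SymL` already carries its commutative product;
  -- evaluation at `1` recovers `a.quant k`.
  toFun a := moyalMul V k (a.quant k)
  map_one' := by
    refine LinearMap.ext fun f => ?_
    rw [HColl.quant_one, moyalMul_one_left]
    rfl
  map_mul' a b := by
    refine LinearMap.ext fun f => ?_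
    rw [HColl.quant_mul, moyalMul_assoc]
    rfl

/-- The action of `A_h(Q)` on `(Sym L)[h]`. -/
noncomputable def moyalAction : AlgH V k →ₐ[k[X]] Module.End k[X] (SymL V k) :=
  RingQuot.liftAlgHom k[X] ⟨MonoidAlgebra.lift k[X] _ _ (moyalHom V k), by
    intro x y h
    induction h with
    | commute a i j hij h =>
      rw [MonoidAlgebra.lift_of, MonoidAlgebra.lift_of]
      show moyalMul V k _ = moyalMul V k _
      rw [HColl.quant_interchange_of_ne k hij h]
    | contract a i j hij h =>
      rw [map_add, map_smul, MonoidAlgebra.lift_of, MonoidAlgebra.lift_of, MonoidAlgebra.lift_of]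
      show moyalMul V k _ = moyalMul V k _ + _ • moyalMul V k _
      rw [HColl.quant_interchange_of_eq k hij h, map_add, map_smul]⟩

/-- The inverse of the symmetrization map. -/
noncomputable def unsym : AlgH V k →ₗ[k[X]] SymL V k :=
  LinearMap.applyₗ (1 : SymL V k) ∘ₗ (moyalAction V k).toLinearMap

variable {V}

theorem moyalAction_toAlg (a : HColl V) : moyalAction V k (a.toAlg k) = moyalMul V k (a.quant k) := by
  rw [moyalAction, HColl.toAlg, RingQuot.liftAlgHom_mkAlgHom_apply, MonoidAlgebra.lift_of]
  rfl

theorem unsym_toAlg (a : HColl V) : unsym V k (a.toAlg k) = a.quant k := by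
  show moyalAction V k (a.toAlg k) 1 = _
  rw [moyalAction_toAlg, moyalMul_one_right]

theorem unsym_average {X W : Type} [Fintype X] [Fintype W] (P : Collection V X W) :
    unsym V k (P.average k) = P.toSym k := by
  classical
  rw [Collection.average, map_smul, map_sum, P.toSym_eq_sum_quant k]
  congr 1
  exact Finset.sum_congr rfl fun H _ => unsym_toAlg k _

theorem unsym_symmetrization (f : SymL V k) : unsym V k (symmetrization V k f) = f := by
  have : unsym V k ∘ₗ symmetrization V k = LinearMap.id := by
    refine (MvPolynomial.basisMonomials (Necklace V) k[X]).ext fun m => ?_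
    rw [LinearMap.comp_apply, symmetrization, Module.Basis.constr_basis, unsym_average, Collection.toSym_present,
      MvPolynomial.coe_basisMonomials]
    rfl
  exact LinearMap.congr_fun this f

end Char

/-! ### Surjectivity of symmetrization by induction on the number of edges -/

theorem span_toAlg : Submodule.span k[X] (Set.range fun a : HColl V => a.toAlg k) = ⊤ := by
  rw [eq_top_iff]
  rintro x -
  obtain ⟨y, rfl⟩ := RingQuot.mkAlgHom_surjective k[X] (Rel V k) x
  induction y using MonoidAlgebra.induction_on with
  | of a => exact Submodule.subset_span ⟨a, rfl⟩
  | add f g hf hg =>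
    rw [map_add]
    exact Submodule.add_mem _ hf hg
  | smul r f hf =>
    rw [map_smul]
    exact Submodule.smul_mem _ _ hf

variable {N : Type*} [AddCommGroup N] [Module k[X] N] (φ : AlgH V k →ₗ[k[X]] N)

/-- The correction term of the relation has fewer edges and is killed by `φ`. Arguing with a linear
map that kills shorter classes takes the place of passing to an associated graded module. -/
theorem map_toAlg_interchange (a : HColl V) (hφ : ∀ b : HColl V, b.n < a.n → φ (b.toAlg k) = 0)
    {i j : Fin a.n} (hij : (j : ℕ) = i + 1) :
    φ (a.toAlg k) = φ ((a.interchange i j).toAlg k) := by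
  by_cases h : a.edge j = edgeRev (a.edge i)
  · have := RingQuot.mkAlgHom_rel k[X] (Rel.contract (k := k) a i j hij h)
    rw [map_add, map_smul] at this
    have hlt : (Collection.glue (a.swapPairing i j h)).ordHeights.n < a.n := by
      show Fintype.card {x : Fin a.n // _} < a.n
      conv_rhs => rw [← Fintype.card_fin a.n]
      refine Fintype.card_subtype_lt (x := i) fun hk => ?_
      have : Equiv.swap i j i = i := hk.1
      rw [Equiv.swap_apply_left] at this
      rw [this] at hij
      omega
    have h0 := hφ _ hlt
    rw [HColl.toAlg] at h0
    rw [HColl.toAlg, HColl.toAlg, this, map_add, map_smul, h0, smul_zero, add_zero]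
  · rw [HColl.toAlg, HColl.toAlg, RingQuot.mkAlgHom_rel k[X] (Rel.commute (k := k) a i j hij h)]

theorem HColl.withHeights_one (a : HColl V) :
    a.toCollection.withHeights (1 : Equiv.Perm (Fin a.n)) = a := by
  refine HColl.ext_val rfl (fun _ => rfl) (fun _ => rfl) ?_
  show Finset.univ.val.map a.idem.toList.get = a.idem
  rw [Fin.univ_val_map, List.ofFn_get, Multiset.coe_toList]

/-- Adjacent transpositions generate the symmetric group, so `φ` does not see the heights at all. -/
theorem map_toAlg_withHeights {n : ℕ} {W : Type} [Fintype W] (P : Collection V (Fin n) W)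
    (hφ : ∀ b : HColl V, b.n < n → φ (b.toAlg k) = 0) (σ τ : Equiv.Perm (Fin n)) :
    φ ((P.withHeights τ).toAlg k) = φ ((P.withHeights (σ * τ)).toAlg k) := by
  cases n with
  | zero => rw [Subsingleton.elim (σ * τ) τ]
  | succ n =>
    have hσ : σ ∈ Submonoid.closure
        (Set.range fun i : Fin n => Equiv.swap i.castSucc i.succ) := by
      rw [Equiv.Perm.mclosure_swap_castSucc_succ]
      trivial
    induction hσ using Submonoid.closure_induction generalizing τ with
    | mem σ h =>
      obtain ⟨i, rfl⟩ := h
      exact map_toAlg_interchange k φ (P.withHeights τ) hφ (i := i.castSucc) (j := i.succ) (by simp)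
    | one => rw [one_mul]
    | mul σ σ' _ _ h h' => rw [h' τ, h (σ' * τ), mul_assoc]

variable [CharZero k]

theorem natCard_equiv_fin (X : Type*) [Fintype X] :
    Nat.card (X ≃ Fin (Fintype.card X)) = (Fintype.card X).factorial := by
  classical
  rw [Nat.card_eq_fintype_card, Fintype.card_equiv (Fintype.equivFin X)]

theorem smul_sum_equiv_const {X : Type*} [Fintype X] {h : Fintype (X ≃ Fin (Fintype.card X))}
    (x : N) : Polynomial.C (((Fintype.card X).factorial : k)⁻¹) •
      ∑ _H : X ≃ Fin (Fintype.card X), x = x := by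
  rw [Finset.sum_const, Finset.card_univ, ← @Nat.card_eq_fintype_card _ h, natCard_equiv_fin,
    ← Nat.cast_smul_eq_nsmul k[X], smul_smul, C_inv_factorial_mul, one_smul]

/-- By strong induction on the number of edges, `φ` takes the same value on all `P_H` with the same
`P`. That value is its value on their average `Φ_W(P)`, which is `0`. -/
theorem map_toAlg_eq_zero (hφ : ∀ f, φ (symmetrization V k f) = 0) (a : HColl V) :
    φ (a.toAlg k) = 0 := by
  have key : ∀ n, ∀ a : HColl V, a.n = n → φ (a.toAlg k) = 0 := by
    intro n
    induction n using Nat.strong_induction_on with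
    | h n ih =>
      rintro a rfl
      -- The number `N` is kept general because `Fintype.card (Fin a.n)`, which occurs in the
      -- average, only equals `a.n` through a proof.
      have h1 : ∀ N, N = a.n → ∀ H : Fin a.n ≃ Fin N,
          φ ((a.toCollection.withHeights H).toAlg k) = φ (a.toAlg k) := by
        rintro N rfl H
        have := map_toAlg_withHeights k φ a.toCollection (fun b hb => ih _ hb b rfl) H 1
        rw [mul_one, a.withHeights_one] at this
        exact this.symm
      have h2 := hφ (a.toCollection.toSym k)
      rw [a.toCollection.symmetrization_toSym, Collection.average, map_smul, map_sum,
        Finset.sum_congr rfl fun H _ => h1 _ (Fintype.card_fin _) H] at h2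
      exact (smul_sum_equiv_const k _).symm.trans h2
  exact key _ a rfl

theorem symmetrization_surjective : Surjective (symmetrization V k) := by
  let : AddCommGroup (AlgH V k) := Module.addCommMonoidToAddCommGroup k[X]
  rw [← LinearMap.range_eq_top]
  -- A linear map is surjective if any two maps that agree on its range agree; `map_toAlg_eq_zero`
  -- is applied to their difference.
  refine LinearMap.range_eq_top_of_cancel fun u v huv => ?_
  refine LinearMap.ext_on_range (span_toAlg k) fun a => sub_eq_zero.1 ?_
  exact map_toAlg_eq_zero k (u - v) (fun f => sub_eq_zero.2 (LinearMap.congr_fun huv f)) a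

theorem symmetrization_unsym (x : AlgH V k) : symmetrization V k (unsym V k x) = x := by
  obtain ⟨f, rfl⟩ := symmetrization_surjective k x
  rw [unsym_symmetrization]

theorem symmetrization_bijective : Bijective (symmetrization V k) :=
  ⟨HasLeftInverse.injective ⟨_, unsym_symmetrization k⟩, symmetrization_surjective k⟩

theorem symmetrization_quant (a : HColl V) : symmetrization V k (a.quant k) = a.toAlg k := by
  rw [← unsym_toAlg, symmetrization_unsym]

omit [CharZero k] in
theorem toAlg_mul (a b : HColl V) : (a * b).toAlg k = a.toAlg k * b.toAlg k := by
  rw [HColl.toAlg, map_mul, map_mul]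
  rfl

omit [CharZero k] in
theorem toAlg_one : (1 : HColl V).toAlg k = 1 := by
  rw [HColl.toAlg, map_one, map_one]

theorem symmetrization_one : symmetrization V k 1 = 1 := by
  rw [← HColl.quant_one, symmetrization_quant, toAlg_one]

theorem symmetrization_mul (f g : SymL V k) :
    symmetrization V k (moyalMul V k f g) = symmetrization V k f * symmetrization V k g := by
  induction f using quant_induction with
  | h a =>
    induction g using quant_induction with
    | h b => rw [← HColl.quant_mul, symmetrization_quant, symmetrization_quant,
        symmetrization_quant, toAlg_mul]
    | hadd g g' h h' => rw [map_add, map_add, map_add, h, h', mul_add]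
    | hsmul r g h => rw [map_smul, map_smul, map_smul, h, mul_smul_comm]
  | hadd f f' h h' => rw [map_add, LinearMap.add_apply, map_add, map_add, h, h', add_mul]
  | hsmul r f h => rw [map_smul, LinearMap.smul_apply, map_smul, map_smul, h, smul_mul_assoc]

end Bijective

end NecklaceMoyal

namespace NecklaceMoyal

open Function

/-! ### Compatibility of the coproducts -/

section Coproduct

variable {V : Type u} [Quiver.{v} V]

namespace Diagram

variable {X : Type} [Finite X] {G : Diagram V X} {ht : X → ℕ} {p p' : X → Prop}

section Bilinear

variable {R M N L : Type*} [CommRing R] [AddCommGroup M] [Module R M] [AddCommGroup N] [Module R N]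
  [AddCommGroup L] [Module R L]

/-- A pairing inside `p` and a pairing inside `p'` combine to one pairing with added weights. The
hypotheses `hF` and `hF'` say that each summand ignores the pairs of the other part. -/
theorem psum_bilin (B : M →ₗ[R] N →ₗ[R] L) (hs : G.Separates ht) {a b : X → X → R}
    (ha : ∀ x y, a x y ≠ 0 → p x ∧ p y) (hb : ∀ x y, b x y ≠ 0 → p' x ∧ p' y)
    (hd : ∀ x, p x → ¬ p' x) {F : Equiv.Perm X → M} {F' : Equiv.Perm X → N}
    (hF : ∀ ψ₁ ψ₂, G.IsPairing ψ₁ → G.IsPairing ψ₂ → ψ₁.Disjoint ψ₂ → (∀ x, ψ₁ x ≠ x → p x) →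
      (∀ x, ψ₂ x ≠ x → p' x) → F (ψ₁ * ψ₂) = F ψ₁)
    (hF' : ∀ ψ₁ ψ₂, G.IsPairing ψ₁ → G.IsPairing ψ₂ → ψ₁.Disjoint ψ₂ → (∀ x, ψ₁ x ≠ x → p' x) →
      (∀ x, ψ₂ x ≠ x → p x) → F' (ψ₁ * ψ₂) = F' ψ₁) :
    B (psum G ht a F) (psum G ht b F')
      = psum G ht (fun x y => a x y + b x y) fun ψ => B (F ψ) (F' ψ) := by
  have e1 : B (psum G ht a F) (psum G ht b F')
      = psum G ht a fun ψ₁ => psum G ht b fun ψ₂ => B (F ψ₁) (F' ψ₂) := by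
    rw [← LinearMap.flip_apply, map_psum]
    congr 1
    ext1 ψ₁
    rw [LinearMap.flip_apply, map_psum]
  rw [e1, psum_psum hs ha fun x y h =>
    ⟨fun hx => hd x hx (hb x y h).1, fun hy => hd y hy (hb x y h).2⟩, ← psum_glue hs]
  refine psum_congr (fun _ _ => rfl) fun ψ₁ h₁ hne₁ => ?_
  refine psum_congr (fun _ _ => rfl) fun ψ₂ h₂ hne₂ => ?_
  have hs₁ : ∀ x, ψ₁ x ≠ x → p x := fun x => supp_of_weight hs ha h₁ hne₁
  have hs₂ : ∀ x, ψ₂ x ≠ x → p' x := fun x => supp_of_weight (hs.glue ψ₁) hb h₂ hne₂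
  obtain ⟨h₂, hdis⟩ := isPairing_glue.1 h₂
  rw [hF ψ₁ ψ₂ h₁ h₂ hdis hs₁ hs₂, hdis.commute.eq, hF' ψ₂ ψ₁ h₂ h₁ hdis.symm hs₂ hs₁]

theorem psum_of_weight_eq_zero (hs : G.Separates ht) {a : X → X → R} (ha : ∀ x y, a x y = 0)
    (F : Equiv.Perm X → M) : psum G ht a F = F 1 := by
  have hlow : low ht (1 : Equiv.Perm X) = ∅ := by
    ext x
    simp
  rw [psum, Finset.sum_eq_single 1, hlow, Finset.prod_empty, one_smul]
  · intro ψ hψ hne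
    have hψ := mem_pairings.1 hψ
    have : ∃ x, ψ x ≠ x := by
      by_contra h
      push Not at h
      exact hne (Equiv.ext h)
    obtain ⟨x, hx⟩ := this
    rcases hs.lt_or_lt hψ hx with h | h
    · rw [Finset.prod_eq_zero (f := fun x => a x (ψ x)) (mem_low.2 h) (ha _ _), zero_smul]
    · rw [Finset.prod_eq_zero (f := fun x => a x (ψ x)) (mem_low.2 h) (ha _ _), zero_smul]
  · exact fun h => absurd (mem_pairings.2 isPairing_one) h

end Bilinear

variable {k : Type w} [Field k]

theorem val_glue_mul (hG : G.IsPath) {ψ₁ ψ₂ : Equiv.Perm X} (h₁ : G.IsPairing ψ₁)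
    (h₂ : G.IsPairing ψ₂) (hdis : ψ₁.Disjoint ψ₂) (hi : (G.glue ψ₁).Inv p)
    (hn : ∀ x, ψ₂ x ≠ x → ¬ p x) : (G.glue (ψ₁ * ψ₂)).val k p = (G.glue ψ₁).val k p := by
  rw [← glue_glue hdis]
  exact val_glue_mul_left hG h₁ (isPairing_glue.2 ⟨h₂, hdis⟩) hi hn

/-- The colouring is constant along the cycles obtained by cutting and gluing. -/
def Flow {n : ℕ} (G : Diagram V X) (c : X → Fin n) (ψ : Equiv.Perm X) : Prop :=
  ∀ x, c (G.next (ψ x)) = c x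

omit [Finite X] in
theorem Flow.inv {n : ℕ} {c : X → Fin n} {ψ : Equiv.Perm X} (h : G.Flow c ψ) (a : Fin n) :
    (G.glue ψ).Inv fun x => c x = a := by
  intro x
  show c (G.next (ψ x)) = a ↔ c x = a
  rw [h x]

omit [Finite X] in
theorem flow_mul_iff {n : ℕ} {c : X → Fin n} {ψ₁ ψ₂ : Equiv.Perm X} (h₂ : ∀ x, c (ψ₂ x) = c x) :
    G.Flow c (ψ₁ * ψ₂) ↔ G.Flow c ψ₁ := by
  constructor
  · intro h x
    have := h (ψ₂.symm x)
    rw [Equiv.Perm.mul_apply, Equiv.apply_symm_apply] at this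
    rw [this, ← h₂, Equiv.apply_symm_apply]
  · intro h x
    rw [Equiv.Perm.mul_apply, h, h₂]

open Classical in
/-- The weight of a pair in the coproduct of a collection with heights. -/
noncomputable def stepW (G : Diagram V X) (k : Type w) [Field k] (c : X → Fin 2) (x y : X) : k[X] :=
  if c x = 0 ∧ c y = 1 then 2 * G.wgt k x else 0

open Classical in
-- The two colour classes are disjoint unions of cycles, so their quantizations involve independent
-- pairings. Together these are the pairings whose pairs are monochromatic.
theorem quant_tmul_quant (hG : G.IsPath) (hs : G.Separates ht) {c : X → Fin 2} (hc : G.Flow c 1) :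
    G.quant ht k (fun x => c x = 0) ⊗ₜ[k[X]] G.quant ht k (fun x => c x = 1)
      = psum G ht (fun x y => if c x = c y then G.wgt k x else 0) fun ψ =>
        (G.glue ψ).val k (fun x => c x = 0) ⊗ₜ[k[X]] (G.glue ψ).val k (fun x => c x = 1) := by
  have hi : ∀ a, G.Inv fun x => c x = a := fun a => by
    have := hc.inv a
    rwa [glue_one] at this
  have := psum_bilin (L := SymL V k ⊗[k[X]] SymL V k) (TensorProduct.mk k[X] (SymL V k) (SymL V k)) hs
    (selfW_supp (G := G) (k := k) fun x => c x = 0) (selfW_supp (G := G) (k := k) fun x => c x = 1)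
    (fun x h h' => by rw [h] at h'; exact absurd h' (by decide))
    (F := fun ψ => (G.glue ψ).val k fun x => c x = 0)
    (F' := fun ψ => (G.glue ψ).val k fun x => c x = 1)
    (fun ψ₁ ψ₂ h₁ h₂ hdis hs₁ hs₂ => val_glue_mul hG h₁ h₂ hdis (inv_glue_of_supp (hi 0) h₁ hs₁)
      fun x hx h' => by have := hs₂ x hx; rw [h'] at this; exact absurd this (by decide))
    (fun ψ₁ ψ₂ h₁ h₂ hdis hs₁ hs₂ => val_glue_mul hG h₁ h₂ hdis (inv_glue_of_supp (hi 1) h₁ hs₁)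
      fun x hx h' => by have := hs₂ x hx; rw [h'] at this; exact absurd this (by decide))
  refine this.trans (psum_congr (fun ψ _ => Finset.prod_congr rfl fun x _ => ?_) fun _ _ _ => rfl)
  rw [selfW, selfW]
  generalize c x = s
  generalize c (ψ x) = t
  fin_cases s <;> fin_cases t <;> simp

theorem sum_flowCols_psum {M : Type*} [AddCommGroup M] [Module k[X] M] {n : ℕ} [NeZero n]
    (a : (X → Fin n) → X → X → k[X]) (F : (X → Fin n) → Equiv.Perm X → M) :
    ∑ ψ ∈ G.pairings, ∑ c ∈ (G.glue ψ).flowCols n (fun _ => True),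
        (∏ x ∈ low ht ψ, a c x (ψ x)) • F c ψ
      = ∑ c ∈ cols n fun _ : X => True, psum G ht (a c) fun ψ =>
        open Classical in if G.Flow c ψ then F c ψ else 0 := by
  classical
  simp only [psum]
  rw [Finset.sum_comm]
  refine Finset.sum_congr rfl fun ψ _ => ?_
  simp only [smul_ite, smul_zero]
  rw [← Finset.sum_filter]
  refine Finset.sum_congr ?_ fun _ _ => rfl
  ext c
  rw [Finset.mem_filter, mem_flowCols, mem_cols]
  exact and_comm

open Classical in
theorem comulForm_eq_sum_flow (hs : G.Separates ht) : G.comulForm k (fun _ => True)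
    = ∑ c ∈ cols 2 fun _ : X => True, psum G ht (G.colW k (fun _ => True) c) fun ψ =>
      if G.Flow c ψ then (G.glue ψ).val k (fun x => c x = 0) ⊗ₜ[k[X]]
        (G.glue ψ).val k (fun x => c x = 1) else 0 := by
  rw [comulForm_eq hs]
  simp only [true_and]
  rfl

open Classical in
-- Pairs of equal colour do not affect the condition that the colouring is constant on the glued
-- cycles, so this condition may be moved from `ψ₁` to `ψ₁ * ψ₂`.
theorem psum_glue_flow (hs : G.Separates ht) {n : ℕ} (c : X → Fin n) {a b b' : X → X → k[X]}
    (hb : ∀ ψ₁ ψ₂, (G.glue ψ₁).IsPairing ψ₂ → ∏ x ∈ low ht ψ₂, b x (ψ₂ x)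
      = ∏ x ∈ low ht ψ₂, b' x (ψ₂ x)) (hb' : ∀ x y, b x y ≠ 0 → c y = c x)
    {M : Type*} [AddCommGroup M] [Module k[X] M] (F : Equiv.Perm X → M) :
    psum G ht a (fun ψ₁ => if G.Flow c ψ₁ then psum (G.glue ψ₁) ht b fun ψ₂ => F (ψ₁ * ψ₂) else 0)
      = psum G ht (fun x y => a x y + b' x y) fun ψ => if G.Flow c ψ then F ψ else 0 := by
  rw [← psum_glue hs]
  refine psum_congr (fun _ _ => rfl) fun ψ₁ h₁ _ => ?_
  have key : ∀ ψ₂, (G.glue ψ₁).IsPairing ψ₂ → (∀ x ∈ low ht ψ₂, b x (ψ₂ x) ≠ 0) →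
      (G.Flow c (ψ₁ * ψ₂) ↔ G.Flow c ψ₁) := by
    intro ψ₂ h₂ hne
    refine flow_mul_iff fun x => ?_
    by_cases hx : ψ₂ x = x
    · rw [hx]
    · rcases (hs.glue ψ₁).lt_or_lt h₂ hx with h | h
      · exact hb' _ _ (hne x (mem_low.2 h))
      · have := hb' _ _ (hne _ (mem_low.2 h))
        rw [h₂.1] at this
        exact this.symm
  have e : psum (G.glue ψ₁) ht b (fun ψ₂ => if G.Flow c ψ₁ then F (ψ₁ * ψ₂) else 0)
      = psum (G.glue ψ₁) ht b' fun ψ₂ => if G.Flow c (ψ₁ * ψ₂) then F (ψ₁ * ψ₂) else 0 :=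
    psum_congr (fun ψ₂ h₂ => hb ψ₁ ψ₂ h₂) fun ψ₂ h₂ hne => if_congr (key ψ₂ h₂ hne).symm rfl rfl
  rw [← e]
  split_ifs with h
  · rfl
  · simp [psum]

theorem psum_sum {ι M : Type*} [AddCommGroup M] [Module k[X] M] (a : X → X → k[X]) (s : Finset ι)
    (F : ι → Equiv.Perm X → M) :
    psum G ht a (fun ψ => ∑ i ∈ s, F i ψ) = ∑ i ∈ s, psum G ht a (F i) := by
  simp only [psum, Finset.smul_sum]
  exact Finset.sum_comm

open Classical in
-- The coproduct pairs up further points after each gluing; by `psum_glue` its weight `colW` is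
-- simply added to `a`, one colouring at a time.
theorem moyalComul_psum [CharZero k] (hG : G.IsPath) (hs : G.Separates ht) (a : X → X → k[X]) :
    moyalComul V k (psum G ht a fun ψ => (G.glue ψ).val k fun _ => True)
      = ∑ c ∈ cols 2 fun _ : X => True,
        psum G ht (fun x y => a x y + G.colW k (fun _ => True) c x y) fun ψ =>
          if G.Flow c ψ then (G.glue ψ).val k (fun x => c x = 0) ⊗ₜ[k[X]]
            (G.glue ψ).val k (fun x => c x = 1) else 0 := by
  rw [map_psum (N := SymL V k ⊗[k[X]] SymL V k) (moyalComul V k)]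
  have e : ∀ ψ₁, G.IsPairing ψ₁ → moyalComul V k ((G.glue ψ₁).val k fun _ => True)
      = ∑ c ∈ cols 2 fun _ : X => True, psum (G.glue ψ₁) ht
        ((G.glue ψ₁).colW k (fun _ => True) c) fun ψ₂ =>
        if G.Flow c (ψ₁ * ψ₂) then (G.glue (ψ₁ * ψ₂)).val k (fun x => c x = 0) ⊗ₜ[k[X]]
          (G.glue (ψ₁ * ψ₂)).val k (fun x => c x = 1) else 0 := by
    intro ψ₁ h₁
    rw [moyalComul_val (hG.glue h₁) inv_true, comulForm_eq_sum_flow (hs.glue ψ₁)]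
    refine Finset.sum_congr rfl fun c _ => psum_congr (fun _ _ => rfl) fun ψ₂ h₂ _ => ?_
    rw [glue_glue (isPairing_glue.1 h₂).2]
    rfl
  rw [psum_congr (fun _ _ => rfl) fun ψ₁ h₁ _ => e ψ₁ h₁, psum_sum]
  refine Finset.sum_congr rfl fun c _ => ?_
  rw [← psum_glue hs]
  refine psum_congr (fun _ _ => rfl) fun ψ₁ h₁ _ => psum_congr (fun ψ₂ h₂ => ?_) fun _ _ _ => rfl
  refine Finset.prod_congr rfl fun x hx => ?_
  exact colW_glue (((isPairing_glue.1 h₂).2 x).resolve_right (ne_of_mem_low hx))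

/-- The comparison of the coproduct of a diagram with heights with the Moyal coproduct. -/
theorem sum_quant_tmul_quant [CharZero k] (hG : G.IsPath) (hs : G.Separates ht) :
    ∑ ψ ∈ G.pairings, ∑ c ∈ (G.glue ψ).flowCols 2 (fun _ => True),
      (∏ x ∈ low ht ψ, G.stepW k c x (ψ x)) •
        ((G.glue ψ).quant ht k (fun x => c x = 0) ⊗ₜ[k[X]]
          (G.glue ψ).quant ht k (fun x => c x = 1))
      = moyalComul V k (G.quant ht k fun _ => True) := by
  classical
  rw [sum_flowCols_psum (fun c => G.stepW k c) fun c ψ => (G.glue ψ).quant ht k (fun x => c x = 0)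
    ⊗ₜ[k[X]] (G.glue ψ).quant ht k (fun x => c x = 1), quant, moyalComul_psum hG hs]
  refine Finset.sum_congr rfl fun c _ => ?_
  have e2 : psum G ht (G.stepW k c) (fun ψ => if G.Flow c ψ then
        (G.glue ψ).quant ht k (fun x => c x = 0) ⊗ₜ[k[X]]
          (G.glue ψ).quant ht k (fun x => c x = 1) else 0)
      = psum G ht (G.stepW k c) fun ψ₁ => if G.Flow c ψ₁ then
        psum (G.glue ψ₁) ht (fun x y => if c x = c y then (G.glue ψ₁).wgt k x else 0) fun ψ₂ =>
          (G.glue (ψ₁ * ψ₂)).val k (fun x => c x = 0) ⊗ₜ[k[X]]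
            (G.glue (ψ₁ * ψ₂)).val k (fun x => c x = 1) else 0 := by
    refine psum_congr (fun _ _ => rfl) fun ψ₁ h₁ _ => ?_
    split_ifs with h
    · rw [quant_tmul_quant (hG.glue h₁) (hs.glue ψ₁) fun x => h x]
      refine psum_congr (fun _ _ => rfl) fun ψ₂ h₂ _ => ?_
      rw [glue_glue (isPairing_glue.1 h₂).2]
    · rfl
  have e3 : ∀ ψ₁, G.IsPairing ψ₁ → ∀ M : Equiv.Perm X → SymL V k ⊗[k[X]] SymL V k,
      psum (G.glue ψ₁) ht (fun x y => if c x = c y then (G.glue ψ₁).wgt k x else 0) M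
        = psum (G.glue ψ₁) ht (fun x y => if c x = c y then G.wgt k x else 0) M := by
    intro ψ₁ h₁ M
    refine psum_congr (fun ψ₂ h₂ => Finset.prod_congr rfl fun x hx => ?_) fun _ _ _ => rfl
    rw [wgt_glue (((isPairing_glue.1 h₂).2 x).resolve_right (ne_of_mem_low hx))]
  rw [e2, psum_congr (fun _ _ => rfl) fun ψ₁ h₁ _ => if_congr Iff.rfl (e3 ψ₁ h₁ _) rfl,
    psum_glue_flow hs c (b' := fun x y => if c x = c y then G.wgt k x else 0) (fun _ _ _ => rfl)
      (fun x y h => by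
        by_contra hn
        exact h (if_neg fun h' => hn h'.symm))
      fun ψ => (G.glue ψ).val k (fun x => c x = 0) ⊗ₜ[k[X]] (G.glue ψ).val k (fun x => c x = 1)]
  refine psum_congr (fun ψ _ => Finset.prod_congr rfl fun x _ => ?_) fun _ _ _ => rfl
  have e4 : G.selfW k (fun _ => True) x (ψ x) = G.wgt k x := if_pos ⟨trivial, trivial⟩
  have e5 : G.colW k (fun _ => True) c x (ψ x) = G.wgt k x * (colSign (c x) (c (ψ x)) : k[X]) :=
    if_pos ⟨trivial, trivial⟩
  rw [stepW, e4, e5]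
  generalize c x = s
  generalize c (ψ x) = t
  -- The comparison of weights: for colours `(0, 1)`, equal colours and `(1, 0)` both sides are `2`,
  -- `1` and `0` times `wgt x`.
  fin_cases s <;> fin_cases t <;> simp [colSign, two_mul]

end Diagram

end Coproduct

end NecklaceMoyal

namespace NecklaceMoyal

open Function

/-! ### The coproduct and the counit of `A_h(Q)` -/

section HeightCoproduct

variable {V : Type u} [Quiver.{v} V] (k : Type w) [Field k]

open Diagram Collection

theorem int_smul_tensor_algH (n : ℤ) (t : AlgH V k ⊗[k[X]] AlgH V k) :
    n • t = (n : k[X]) • t := by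
  induction t with
  | zero => rw [smul_zero, smul_zero]
  | add s t hs ht => rw [smul_add, smul_add, hs, ht]
  | tmul s t =>
    rw [TensorProduct.smul_tmul', TensorProduct.smul_tmul']
    exact congrArg (· ⊗ₜ[k[X]] t) (Int.cast_smul_eq_zsmul k[X] n s).symm

namespace HColl

variable {k} {a : HColl V}

open Classical in
theorem prod_low_ht {R : Type*} [CommRing R] (ψ : a.toCollection.Pairing)
    (f : Fin a.n ⊕ Fin a.idem.toList.length → R) :
    ∏ z ∈ low a.ht (sumPerm _ ψ.1), f z = ∏ i : Fin a.n with i < ψ.1 i, f (Sum.inl i) := by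
  symm
  refine Finset.prod_bij (fun i _ => Sum.inl i) ?_ (fun _ _ _ _ h => Sum.inl.inj h) ?_
    fun _ _ => rfl
  · exact fun i hi => mem_low.2 (Finset.mem_filter.1 hi).2
  · rintro (i | i) hz
    · have h := mem_low.1 hz
      exact ⟨i, Finset.mem_filter.2 ⟨Finset.mem_univ _, h⟩, rfl⟩
    · have h := mem_low.1 hz
      exact absurd h (lt_irrefl _)

open Classical in
theorem card_moved_lt (ψ : a.toCollection.Pairing) :
    (Finset.univ.filter fun i : Fin a.n => ψ.1 i ≠ i).card / 2
      = (Finset.univ.filter fun i : Fin a.n => i < ψ.1 i).card := by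
  have hS : Splits (fun i : Fin a.n => i < ψ.1 i) ψ := by
    intro i hi
    show ψ.1 i < ψ.1 (ψ.1 i) ↔ ¬ i < ψ.1 i
    rw [ψ.2.1, not_lt]
    exact (lt_iff_le_and_ne.trans (and_iff_left hi))
  have h := card_moved _ ψ hS
  have e : (Finset.univ.filter fun i : Fin a.n => ψ.1 i ≠ i ∧ i < ψ.1 i)
      = Finset.univ.filter fun i : Fin a.n => i < ψ.1 i :=
    Finset.filter_congr fun i _ => and_iff_right_of_imp fun h => h.ne'
  rw [← e]
  convert h

variable (k) in
theorem two_mul_wgt [CharZero k] (i : Fin a.n) :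
    2 * a.toCollection.toDiag.wgt k (Sum.inl i) = (Polynomial.X : k[X]) * (edgeSign (a.edge i) : k[X]) := by
  rw [lsign_wgt (e := a.edge i) rfl, halfH, ← map_ofNat (Polynomial.C : k →+* k[X]) 2,
    mul_left_comm, ← mul_assoc (Polynomial.C _) (Polynomial.C _), ← map_mul,
    mul_inv_cancel₀ two_ne_zero, map_one, one_mul, mul_comm]

variable (k) in
-- Each pair of the coproduct of `A_h(Q)` carries `h` with a sign, that is `2 * wgt`, and must step
-- from colour `0` to colour `1`; the remaining parts are then quantized. This is the left side of
-- `sum_quant_tmul_quant`. Only the formula for `a.comul` is used, not that it descends to the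
-- quotient.
theorem map_unsym_comul [CharZero k] (a : HColl V) :
    TensorProduct.map (unsym V k) (unsym V k) (a.comul k) = moyalComul V k (a.quant k) := by
  classical
  rw [quant, ← sum_quant_tmul_quant a.toCollection.isPath_toDiag a.separates_ht, comul, map_sum]
  refine sum_pairing fun ψ => ?_
  rw [map_smul, map_sum, Finset.smul_sum, Finset.sum_filter]
  refine sum_comp ψ fun c => ?_
  rw [prod_low_ht ψ fun z => a.toCollection.toDiag.stepW k (c ∘ compOf ψ) z (sumPerm _ ψ.1 z)]
  have hc : ∀ i, a.toCollection.toDiag.stepW k (c ∘ compOf ψ) (Sum.inl i) (sumPerm _ ψ.1 (Sum.inl i))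
      = if c (Sum.inl (orb ψ i)) = 0 ∧ c (Sum.inl (orb ψ (a.next i))) = 1 then
        (Polynomial.X : k[X]) * (edgeSign (a.edge i) : k[X]) else 0 := by
    intro i
    rw [← two_mul_wgt, show a.next i = a.toCollection.next i from rfl, orb_next]
    rfl
  split_ifs with h
  · rw [int_smul_tensor_algH, map_smul, smul_smul, TensorProduct.map_tmul, unsym_toAlg, unsym_toAlg,
      quant_part, quant_part]
    congr 1
    rw [card_moved_lt, Finset.prod_congr rfl fun i hi => (hc i).trans
      (if_pos (h i (Finset.mem_filter.1 hi).2)), Finset.prod_mul_distrib, Finset.prod_const,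
      Int.cast_prod]
  · push Not at h
    obtain ⟨i, hi, hi'⟩ := h
    rw [Finset.prod_eq_zero (i := i) (Finset.mem_filter.2 ⟨Finset.mem_univ _, hi⟩)
      ((hc i).trans (if_neg fun h => hi' h.1 h.2)), zero_smul]

end HColl

variable {k}

/-- The value is a product over the cycles in `p`, of which there is at least one, and the counit
kills each generator. -/
theorem Diagram.symCounit_val {X : Type} [Finite X] {G : Diagram V X} (hG : G.IsPath)
    {p : X → Prop} (hp : G.Inv p) {x : X} (hx : p x) : symCounit V k (G.val k p) = 0 := by
  classical
  let r : {o : Quotient (Equiv.Perm.SameCycle.setoid G.next) // p o.out} → X := fun o => o.1.out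
  have := Fintype.ofFinite {o : Quotient (Equiv.Perm.SameCycle.setoid G.next) // p o.out}
  rw [G.val_eq_prod k hG hp r (fun o => o.2) (fun o o' h => Subtype.ext ?_) fun x hx =>
    ⟨⟨Quotient.mk _ x, (hp.sameCycle (sameCycle_out G.next x)).2 hx⟩, (sameCycle_out G.next x).symm⟩]
  · show MvPolynomial.aeval (fun _ => (0 : k[X])) _ = 0
    rw [map_prod]
    refine Finset.prod_eq_zero (Finset.mem_univ
      ⟨Quotient.mk _ x, (hp.sameCycle (sameCycle_out G.next x)).2 hx⟩) ?_
    exact MvPolynomial.aeval_X _ _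
  · rw [← Quotient.out_eq o.1, ← Quotient.out_eq o'.1]
    exact Quotient.sound h

theorem HColl.eq_one {a : HColl V} (hn : a.n = 0) (hv : a.idem = 0) : a = 1 := by
  refine HColl.ext_val hn (fun i => ?_) (fun i => ?_) hv
  · exact absurd i.2 (by omega)
  · exact absurd i.2 (by omega)

variable (k) in
theorem symCounit_quant [CharZero k] (a : HColl V) :
    symCounit V k (a.quant k) = a.counit k := by
  classical
  rw [HColl.counit]
  split_ifs with h
  · rw [HColl.eq_one h.1 h.2, HColl.quant_one]
    show MvPolynomial.aeval (fun _ => (0 : k[X])) 1 = 1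
    exact map_one _
  · have hx : Nonempty (Fin a.n ⊕ Fin a.idem.toList.length) := by
      by_contra hne
      rw [not_nonempty_iff, isEmpty_sum] at hne
      refine h ⟨?_, ?_⟩
      · by_contra h0
        exact hne.1.elim ⟨0, Nat.pos_of_ne_zero h0⟩
      · by_contra h0
        have : a.idem.toList.length ≠ 0 := by simpa using h0
        exact hne.2.elim ⟨0, Nat.pos_of_ne_zero this⟩
    obtain ⟨x⟩ := hx
    rw [HColl.quant, Diagram.quant, map_psum, psum]
    refine Finset.sum_eq_zero fun ψ hψ => ?_
    rw [Diagram.symCounit_val (a.toCollection.isPath_toDiag.glue (mem_pairings.1 hψ)) inv_true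
      (x := x) trivial, smul_zero]

variable (V k)

/-- The coproduct of `A_h(Q)`. -/
noncomputable def algComul [CharZero k] : AlgH V k →ₗ[k[X]] AlgH V k ⊗[k[X]] AlgH V k :=
  -- Defining the coproduct by transport from `(Sym L)[h]` avoids checking the relations; its values
  -- on the classes `P_H` are verified in `isAlgHCoproduct_algComul`.
  TensorProduct.map (symmetrization V k) (symmetrization V k) ∘ₗ moyalComul V k ∘ₗ unsym V k

/-- The counit of `A_h(Q)`. -/
noncomputable def algCounit [CharZero k] : AlgH V k →ₗ[k[X]] k[X] := symCounit V k ∘ₗ unsym V k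

theorem isAlgHCoproduct_algComul [CharZero k] :
    IsAlgHCoproduct k (algComul V k) (algCounit V k) := by
  have hid : symmetrization V k ∘ₗ unsym V k = LinearMap.id :=
    LinearMap.ext (symmetrization_unsym k)
  refine fun a => ⟨?_, ?_⟩
  · rw [algComul, LinearMap.comp_apply, LinearMap.comp_apply, unsym_toAlg,
      ← HColl.map_unsym_comul, ← LinearMap.comp_apply, ← TensorProduct.map_comp, hid,
      TensorProduct.map_id, LinearMap.id_apply]
  · rw [algCounit, LinearMap.comp_apply, unsym_toAlg, symCounit_quant]

theorem IsAlgHCoproduct.ext {D D' : AlgH V k →ₗ[k[X]] AlgH V k ⊗[k[X]] AlgH V k}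
    {e e' : AlgH V k →ₗ[k[X]] k[X]} (h : IsAlgHCoproduct k D e) (h' : IsAlgHCoproduct k D' e') :
    D = D' ∧ e = e' :=
  ⟨LinearMap.ext_on_range (span_toAlg k) fun a => (h a).1.trans (h' a).1.symm,
    LinearMap.ext_on_range (span_toAlg k) fun a => (h a).2.trans (h' a).2.symm⟩

end HeightCoproduct

end NecklaceMoyal

namespace NecklaceMoyal

open Function

/-! ### The coalgebra structure of `(Sym L)[h]` -/

section Coalgebra

variable {V : Type u} [Quiver.{v} V] {k : Type w} [Field k]

theorem SymL.hom_ext {M : Type*} [AddCommMonoid M] [Module k[X] M] {f g : SymL V k →ₗ[k[X]] M}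
    (h : ∀ (X : Type) [Finite X] (G : Diagram V X), G.IsPath →
      f (G.val k fun _ => True) = g (G.val k fun _ => True)) : f = g := by
  refine (MvPolynomial.basisMonomials (Necklace V) k[X]).ext fun m => ?_
  rw [MvPolynomial.coe_basisMonomials]
  dsimp only
  rw [← Collection.toSym_present k m, Collection.toSym_eq_val]
  exact h _ _ (Collection.isPath_toDiag _)

/-- Two monomials can be realized as complementary parts of one diagram, namely that of the union of
their presentations. -/
theorem SymL.hom_ext₂ {M : Type*} [AddCommMonoid M] [Module k[X] M]
    {f g : SymL V k →ₗ[k[X]] SymL V k →ₗ[k[X]] M}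
    (h : ∀ (X : Type) [Finite X] (G : Diagram V X) (p p' : X → Prop), G.IsPath → G.Inv p →
      G.Inv p' → (∀ x, p' x ↔ ¬ p x) → f (G.val k p) (G.val k p') = g (G.val k p) (G.val k p')) :
    f = g := by
  refine (MvPolynomial.basisMonomials (Necklace V) k[X]).ext fun m =>
    (MvPolynomial.basisMonomials (Necklace V) k[X]).ext fun m' => ?_
  rw [MvPolynomial.coe_basisMonomials]
  dsimp only
  rw [← Collection.toSym_present k m, ← Collection.toSym_present k m',
    ← Collection.val_onLeft (present m) (present m') k,
    ← Collection.val_onRight (present m) (present m') k]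
  exact h _ _ _ _ (Collection.isPath_toDiag _) (Collection.inv_onLeft _ _)
    (Collection.inv_onRight _ _) fun _ => Iff.rfl

namespace Diagram

variable {X : Type} [Finite X] {G : Diagram V X} {ht : X → ℕ} {p p' : X → Prop}

theorem val_of_forall_not (hp : ∀ x, ¬ p x) : G.val k p = 1 :=
  Finset.prod_eq_one fun _ _ => if_neg (hp _)

theorem Flow.symCounit_val {n : ℕ} (hG : G.IsPath) {c : X → Fin n} {ψ : Equiv.Perm X}
    (hψ : G.IsPairing ψ) (h : G.Flow c ψ) {x : X} :
    symCounit V k ((G.glue ψ).val k fun z => c z = c x) = 0 :=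
  Diagram.symCounit_val (hG.glue hψ) (h.inv (c x)) rfl

omit [Finite X] in
theorem colW_const (a : Fin 2) (x y : X) : G.colW k (fun _ => True) (fun _ => a) x y = 0 := by
  rw [colW, if_pos ⟨trivial, trivial⟩, colSign_self, Int.cast_zero, mul_zero]

/-- Here `a` is the colour of the factor to which the counit is applied. If some point has colour
`a`, that factor is a nonempty product and is killed. The remaining constant colouring `b` has all
weights `0`, so only the identity pairing survives. -/
theorem comulForm_counit [CharZero k] (hG : G.IsPath) (hs : G.Separates ht) (a b : Fin 2)
    (hab : ∀ c, c ≠ a → c = b) (hba : b ≠ a) {M : Type*} [AddCommGroup M] [Module k[X] M]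
    (L : SymL V k ⊗[k[X]] SymL V k →ₗ[k[X]] M) (F : SymL V k → SymL V k → M)
    (hL : ∀ f : Fin 2 → SymL V k, L (f 0 ⊗ₜ f 1) = F (f a) (f b))
    (hF : ∀ f g, symCounit V k f = 0 → F f g = 0) :
    L (moyalComul V k (G.val k fun _ => True)) = F 1 (G.val k fun _ => True) := by
  classical
  rw [moyalComul_val hG inv_true, comulForm_eq_sum_flow hs, map_sum,
    Finset.sum_eq_single fun _ => b]
  · rw [psum_of_weight_eq_zero hs (colW_const b), if_pos (show G.Flow (fun _ => b) 1 from fun _ => rfl), glue_one,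
      hL fun i => G.val k fun _ => b = i, val_of_forall_not fun _ => hba]
    simp
  · intro c _ hc
    obtain ⟨x, hx⟩ : ∃ x, c x ≠ b := by
      by_contra h
      push Not at h
      exact hc (funext h)
    have hx : c x = a := by
      by_contra h
      exact hx (hab _ h)
    rw [map_psum (M := SymL V k ⊗[k[X]] SymL V k) L, psum]
    refine Finset.sum_eq_zero fun ψ hψ => ?_
    split_ifs with h
    · rw [hL fun i => (G.glue ψ).val k fun z => c z = i, hF _ _ (by
        rw [← hx]
        exact h.symCounit_val hG (mem_pairings.1 hψ)), smul_zero]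
    · rw [map_zero, smul_zero]
  · exact fun h => absurd (mem_cols.2 fun _ h => absurd trivial h) h

end Diagram

variable (V k) in
theorem symCounit_one : symCounit V k 1 = 1 := by
  show MvPolynomial.aeval (fun _ => (0 : k[X])) 1 = 1
  exact map_one _

variable [CharZero k]

theorem rTensor_symCounit_moyalComul (f : SymL V k) :
    (symCounit V k).rTensor (SymL V k) (moyalComul V k f) = 1 ⊗ₜ[k[X]] f := by
  have : (symCounit V k).rTensor (SymL V k) ∘ₗ moyalComul V k
      = TensorProduct.mk k[X] k[X] (SymL V k) 1 := by
    refine SymL.hom_ext fun X _ G hG => ?_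
    have := Diagram.comulForm_counit hG Diagram.separates_qht 0 1 (by decide) (by decide)
      ((symCounit V k).rTensor (SymL V k)) (fun f g => symCounit V k f ⊗ₜ[k[X]] g)
      (fun f => LinearMap.rTensor_tmul _ _ _ _) fun f g h => by rw [h, TensorProduct.zero_tmul]
    exact this.trans (congrArg (· ⊗ₜ[k[X]] _) (symCounit_one V k))
  exact LinearMap.congr_fun this f

theorem lTensor_symCounit_moyalComul (f : SymL V k) :
    (symCounit V k).lTensor (SymL V k) (moyalComul V k f) = f ⊗ₜ[k[X]] 1 := by
  have : (symCounit V k).lTensor (SymL V k) ∘ₗ moyalComul V k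
      = (TensorProduct.mk k[X] (SymL V k) k[X]).flip 1 := by
    refine SymL.hom_ext fun X _ G hG => ?_
    have := Diagram.comulForm_counit hG Diagram.separates_qht 1 0 (by decide) (by decide)
      ((symCounit V k).lTensor (SymL V k)) (fun f g => g ⊗ₜ[k[X]] symCounit V k f)
      (fun f => LinearMap.lTensor_tmul _ _ _ _) fun f g h => by rw [h, TensorProduct.tmul_zero]
    exact this.trans (congrArg (_ ⊗ₜ[k[X]] ·) (symCounit_one V k))
  exact LinearMap.congr_fun this f

variable (V k)

theorem moyalComul_one : moyalComul V k 1 = 1 ⊗ₜ[k[X]] 1 := by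
  classical
  let G : Diagram V Empty := ⟨1, Empty.elim⟩
  have hv : ∀ p : Empty → Prop, G.val k p = 1 := fun p => Diagram.val_of_forall_not fun x => x.elim
  have hG : G.IsPath := fun x => x.elim
  rw [← hv fun _ => True, Diagram.moyalComul_val hG Diagram.inv_true,
    Diagram.comulForm_eq_sum_flow Diagram.separates_qht, Finset.sum_eq_single fun _ => 0]
  · rw [Diagram.psum_of_weight_eq_zero Diagram.separates_qht fun x => x.elim,
      if_pos (show G.Flow (fun _ => 0) 1 from fun x => x.elim), Diagram.glue_one, hv, hv, hv]
  · exact fun c _ hc => absurd (funext fun x => x.elim) hc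
  · exact fun h => absurd (Diagram.mem_cols.2 fun x => x.elim) h

variable {V k}

/-- Gluing never removes the last component, since an orbit consumed entirely becomes an idempotent.
So both sides vanish unless the diagram is empty. -/
theorem symCounit_moyalMul (f g : SymL V k) :
    symCounit V k (moyalMul V k f g) = symCounit V k f * symCounit V k g := by
  have : (moyalMul V k).compr₂ (symCounit V k)
      = (LinearMap.mul k[X] k[X]).compl₁₂ (symCounit V k) (symCounit V k) := by
    refine SymL.hom_ext₂ fun X _ G p p' hG hp hp' hd => ?_
    rw [LinearMap.compr₂_apply, LinearMap.compl₁₂_apply, LinearMap.mul_apply',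
      Diagram.moyalMul_val hG hp hp' (fun x h h' => (hd x).1 h' h), Diagram.mulForm]
    have hd' : ∀ x, p x ∨ p' x := fun x => by rw [hd]; exact em _
    rcases isEmpty_or_nonempty X with hX | ⟨⟨x⟩⟩
    · rw [Diagram.psum_of_weight_eq_zero Diagram.separates_qht fun x => isEmptyElim x,
        Diagram.val_of_forall_not fun x => isEmptyElim x,
        Diagram.val_of_forall_not fun x => isEmptyElim x,
        Diagram.val_of_forall_not fun x => isEmptyElim x, symCounit_one, one_mul]
    · have h0 : symCounit V k (G.val k p) * symCounit V k (G.val k p') = 0 := by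
        rcases hd' x with h | h
        · rw [Diagram.symCounit_val hG hp h, zero_mul]
        · rw [Diagram.symCounit_val hG hp' h, mul_zero]
      rw [h0, Diagram.map_psum, Diagram.psum]
      refine Finset.sum_eq_zero fun ψ hψ => ?_
      have e : (fun x => p x ∨ p' x) = fun _ => True := funext fun x => eq_true (hd' x)
      rw [e, Diagram.symCounit_val (hG.glue (Diagram.mem_pairings.1 hψ)) Diagram.inv_true
        (x := x) trivial, smul_zero]
  exact LinearMap.congr_fun₂ this f g

/-! ### Coassociativity -/

namespace Diagram

variable {X : Type} [Finite X] {G : Diagram V X} {ht : X → ℕ}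

open Classical in
-- Refining the colour `a` by a second 2-colouring is the same as giving a 3-colouring: `m` merges
-- the two colours, and `i`, `j` recover them.
theorem sum_cols_recolor {M : Type*} [AddCommMonoid M] (a : Fin 2) (m : Fin 2 → Fin 2 → Fin 3)
    (i j : Fin 3 → Fin 2) (h₁ : ∀ s t, (s ≠ a → t = 0) → i (m s t) = s ∧ j (m s t) = t)
    (h₂ : ∀ r, m (i r) (j r) = r ∧ (i r ≠ a → j r = 0)) (Φ : (X → Fin 3) → M) :
    ∑ c ∈ cols 2 fun _ : X => True, ∑ d ∈ cols 2 fun x => c x = a, Φ (fun x => m (c x) (d x))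
      = ∑ g ∈ cols 3 fun _ : X => True, Φ g := by
  rw [Finset.sum_sigma']
  refine Finset.sum_bij' (fun q _ x => m (q.1 x) (q.2 x)) (fun g _ => ⟨i ∘ g, j ∘ g⟩) ?_ ?_ ?_ ?_ ?_
  · exact fun _ _ => mem_cols.2 fun _ h => absurd trivial h
  · intro g _
    rw [Finset.mem_sigma]
    exact ⟨mem_cols.2 fun _ h => absurd trivial h, mem_cols.2 fun x => (h₂ (g x)).2⟩
  · rintro ⟨c, d⟩ h
    have hd := mem_cols.1 (Finset.mem_sigma.1 h).2
    rw [Sigma.mk.injEq, heq_eq_eq]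
    exact ⟨funext fun x => (h₁ _ _ (hd x)).1, funext fun x => (h₁ _ _ (hd x)).2⟩
  · exact fun g _ => funext fun x => (h₂ (g x)).1
  · exact fun _ _ => rfl

open Classical in
/-- The iterated coproduct, applied to one of the two factors. -/
theorem comulForm_comul (hG : G.IsPath) (hs : G.Separates ht) (a b : Fin 2) (hab : a ≠ b)
    {M : Type*} [AddCommGroup M] [Module k[X] M]
    (B : SymL V k →ₗ[k[X]] SymL V k ⊗[k[X]] SymL V k →ₗ[k[X]] M)
    (L : SymL V k ⊗[k[X]] SymL V k →ₗ[k[X]] M)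
    (hL : ∀ f : Fin 2 → SymL V k, L (f 0 ⊗ₜ f 1) = B (f b) (moyalComul V k (f a))) :
    L (moyalComul V k (G.val k fun _ => True))
      = ∑ c ∈ cols 2 fun _ : X => True, ∑ d ∈ cols 2 fun x => c x = a,
        psum G ht (fun x y => G.colW k (fun _ => True) c x y + G.colW k (fun x => c x = a) d x y)
          fun ψ => if G.Flow c ψ ∧ G.Flow d ψ then B ((G.glue ψ).val k fun x => c x = b)
            ((G.glue ψ).val k (fun x => c x = a ∧ d x = 0) ⊗ₜ
              (G.glue ψ).val k (fun x => c x = a ∧ d x = 1)) else 0 := by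
  rw [moyalComul_val hG inv_true, comulForm_eq_sum_flow hs, map_sum]
  refine Finset.sum_congr rfl fun c _ => ?_
  have e : ∀ ψ₁, G.IsPairing ψ₁ → L (if G.Flow c ψ₁ then (G.glue ψ₁).val k (fun x => c x = 0)
        ⊗ₜ[k[X]] (G.glue ψ₁).val k (fun x => c x = 1) else 0)
      = ∑ d ∈ cols 2 fun x => c x = a, if G.Flow c ψ₁ then psum (G.glue ψ₁) ht
        (G.colW k (fun x => c x = a) d) fun ψ₂ => if G.Flow d (ψ₁ * ψ₂) then
          B ((G.glue (ψ₁ * ψ₂)).val k fun x => c x = b)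
            ((G.glue (ψ₁ * ψ₂)).val k (fun x => c x = a ∧ d x = 0) ⊗ₜ
              (G.glue (ψ₁ * ψ₂)).val k (fun x => c x = a ∧ d x = 1)) else 0 else 0 := by
    intro ψ₁ h₁
    split_ifs with h
    · rw [hL fun i => (G.glue ψ₁).val k fun z => c z = i,
        moyalComul_val (hG.glue h₁) (h.inv a), comulForm_eq (hs.glue ψ₁), map_sum]
      refine Finset.sum_congr rfl fun d _ => ?_
      rw [map_psum (M := SymL V k ⊗[k[X]] SymL V k) (B ((G.glue ψ₁).val k fun z => c z = b))]
      refine psum_congr (fun ψ₂ h₂ => Finset.prod_congr rfl fun x hx => ?_) fun ψ₂ h₂ hne => ?_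
      · exact colW_glue (((isPairing_glue.1 h₂).2 x).resolve_right (ne_of_mem_low hx))
      -- The pairs of the second coproduct lie in colour `a`, so the factor of colour `b` can also
      -- be read off after gluing along them.
      · have hsupp : ∀ x, ψ₂ x ≠ x → c x = a := fun x =>
          supp_of_weight (p := fun x => c x = a) (hs.glue ψ₁)
            (colW_supp (G := G.glue ψ₁) (k := k) _ d) h₂ hne
        obtain ⟨h₂, hdis⟩ := isPairing_glue.1 h₂
        rw [← val_glue_mul hG h₁ h₂ hdis (h.inv b) fun x hx h' => hab ((hsupp x hx).symm.trans h'),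
          glue_glue hdis]
        by_cases hf : G.Flow d (ψ₁ * ψ₂)
        · rw [if_pos hf, if_pos (show ∀ x, d ((G.glue ψ₁).next (ψ₂ x)) = d x from hf)]
        · rw [if_neg hf, if_neg (show ¬ ∀ x, d ((G.glue ψ₁).next (ψ₂ x)) = d x from hf), map_zero]
    · rw [map_zero, Finset.sum_const_zero]
  rw [map_psum (M := SymL V k ⊗[k[X]] SymL V k) L, psum_congr (fun _ _ => rfl) fun ψ₁ h₁ _ => e ψ₁ h₁, psum_sum]
  refine Finset.sum_congr rfl fun d _ => ?_
  rw [psum_glue_flow hs c (b := G.colW k (fun x => c x = a) d)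
    (b' := G.colW k (fun x => c x = a) d) (fun _ _ _ => rfl)
    (fun x y h => (colW_supp (G := G) (k := k) _ d x y h).2.trans
      (colW_supp (G := G) (k := k) _ d x y h).1.symm)
    fun ψ => if G.Flow d ψ then B ((G.glue ψ).val k fun x => c x = b)
      ((G.glue ψ).val k (fun x => c x = a ∧ d x = 0) ⊗ₜ
        (G.glue ψ).val k (fun x => c x = a ∧ d x = 1)) else 0]
  refine psum_congr (fun _ _ => rfl) fun ψ _ _ => ?_
  rw [ite_and]

open Classical in
/-- The twofold coproduct of a diagram. -/
noncomputable def comulForm₃ (G : Diagram V X) (k : Type w) [Field k] :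
    SymL V k ⊗[k[X]] (SymL V k ⊗[k[X]] SymL V k) :=
  ∑ g ∈ cols 3 fun _ : X => True, psum G G.qht (G.colW k (fun _ => True) g) fun ψ =>
    if G.Flow g ψ then (G.glue ψ).val k (fun x => g x = 0) ⊗ₜ[k[X]]
      ((G.glue ψ).val k (fun x => g x = 1) ⊗ₜ[k[X]] (G.glue ψ).val k fun x => g x = 2) else 0

omit [Finite X] [CharZero k] in
-- Points whose first colours differ keep the sign of that difference, and points of common colour
-- `a` receive the sign of the second difference. By `hw`, the sum is the sign of the difference of
-- the merged colours.
theorem colW_recolor {a : Fin 2} {m : Fin 2 → Fin 2 → Fin 3}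
    (hw : ∀ s t s' t', (s ≠ a → t = 0) → (s' ≠ a → t' = 0) → colSign s s' +
      (if s = a ∧ s' = a then colSign t t' else 0) = colSign (m s t) (m s' t'))
    {c d : X → Fin 2} (hd : ∀ x, c x ≠ a → d x = 0) (x y : X) :
    G.colW k (fun _ => True) c x y + G.colW k (fun x => c x = a) d x y
      = G.colW k (fun _ => True) (fun x => m (c x) (d x)) x y := by
  have e : ∀ {n : ℕ} (g : X → Fin n), G.colW k (fun _ => True) g x y
      = G.wgt k x * (colSign (g x) (g y) : k[X]) := fun g => if_pos ⟨trivial, trivial⟩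
  rw [e, e, ← hw _ _ _ _ (hd x) (hd y), Int.cast_add, mul_add, colW]
  congr 1
  split_ifs
  · rfl
  · rw [Int.cast_zero, mul_zero]

omit [Finite X] in
theorem flow_recolor {a : Fin 2} {m : Fin 2 → Fin 2 → Fin 3} {i j : Fin 3 → Fin 2}
    (h₁ : ∀ s t, (s ≠ a → t = 0) → i (m s t) = s ∧ j (m s t) = t)
    {c d : X → Fin 2} (hd : ∀ x, c x ≠ a → d x = 0) (ψ : Equiv.Perm X) :
    (G.Flow c ψ ∧ G.Flow d ψ) ↔ G.Flow (fun x => m (c x) (d x)) ψ := by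
  constructor
  · intro h x
    show m _ _ = m _ _
    rw [h.1 x, h.2 x]
  · refine fun h => ⟨fun x => ?_, fun x => ?_⟩
    · rw [← (h₁ _ _ (hd x)).1, ← (h₁ _ _ (hd (G.next (ψ x)))).1]
      exact congrArg i (h x)
    · rw [← (h₁ _ _ (hd x)).2, ← (h₁ _ _ (hd (G.next (ψ x)))).2]
      exact congrArg j (h x)

/-- Covers both bracketings of the iterated coproduct at once. Apart from the rearrangement `hB` of
tensor factors, what remains to be checked about `m`, `i`, `j` is a finite statement on colours. -/
theorem comulForm_comul_recolor (hG : G.IsPath) (a b : Fin 2) (hab : a ≠ b)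
    (B : SymL V k →ₗ[k[X]] SymL V k ⊗[k[X]] SymL V k →ₗ[k[X]]
      SymL V k ⊗[k[X]] (SymL V k ⊗[k[X]] SymL V k))
    (L : SymL V k ⊗[k[X]] SymL V k →ₗ[k[X]] SymL V k ⊗[k[X]] (SymL V k ⊗[k[X]] SymL V k))
    (hL : ∀ f : Fin 2 → SymL V k, L (f 0 ⊗ₜ f 1) = B (f b) (moyalComul V k (f a)))
    (m : Fin 2 → Fin 2 → Fin 3) (i j : Fin 3 → Fin 2)
    (h₁ : ∀ s t, (s ≠ a → t = 0) → i (m s t) = s ∧ j (m s t) = t)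
    (h₂ : ∀ r, m (i r) (j r) = r ∧ (i r ≠ a → j r = 0))
    (hw : ∀ s t s' t', (s ≠ a → t = 0) → (s' ≠ a → t' = 0) → colSign s s' +
      (if s = a ∧ s' = a then colSign t t' else 0) = colSign (m s t) (m s' t'))
    (hB : ∀ (ψ : Equiv.Perm X) (c d : X → Fin 2), (∀ x, c x ≠ a → d x = 0) →
      B ((G.glue ψ).val k fun x => c x = b) ((G.glue ψ).val k (fun x => c x = a ∧ d x = 0) ⊗ₜ
        (G.glue ψ).val k (fun x => c x = a ∧ d x = 1))
      = (G.glue ψ).val k (fun x => m (c x) (d x) = 0) ⊗ₜ ((G.glue ψ).val k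
        (fun x => m (c x) (d x) = 1) ⊗ₜ (G.glue ψ).val k fun x => m (c x) (d x) = 2)) :
    L (moyalComul V k (G.val k fun _ => True)) = G.comulForm₃ k := by
  classical
  rw [comulForm₃, ← sum_cols_recolor a m i j h₁ h₂]
  refine (comulForm_comul (M := SymL V k ⊗[k[X]] (SymL V k ⊗[k[X]] SymL V k)) hG separates_qht
    a b hab B L hL).trans ?_
  refine Finset.sum_congr rfl fun c _ => Finset.sum_congr rfl fun d hd => ?_
  have hd := mem_cols.1 hd
  refine psum_congr (fun ψ _ => Finset.prod_congr rfl fun x _ => colW_recolor hw hd x _)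
    fun ψ _ _ => ?_
  rw [hB ψ c d hd]
  exact if_congr (flow_recolor h₁ hd ψ) rfl rfl

end Diagram

theorem moyalComul_coassoc (f : SymL V k) :
    TensorProduct.assoc k[X] (SymL V k) (SymL V k) (SymL V k)
      ((moyalComul V k).rTensor (SymL V k) (moyalComul V k f))
      = (moyalComul V k).lTensor (SymL V k) (moyalComul V k f) := by
  have : ((TensorProduct.assoc k[X] (SymL V k) (SymL V k) (SymL V k)).toLinearMap ∘ₗ
      (moyalComul V k).rTensor (SymL V k)) ∘ₗ moyalComul V k
      = (moyalComul V k).lTensor (SymL V k) ∘ₗ moyalComul V k := by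
    refine SymL.hom_ext fun X _ G hG => ?_
    trans G.comulForm₃ k
    -- The coproduct is applied again to the first factor: colour `0` is split into `0` and `1`, and
    -- colour `1` becomes `2`.
    · refine Diagram.comulForm_comul_recolor hG 0 1 (by decide)
        ((TensorProduct.mk k[X] (SymL V k ⊗[k[X]] SymL V k) (SymL V k)).flip.compr₂
          (TensorProduct.assoc k[X] (SymL V k) (SymL V k) (SymL V k)).toLinearMap)
        ((TensorProduct.assoc k[X] (SymL V k) (SymL V k) (SymL V k)).toLinearMap ∘ₗ
          (moyalComul V k).rTensor (SymL V k))
        (fun f => rfl) (fun s t => if s = 1 then 2 else if t = 0 then 0 else 1)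
        (fun r => if r = 2 then 1 else 0) (fun r => if r = 1 then 1 else 0)
        (by decide) (by decide) (by decide) fun ψ c d hd => ?_
      have h : ∀ s t : Fin 2, (s ≠ 0 → t = 0) →
          ((s = 1 ↔ (if s = 1 then (2 : Fin 3) else if t = 0 then 0 else 1) = 2) ∧
          (s = 0 ∧ t = 0 ↔ (if s = 1 then (2 : Fin 3) else if t = 0 then 0 else 1) = 0) ∧
          (s = 0 ∧ t = 1 ↔ (if s = 1 then (2 : Fin 3) else if t = 0 then 0 else 1) = 1)) := by
        decide
      rw [funext fun x => propext (h (c x) (d x) (hd x)).1,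
        funext fun x => propext (h (c x) (d x) (hd x)).2.1,
        funext fun x => propext (h (c x) (d x) (hd x)).2.2]
      rfl
    -- The coproduct is applied again to the second factor: colour `0` is kept, and colour `1` is
    -- split into `1` and `2`.
    · refine (Diagram.comulForm_comul_recolor hG 1 0 (by decide)
        (TensorProduct.mk k[X] (SymL V k) (SymL V k ⊗[k[X]] SymL V k))
        ((moyalComul V k).lTensor (SymL V k))
        (fun f => rfl) (fun s t => if s = 0 then 0 else if t = 0 then 1 else 2)
        (fun r => if r = 0 then 0 else 1) (fun r => if r = 2 then 1 else 0)
        (by decide) (by decide) (by decide) fun ψ c d hd => ?_).symm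
      have h : ∀ s t : Fin 2, (s ≠ 1 → t = 0) →
          ((s = 0 ↔ (if s = 0 then (0 : Fin 3) else if t = 0 then 1 else 2) = 0) ∧
          (s = 1 ∧ t = 0 ↔ (if s = 0 then (0 : Fin 3) else if t = 0 then 1 else 2) = 1) ∧
          (s = 1 ∧ t = 1 ↔ (if s = 0 then (0 : Fin 3) else if t = 0 then 1 else 2) = 2)) := by
        decide
      rw [funext fun x => propext (h (c x) (d x) (hd x)).1,
        funext fun x => propext (h (c x) (d x) (hd x)).2.1,
        funext fun x => propext (h (c x) (d x) (hd x)).2.2]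
      rfl
  exact LinearMap.congr_fun this f

end Coalgebra

end NecklaceMoyal

namespace NecklaceMoyal

open Function

/-! ### The compatibility of the Moyal product with the Moyal coproduct -/

section Compatibility

variable {V : Type u} [Quiver.{v} V] {k : Type w} [Field k]

namespace Diagram

variable {X : Type} [Finite X] {G : Diagram V X} {ht : X → ℕ} {p p' : X → Prop}

/-- The colouring is constant along the cycles obtained by cutting and gluing, at the points that
satisfy `p`. -/
def FlowOn {n : ℕ} (G : Diagram V X) (p : X → Prop) (c : X → Fin n) (ψ : Equiv.Perm X) : Prop :=
  ∀ x, p x → c (G.next (ψ x)) = c x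

omit [Finite X] in
theorem FlowOn.inv {n : ℕ} {c : X → Fin n} {ψ : Equiv.Perm X} (h : G.FlowOn p c ψ)
    (hp : (G.glue ψ).Inv p) (a : Fin n) : (G.glue ψ).Inv fun x => p x ∧ c x = a := by
  intro x
  refine and_congr_left' (hp x) |>.trans (and_congr_right fun hx => ?_)
  show c (G.next (ψ x)) = a ↔ c x = a
  rw [h x hx]

open Classical in
/-- The summand of the coproduct of the cycles in `p` for a colouring. -/
noncomputable def colourTerm (G : Diagram V X) (k : Type w) [Field k] (p : X → Prop)
    (c : X → Fin 2) (ψ : Equiv.Perm X) : SymL V k ⊗[k[X]] SymL V k :=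
  if G.FlowOn p c ψ then (G.glue ψ).val k (fun x => p x ∧ c x = 0) ⊗ₜ[k[X]]
    (G.glue ψ).val k (fun x => p x ∧ c x = 1) else 0

/-- Contributing pairings fix all points outside `p`, where the colour is `0`, so the flow condition
holds there automatically. -/
theorem comulForm_eq_sum_colourTerm (hs : G.Separates ht) (hp : G.Inv p) :
    G.comulForm k p = ∑ c ∈ cols 2 p, psum G ht (G.colW k p c) (G.colourTerm k p c) := by
  classical
  rw [comulForm_eq hs]
  refine Finset.sum_congr rfl fun c hc => psum_congr (fun _ _ => rfl) fun ψ hψ hne => ?_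
  rw [mem_cols] at hc
  have hsupp : ∀ x, ψ x ≠ x → p x := fun x => supp_of_weight hs (colW_supp p c) hψ hne
  refine if_congr ⟨fun h x _ => h x, fun h x => ?_⟩ rfl rfl
  by_cases hx : p x
  · exact h x hx
  · have e : ψ x = x := by
      by_contra h'
      exact hx (hsupp x h')
    rw [e, hc x hx, hc _ fun h' => hx ((hp x).1 h')]

theorem psum_colourTerm_congr {c c' : X → Fin 2} (hp : G.Inv p) (hs : G.Separates ht)
    (h : ∀ x, p x → c x = c' x) :
    psum G ht (G.colW k p c) (G.colourTerm k p c)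
      = psum G ht (G.colW k p c') (G.colourTerm k p c') := by
  classical
  refine psum_congr (fun ψ _ => Finset.prod_congr rfl fun x _ => ?_) fun ψ hψ hne => ?_
  · rw [colW, colW]
    refine ite_congr rfl (fun hx => ?_) fun _ => rfl
    rw [h _ hx.1, h _ hx.2]
  · have hsupp : ∀ x, ψ x ≠ x → p x := fun x => supp_of_weight hs (colW_supp p c) hψ hne
    have hpi := inv_glue_of_supp hp hψ hsupp
    have e : ∀ a, (fun x => p x ∧ c x = a) = fun x => p x ∧ c' x = a := fun a =>
      funext fun x => propext (and_congr_right fun hx => by rw [h x hx])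
    rw [colourTerm, colourTerm, e, e]
    refine if_congr (forall_congr' fun x => forall_congr' fun hx => ?_) rfl rfl
    rw [h x hx, show c (G.next (ψ x)) = c' (G.next (ψ x)) from h _ ((hpi x).2 hx)]

open Classical in
-- Colourings of two complementary parts are the restrictions of a single colouring of the whole,
-- and `T` depends only on these restrictions.
theorem sum_cols_sum_cols {M : Type*} [AddCommMonoid M] (hd : ∀ x, p' x ↔ ¬ p x)
    (T : (X → Fin 2) → (X → Fin 2) → M)
    (hT : ∀ c c' d d', (∀ x, p x → c x = d x) → (∀ x, p' x → c' x = d' x) → T c c' = T d d') :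
    ∑ c ∈ cols 2 p, ∑ c' ∈ cols 2 p', T c c' = ∑ c ∈ cols 2 fun _ : X => True, T c c := by
  rw [Finset.sum_sigma']
  refine Finset.sum_bij' (fun q _ x => if p x then q.1 x else q.2 x)
    (fun c _ => ⟨fun x => if p x then c x else 0, fun x => if p' x then c x else 0⟩) ?_ ?_ ?_ ?_ ?_
  · exact fun _ _ => mem_cols.2 fun _ h => absurd trivial h
  · intro g _
    rw [Finset.mem_sigma]
    exact ⟨mem_cols.2 fun x hx => if_neg hx, mem_cols.2 fun x hx => if_neg hx⟩
  · rintro ⟨c, c'⟩ h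
    obtain ⟨hc, hc'⟩ := Finset.mem_sigma.1 h
    rw [mem_cols] at hc hc'
    rw [Sigma.mk.injEq, heq_eq_eq]
    refine ⟨funext fun x => ?_, funext fun x => ?_⟩
    · by_cases hx : p x
      · simp only [if_pos hx]
      · simp only [if_neg hx]
        exact (hc x hx).symm
    · by_cases hx : p x
      · have hx' : ¬ p' x := fun h => (hd x).1 h hx
        simp only [if_neg hx']
        exact (hc' x hx').symm
      · simp only [if_neg hx, if_pos ((hd x).2 hx)]
  · intro c _
    funext x
    by_cases hx : p x
    · simp only [if_pos hx]
    · simp only [if_neg hx, if_pos ((hd x).2 hx)]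
  · rintro ⟨c, c'⟩ _
    refine hT _ _ _ _ (fun x hx => (if_pos hx).symm) fun x hx => (if_neg ((hd x).1 hx)).symm

/-- Conservation of colour. The flow condition gives `c (next x) = c (ψ x)`, and `next` permutes
`p`, so the sums of `c ∘ ψ` and of `c` over `p` agree. Pairs inside `p` cancel. Hence the crossing
points of `p` have the same total colour as their partners, and an inequality at one of them forces
a decrease somewhere. -/
theorem Flow.exists_lt {n : ℕ} {c : X → Fin n} {ψ : Equiv.Perm X} (h : G.Flow c ψ)
    (hp : G.Inv p) (hψ : ∀ x, ψ (ψ x) = x) {z : X} (hz : p z) (hz' : ¬ p (ψ z))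
    (hne : c z ≠ c (ψ z)) : ∃ x, p x ∧ ¬ p (ψ x) ∧ c (ψ x) < c x := by
  classical
  have := Fintype.ofFinite X
  by_contra hcon
  push Not at hcon
  have h1 : ∑ x with p x, (c (ψ x) : ℕ) = ∑ x with p x, (c x : ℕ) := by
    refine Finset.sum_equiv G.next (fun x => ?_) fun x _ => ?_
    · rw [Finset.mem_filter, Finset.mem_filter]
      simp only [Finset.mem_univ, true_and]
      exact (hp x).symm
    · rw [← h (ψ x), hψ]
  rw [← Finset.sum_filter_add_sum_filter_not _ fun x => p (ψ x),
    ← Finset.sum_filter_add_sum_filter_not (Finset.univ.filter p) (fun x => p (ψ x))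
      fun x => (c x : ℕ)] at h1
  have h2 : ∑ x ∈ (Finset.univ.filter p).filter fun x => p (ψ x), (c (ψ x) : ℕ)
      = ∑ x ∈ (Finset.univ.filter p).filter fun x => p (ψ x), (c x : ℕ) := by
    refine Finset.sum_equiv ψ (fun x => ?_) fun x _ => rfl
    simp only [Finset.mem_filter, Finset.mem_univ, true_and, hψ]
    exact and_comm
  rw [h2] at h1
  have h3 := (Finset.sum_eq_sum_iff_of_le fun x hx => ?_).1 (add_left_cancel h1).symm z ?_
  · exact hne (Fin.ext h3)
  · simp only [Finset.mem_filter, Finset.mem_univ, true_and] at hx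
    exact hcon x hx.1 hx.2
  · simp [hz, hz']

theorem prod_low_eq_zero {R : Type*} [CommRing R] (hs : G.Separates ht) {ψ : Equiv.Perm X}
    (hψ : G.IsPairing ψ) {a : X → X → R} (ha : ∀ x, ψ x ≠ x → a x (ψ x) = a (ψ x) x) {z : X}
    (hz : ψ z ≠ z) (h0 : a z (ψ z) = 0) : ∏ x ∈ low ht ψ, a x (ψ x) = 0 := by
  rcases hs.lt_or_lt hψ hz with h | h
  · exact Finset.prod_eq_zero (f := fun x => a x (ψ x)) (mem_low.2 h) h0
  · refine Finset.prod_eq_zero (f := fun x => a x (ψ x)) (mem_low.2 h) ?_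
    show a (ψ z) (ψ (ψ z)) = 0
    rw [hψ.1, ← ha z hz, h0]

/-- If all crossing pairs have equal colours, the factors agree one by one. Otherwise the right side
has a zero factor at any crossing pair of unequal colours. On the left, `exists_lt` supplies a
crossing pair whose colour drops from `p` to `p'`, where the two weights cancel. -/
theorem prod_low_cross (hs : G.Separates ht) (hp : G.Inv p) (hd : ∀ x, p' x ↔ ¬ p x)
    {ψ : Equiv.Perm X} (hψ : G.IsPairing ψ) {c : X → Fin 2} (h : G.Flow c ψ) :
    ∏ x ∈ low ht ψ, (G.crossW k p p' x (ψ x) + G.colW k (fun _ => True) c x (ψ x))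
      = ∏ x ∈ low ht ψ, (G.colW k p c x (ψ x) + G.colW k p' c x (ψ x) +
        (G.crossW k (fun x => p x ∧ c x = 0) (fun x => p' x ∧ c x = 0) x (ψ x) +
          G.crossW k (fun x => p x ∧ c x = 1) (fun x => p' x ∧ c x = 1) x (ψ x))) := by
  classical
  by_cases hc : ∀ z, p z → ¬ p (ψ z) → c z = c (ψ z)
  · refine Finset.prod_congr rfl fun x _ => ?_
    by_cases hx : p x <;> by_cases hy : p (ψ x)
    · simp [crossW, colW, hd, hx, hy]
    · have e := hc x hx hy
      have e' : c (ψ x) = 0 ∨ c (ψ x) = 1 := by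
        generalize c (ψ x) = s
        revert s
        decide
      rcases e' with e' | e' <;> simp [crossW, colW, hd, hx, hy, e, e', colSign_self]
    · have e := hc (ψ x) hy (by rwa [hψ.1])
      rw [hψ.1] at e
      have e' : c x = 0 ∨ c x = 1 := by
        generalize c x = s
        revert s
        decide
      rcases e' with e' | e' <;> simp [crossW, colW, hd, hx, hy, e, e', colSign_self]
    · simp [crossW, colW, hd, hx, hy]
  · push Not at hc
    obtain ⟨z, hz, hz', hne⟩ := hc
    have hfix : ∀ {z}, p z → ¬ p (ψ z) → ψ z ≠ z := fun hz hz' e => hz' (by rwa [e])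
    obtain ⟨x, hx, hx', hlt⟩ := h.exists_lt hp hψ.1 hz hz' hne
    have h1 : G.crossW k p p' x (ψ x) + G.colW k (fun _ => True) c x (ψ x) = 0 := by
      have e : c x = 1 ∧ c (ψ x) = 0 := by
        generalize c x = s at hlt
        generalize c (ψ x) = t at hlt
        revert s t
        decide
      simp [crossW, colW, hd, hx, hx', e, colSign]
    have h2 : G.colW k p c z (ψ z) + G.colW k p' c z (ψ z) +
        (G.crossW k (fun x => p x ∧ c x = 0) (fun x => p' x ∧ c x = 0) z (ψ z) +
          G.crossW k (fun x => p x ∧ c x = 1) (fun x => p' x ∧ c x = 1) z (ψ z)) = 0 := by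
      have e : (c z = 0 ∧ c (ψ z) = 1) ∨ (c z = 1 ∧ c (ψ z) = 0) := by
        generalize c z = s at hne
        generalize c (ψ z) = t at hne
        revert s t
        decide
      rcases e with e | e <;> simp [crossW, colW, hd, hz, hz', e]
    refine (prod_low_eq_zero hs hψ (a := fun x y => G.crossW k p p' x y +
      G.colW k (fun _ => True) c x y) (fun x hx => ?_) (hfix hx hx') h1).trans
      (prod_low_eq_zero hs hψ (a := fun x y => G.colW k p c x y + G.colW k p' c x y +
        (G.crossW k (fun x => p x ∧ c x = 0) (fun x => p' x ∧ c x = 0) x y +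
          G.crossW k (fun x => p x ∧ c x = 1) (fun x => p' x ∧ c x = 1) x y))
      (fun x hx => ?_) (hfix hz hz') h2).symm
    · exact congrArg₂ _ (crossW_swap _ _ _ _) (colW_swap hψ _ c hx)
    · exact congrArg₂ _ (congrArg₂ _ (colW_swap hψ _ c hx) (colW_swap hψ _ c hx))
        (congrArg₂ _ (crossW_swap _ _ _ _) (crossW_swap _ _ _ _))

/-- In each tensor factor the Moyal product adds crossing pairs of the colour of that factor; the
two independent sums merge into one by `psum_bilin`. -/
theorem map₂_colourTerm [CharZero k] (hG : G.IsPath) (hs : G.Separates ht)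
    (hd : ∀ x, p' x ↔ ¬ p x) {ψ : Equiv.Perm X} (hψ : G.IsPairing ψ) (hp : (G.glue ψ).Inv p)
    (c : X → Fin 2) :
    TensorProduct.map₂ (moyalMul V k) (moyalMul V k) (G.colourTerm k p c ψ)
      (G.colourTerm k p' c ψ) = open Classical in if G.Flow c ψ then psum (G.glue ψ) ht (fun x y =>
        G.crossW k (fun x => p x ∧ c x = 0) (fun x => p' x ∧ c x = 0) x y +
          G.crossW k (fun x => p x ∧ c x = 1) (fun x => p' x ∧ c x = 1) x y) fun ψ₂ =>
        (G.glue (ψ * ψ₂)).val k (fun x => c x = 0) ⊗ₜ[k[X]]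
          (G.glue (ψ * ψ₂)).val k (fun x => c x = 1) else 0 := by
  classical
  have hp' : (G.glue ψ).Inv p' := fun x => by rw [hd, hd, hp x]
  have hor : ∀ a, (fun x => (p x ∧ c x = a) ∨ p' x ∧ c x = a) = fun x => c x = a := fun a =>
    funext fun x => propext (by rw [← or_and_right, hd, eq_true (em (p x)), true_and])
  split_ifs with h
  · have hf : G.FlowOn p c ψ := fun x _ => h x
    have hf' : G.FlowOn p' c ψ := fun x _ => h x
    have hm : ∀ a, moyalMul V k ((G.glue ψ).val k fun x => p x ∧ c x = a)
        ((G.glue ψ).val k fun x => p' x ∧ c x = a) = psum (G.glue ψ) ht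
          (G.crossW k (fun x => p x ∧ c x = a) fun x => p' x ∧ c x = a) fun ψ₂ =>
          ((G.glue ψ).glue ψ₂).val k fun x => c x = a := by
      intro a
      rw [moyalMul_val (hG.glue hψ) (hf.inv hp a) (hf'.inv hp' a) (fun x h h' =>
        (hd x).1 h'.1 h.1), mulForm, hor, psum_change_ht separates_qht (hs.glue ψ) fun _ _ x _ =>
        crossW_swap _ _ _ _]
      refine psum_congr (fun ψ₂ h₂ => Finset.prod_congr rfl fun x hx => ?_) fun _ _ _ => rfl
      have hx' := ne_of_mem_low hx
      have h₂' := (isPairing_glue.1 h₂).2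
      exact crossW_glue ((h₂' x).resolve_right hx')
        ((h₂' (ψ₂ x)).resolve_right (h₂.apply_ne hx'))
    rw [colourTerm, colourTerm, if_pos hf, if_pos hf', TensorProduct.map₂_apply_tmul,
      TensorProduct.map_tmul, hm, hm]
    have hsupp : ∀ a x y, G.crossW k (fun x => p x ∧ c x = a) (fun x => p' x ∧ c x = a) x y ≠ 0 →
        c x = a ∧ c y = a := fun a x y h => by
      have := crossW_supp (G := G) (k := k) _ _ x y h
      exact ⟨this.1.elim And.right And.right, this.2.elim And.right And.right⟩
    have hinv : ∀ a ψ₁, (G.glue ψ).IsPairing ψ₁ → (∀ x, ψ₁ x ≠ x → c x = a) →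
        ((G.glue ψ).glue ψ₁).Inv fun x => c x = a :=
      fun a ψ₁ h₁ => inv_glue_of_supp (h.inv a) h₁
    have := psum_bilin (L := SymL V k ⊗[k[X]] SymL V k)
      (TensorProduct.mk k[X] (SymL V k) (SymL V k)) (hs.glue ψ) (hsupp 0) (hsupp 1)
      (fun x h h' => by rw [h] at h'; exact absurd h' (by decide))
      (F := fun ψ₂ => ((G.glue ψ).glue ψ₂).val k fun x => c x = 0)
      (F' := fun ψ₂ => ((G.glue ψ).glue ψ₂).val k fun x => c x = 1)
      (fun ψ₁ ψ₂ h₁ h₂ hdis hs₁ hs₂ => val_glue_mul (hG.glue hψ) h₁ h₂ hdis (hinv 0 ψ₁ h₁ hs₁)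
        fun x hx h' => by have := hs₂ x hx; rw [h'] at this; exact absurd this (by decide))
      (fun ψ₁ ψ₂ h₁ h₂ hdis hs₁ hs₂ => val_glue_mul (hG.glue hψ) h₁ h₂ hdis (hinv 1 ψ₁ h₁ hs₁)
        fun x hx h' => by have := hs₂ x hx; rw [h'] at this; exact absurd this (by decide))
    refine this.trans (psum_congr (fun _ _ => rfl) fun ψ₂ h₂ _ => ?_)
    rw [glue_glue (isPairing_glue.1 h₂).2]
    rfl
  · have : ¬ G.FlowOn p c ψ ∨ ¬ G.FlowOn p' c ψ := by
      by_contra hn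
      push Not at hn
      refine h fun x => ?_
      by_cases hx : p x
      · exact hn.1 x hx
      · exact hn.2 x ((hd x).2 hx)
    rcases this with h | h
    · rw [colourTerm, if_neg h, map_zero, LinearMap.zero_apply]
    · rw [colourTerm, colourTerm, if_neg h, map_zero]

/-- Both sides become sums over colourings and pairings of the same diagram with the same summands.
Only the weights differ, and their products agree by `prod_low_cross`. -/
theorem moyalComul_moyalMul_val [CharZero k] (hG : G.IsPath) (hp : G.Inv p)
    (hd : ∀ x, p' x ↔ ¬ p x) :
    moyalComul V k (moyalMul V k (G.val k p) (G.val k p'))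
      = TensorProduct.map₂ (moyalMul V k) (moyalMul V k) (moyalComul V k (G.val k p))
        (moyalComul V k (G.val k p')) := by
  classical
  have hs := G.separates_qht
  have hp' : G.Inv p' := fun x => by rw [hd, hd, hp x]
  have hor : (fun x => p x ∨ p' x) = fun _ => True := funext fun x => by
    rw [hd, eq_true (em (p x))]
  have hterm : ∀ {p p' : X → Prop}, (∀ x, p' x → ¬ p x) → G.Inv p → ∀ c ψ₁ ψ₂, G.IsPairing ψ₁ →
      G.IsPairing ψ₂ → ψ₁.Disjoint ψ₂ → (∀ x, ψ₁ x ≠ x → p x) → (∀ x, ψ₂ x ≠ x → p' x) →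
      G.colourTerm k p c (ψ₁ * ψ₂) = G.colourTerm k p c ψ₁ := by
    intro p p' hd hp c ψ₁ ψ₂ h₁ h₂ hdis hs₁ hs₂
    have e : ∀ x, p x → ψ₂ x = x := fun x hx => by
      by_contra h'
      exact hd x (hs₂ x h') hx
    rw [colourTerm, colourTerm]
    have hiff : G.FlowOn p c (ψ₁ * ψ₂) ↔ G.FlowOn p c ψ₁ :=
      forall_congr' fun x => forall_congr' fun hx => by rw [Equiv.Perm.mul_apply, e x hx]
    refine ite_congr (propext hiff) (fun h => ?_) fun _ => rfl
    have hi := inv_glue_of_supp hp h₁ hs₁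
    rw [val_glue_mul hG h₁ h₂ hdis (h.inv hi 0) fun x hx h' => hd x (hs₂ x hx) h'.1,
      val_glue_mul hG h₁ h₂ hdis (h.inv hi 1) fun x hx h' => hd x (hs₂ x hx) h'.1]
  rw [moyalMul_val hG hp hp' fun x h h' => (hd x).1 h' h, mulForm, hor, moyalComul_psum hG hs,
    moyalComul_val hG hp, moyalComul_val hG hp', comulForm_eq_sum_colourTerm hs hp,
    comulForm_eq_sum_colourTerm hs hp', LinearMap.map_sum₂]
  simp only [map_sum]
  rw [sum_cols_sum_cols hd _ fun c c' d d' h h' => by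
    rw [psum_colourTerm_congr hp hs h, psum_colourTerm_congr hp' hs h']]
  refine Finset.sum_congr rfl fun c _ => ?_
  have hb := psum_bilin (M := SymL V k ⊗[k[X]] SymL V k) (N := SymL V k ⊗[k[X]] SymL V k)
    (L := SymL V k ⊗[k[X]] SymL V k)
    (TensorProduct.map₂ (moyalMul V k) (moyalMul V k)) hs (colW_supp (G := G) (k := k) p c)
    (colW_supp (G := G) (k := k) p' c) (fun x h h' => (hd x).1 h' h)
    (F := G.colourTerm k p c) (F' := G.colourTerm k p' c)
    (hterm (fun x h => (hd x).1 h) hp c) (hterm (fun x h h' => (hd x).1 h' h) hp' c)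
  refine Eq.trans ?_ hb.symm
  rw [psum_congr (fun _ _ => rfl) fun ψ hψ hne => map₂_colourTerm hG hs hd hψ ?_ c]
  · rw [psum_glue_flow hs c (fun _ _ _ => rfl) (fun x y h => ?_)
      fun ψ => (G.glue ψ).val k (fun x => c x = 0) ⊗ₜ[k[X]] (G.glue ψ).val k fun x => c x = 1]
    · refine Finset.sum_congr rfl fun ψ hψ => ?_
      by_cases hf : G.Flow c ψ
      · rw [prod_low_cross hs hp hd (mem_pairings.1 hψ) hf]
      · simp only [if_neg hf, smul_zero]
    · by_contra hne
      refine h ?_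
      have e0 : ¬ (c x = 0 ∧ c y = 0) := fun h => hne (h.2.trans h.1.symm)
      have e1 : ¬ (c x = 1 ∧ c y = 1) := fun h => hne (h.2.trans h.1.symm)
      have e : ∀ a, ¬ (c x = a ∧ c y = a) → G.crossW k (fun x => p x ∧ c x = a)
          (fun x => p' x ∧ c x = a) x y = 0 := fun a ha => by
        rw [crossW, if_neg fun h => ha ⟨h.1.2, h.2.2⟩, if_neg fun h => ha ⟨h.1.2, h.2.2⟩, add_zero]
      rw [e 0 e0, e 1 e1, add_zero]
  -- A nonzero weight means that each pair lies within `p` or within `p'`, so gluing does not mix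
  -- the two factors.
  · refine hp.glue fun x => ?_
    by_cases hx : ψ x = x
    · rw [hx]
    · have h1 : (p x ∧ p (ψ x)) ∨ (p' x ∧ p' (ψ x)) := by
        rcases hs.lt_or_lt hψ hx with h | h
        · have := hne x (mem_low.2 h)
          by_contra hn
          push Not at hn
          refine this ?_
          rw [colW, if_neg fun h => hn.1 h.1 h.2, colW, if_neg fun h => hn.2 h.1 h.2, add_zero]
        · have := hne _ (mem_low.2 h)
          rw [hψ.1] at this
          by_contra hn
          push Not at hn
          refine this ?_
          rw [colW, if_neg fun h => hn.1 h.2 h.1, colW, if_neg fun h => hn.2 h.2 h.1, add_zero]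
      rcases h1 with h1 | h1
      · exact iff_of_true h1.2 h1.1
      · exact iff_of_false ((hd _).1 h1.2) ((hd _).1 h1.1)

end Diagram

variable [CharZero k]

theorem moyalComul_moyalMul (f g : SymL V k) : moyalComul V k (moyalMul V k f g)
    = TensorProduct.map₂ (moyalMul V k) (moyalMul V k) (moyalComul V k f) (moyalComul V k g) := by
  have : (moyalMul V k).compr₂ (moyalComul V k)
      = (TensorProduct.map₂ (moyalMul V k) (moyalMul V k)).compl₁₂ (moyalComul V k)
        (moyalComul V k) :=
    SymL.hom_ext₂ fun X _ G p p' hG hp _ hd => by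
      rw [LinearMap.compr₂_apply, LinearMap.compl₁₂_apply]
      exact Diagram.moyalComul_moyalMul_val hG hp hd
  exact LinearMap.congr_fun₂ this f g

variable (V k)

theorem isBialgebra_symL :
    IsBialgebra (moyalMul V k) 1 (moyalComul V k) (symCounit V k) where
  mul_assoc := moyalMul_assoc k
  one_mul := moyalMul_one_left k
  mul_one := moyalMul_one_right k
  coassoc := moyalComul_coassoc
  rTensor_counit_comul := rTensor_symCounit_moyalComul
  lTensor_counit_comul := lTensor_symCounit_moyalComul
  comul_one := moyalComul_one V k
  comul_mul := moyalComul_moyalMul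
  counit_one := symCounit_one V k
  counit_mul := symCounit_moyalMul

end Compatibility

end NecklaceMoyal

namespace NecklaceMoyal

open Function

/-! ### Transport of bialgebra structures -/

section Transport

variable {R : Type*} {B B' : Type*} [CommRing R] [AddCommGroup B] [Module R B] [AddCommGroup B']
  [Module R B'] {mul : B →ₗ[R] B →ₗ[R] B} {one : B} {comul : B →ₗ[R] B ⊗[R] B}
  {counit : B →ₗ[R] R} {mul' : B' →ₗ[R] B' →ₗ[R] B'} {one' : B'} {comul' : B' →ₗ[R] B' ⊗[R] B'}
  {counit' : B' →ₗ[R] R}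

/-- Each axiom is an identity between composites of structure maps that commute with `Φ`, so
surjectivity of `Φ` is enough. -/
theorem IsBialgebra.of_surjective (h : IsBialgebra mul one comul counit) (Φ : B →ₗ[R] B')
    (hΦ : Surjective Φ) (hmul : ∀ a b, Φ (mul a b) = mul' (Φ a) (Φ b)) (hone : Φ one = one')
    (hcomul : ∀ a, comul' (Φ a) = TensorProduct.map Φ Φ (comul a))
    (hcounit : ∀ a, counit' (Φ a) = counit a) : IsBialgebra mul' one' comul' counit' where
  mul_assoc := by
    intro a b c
    obtain ⟨a, rfl⟩ := hΦ a
    obtain ⟨b, rfl⟩ := hΦ b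
    obtain ⟨c, rfl⟩ := hΦ c
    rw [← hmul, ← hmul, ← hmul, ← hmul, h.mul_assoc]
  one_mul := by
    intro a
    obtain ⟨a, rfl⟩ := hΦ a
    rw [← hone, ← hmul, h.one_mul]
  mul_one := by
    intro a
    obtain ⟨a, rfl⟩ := hΦ a
    rw [← hone, ← hmul, h.mul_one]
  coassoc := by
    intro a
    obtain ⟨a, rfl⟩ := hΦ a
    have e : comul' ∘ₗ Φ = TensorProduct.map Φ Φ ∘ₗ comul := LinearMap.ext hcomul
    rw [hcomul, ← LinearMap.comp_apply, ← LinearMap.comp_apply (comul'.lTensor B'),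
      LinearMap.rTensor_comp_map, LinearMap.lTensor_comp_map, e, ← LinearMap.map_comp_rTensor,
      ← LinearMap.map_comp_lTensor, LinearMap.comp_apply, LinearMap.comp_apply, ← h.coassoc,
      TensorProduct.map_map_assoc]
  rTensor_counit_comul := by
    intro a
    obtain ⟨a, rfl⟩ := hΦ a
    have e : counit' ∘ₗ Φ = LinearMap.id ∘ₗ counit := LinearMap.ext hcounit
    rw [hcomul, ← LinearMap.comp_apply, LinearMap.rTensor_comp_map, e,
      ← LinearMap.map_comp_rTensor, LinearMap.comp_apply, h.rTensor_counit_comul,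
      TensorProduct.map_tmul, LinearMap.id_apply]
  lTensor_counit_comul := by
    intro a
    obtain ⟨a, rfl⟩ := hΦ a
    have e : counit' ∘ₗ Φ = LinearMap.id ∘ₗ counit := LinearMap.ext hcounit
    rw [hcomul, ← LinearMap.comp_apply, LinearMap.lTensor_comp_map, e,
      ← LinearMap.map_comp_lTensor, LinearMap.comp_apply, h.lTensor_counit_comul,
      TensorProduct.map_tmul, LinearMap.id_apply]
  comul_one := by rw [← hone, hcomul, h.comul_one, TensorProduct.map_tmul]
  comul_mul := by
    intro a b
    obtain ⟨a, rfl⟩ := hΦ a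
    obtain ⟨b, rfl⟩ := hΦ b
    rw [← hmul, hcomul, hcomul, hcomul, h.comul_mul]
    induction comul a with
    | zero => simp only [map_zero, LinearMap.zero_apply]
    | add s s' hs hs' => simp only [map_add, LinearMap.add_apply, hs, hs']
    | tmul s s' =>
      induction comul b with
      | zero => simp only [map_zero]
      | add t t' ht ht' => simp only [map_add, ht, ht']
      | tmul t t' =>
        rw [TensorProduct.map₂_apply_tmul, TensorProduct.map_tmul, TensorProduct.map_tmul,
          TensorProduct.map_tmul, TensorProduct.map_tmul, TensorProduct.map₂_apply_tmul,
          TensorProduct.map_tmul, hmul, hmul]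
  counit_one := by rw [← hone, hcounit, h.counit_one]
  counit_mul := by
    intro a b
    obtain ⟨a, rfl⟩ := hΦ a
    obtain ⟨b, rfl⟩ := hΦ b
    rw [← hmul, hcounit, hcounit, hcounit, h.counit_mul]

end Transport

/-! ### The bialgebra structure of `A_h(Q)` obtained from the Moyal side -/

section Symmetrization

variable {V : Type u} [Quiver.{v} V] {k : Type w} [Field k] [CharZero k]
  {D : AlgH V k →ₗ[k[X]] AlgH V k ⊗[k[X]] AlgH V k} {e : AlgH V k →ₗ[k[X]] k[X]}

theorem IsAlgHCoproduct.comul_symmetrization (h : IsAlgHCoproduct k D e) (f : SymL V k) :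
    D (symmetrization V k f)
      = TensorProduct.map (symmetrization V k) (symmetrization V k) (moyalComul V k f) := by
  rw [(h.ext V k (isAlgHCoproduct_algComul V k)).1, algComul, LinearMap.comp_apply,
    LinearMap.comp_apply, unsym_symmetrization]

theorem IsAlgHCoproduct.counit_symmetrization (h : IsAlgHCoproduct k D e) (f : SymL V k) :
    e (symmetrization V k f) = symCounit V k f := by
  rw [(h.ext V k (isAlgHCoproduct_algComul V k)).2, algCounit, LinearMap.comp_apply,
    unsym_symmetrization]

theorem IsAlgHCoproduct.isBialgebra (h : IsAlgHCoproduct k D e) :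
    IsBialgebra (B := AlgH V k) (LinearMap.mul k[X] (AlgH V k)) 1 D e :=
  (isBialgebra_symL V k).of_surjective (symmetrization V k) (symmetrization_bijective k).2
    (symmetrization_mul k) (symmetrization_one k) h.comul_symmetrization h.counit_symmetrization

end Symmetrization

end NecklaceMoyal

theorem mainTheorem3 (k : Type w) [Field k] [CharZero k] (V : Type u) [Quiver.{v} V] :
    -- the explicit expressions, for every presentation of a collection of necklaces
    (∀ (X W : Type) [Fintype X] [Fintype W] (P : NecklaceMoyal.Collection V X W),
      NecklaceMoyal.moyalComul V k (P.toSym k) = P.comulSum k ∧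
      NecklaceMoyal.symmetrization V k (P.toSym k) = P.average k ∧
      ∀ (X' W' : Type) [Fintype X'] [Fintype W'] (R : NecklaceMoyal.Collection V X' W'),
        NecklaceMoyal.moyalMul V k (P.toSym k) (R.toSym k) = P.mulSum k R) ∧
    -- the coproduct and the counit of `A_h(Q)` exist and are unique
    (∃! p : (NecklaceMoyal.AlgH V k →ₗ[k[X]]
          NecklaceMoyal.AlgH V k ⊗[k[X]] NecklaceMoyal.AlgH V k) ×
        (NecklaceMoyal.AlgH V k →ₗ[k[X]] k[X]),
      NecklaceMoyal.IsAlgHCoproduct k p.1 p.2) ∧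
    -- `A_h(Q)` is a bialgebra and `Φ_W` is an isomorphism of bialgebras
    (∀ (D : NecklaceMoyal.AlgH V k →ₗ[k[X]]
          NecklaceMoyal.AlgH V k ⊗[k[X]] NecklaceMoyal.AlgH V k)
        (e : NecklaceMoyal.AlgH V k →ₗ[k[X]] k[X]), NecklaceMoyal.IsAlgHCoproduct k D e →
      NecklaceMoyal.IsBialgebra (LinearMap.mul k[X] (NecklaceMoyal.AlgH V k)) 1 D e ∧
      Function.Bijective (NecklaceMoyal.symmetrization V k) ∧
      NecklaceMoyal.symmetrization V k 1 = 1 ∧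
      (∀ f g, NecklaceMoyal.symmetrization V k (NecklaceMoyal.moyalMul V k f g) =
        NecklaceMoyal.symmetrization V k f * NecklaceMoyal.symmetrization V k g) ∧
      (∀ f, D (NecklaceMoyal.symmetrization V k f) =
        TensorProduct.map (NecklaceMoyal.symmetrization V k) (NecklaceMoyal.symmetrization V k)
          (NecklaceMoyal.moyalComul V k f)) ∧
      ∀ f, e (NecklaceMoyal.symmetrization V k f) = NecklaceMoyal.symCounit V k f) ∧
    -- `(Sym L)[h]` with the Moyal product and coproduct is a bialgebra
    NecklaceMoyal.IsBialgebra (NecklaceMoyal.moyalMul V k) 1 (NecklaceMoyal.moyalComul V k)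
      (NecklaceMoyal.symCounit V k) := by
  refine ⟨fun X W _ _ P => ⟨P.moyalComul_toSym k, P.symmetrization_toSym k,
    fun X' W' _ _ R => P.moyalMul_toSym k R⟩, ?_, fun D e h => ?_,
    NecklaceMoyal.isBialgebra_symL V k⟩
  · refine ⟨(NecklaceMoyal.algComul V k, NecklaceMoyal.algCounit V k),
      NecklaceMoyal.isAlgHCoproduct_algComul V k, fun p hp => ?_⟩
    have h := hp.ext V k (NecklaceMoyal.isAlgHCoproduct_algComul V k)
    exact Prod.ext h.1 h.2
  · exact ⟨h.isBialgebra, NecklaceMoyal.symmetrization_bijective k,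
      NecklaceMoyal.symmetrization_one k, NecklaceMoyal.symmetrization_mul k,
      h.comul_symmetrization, h.counit_symmetrization⟩
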